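/- Let $k$ be an algebraically closed field of characteristic zero and let $A$ be a finitely generated commutative associative unital $k$-algebra. Let $\mathfrak g=\mathfrak g_{\bar 0}\oplus\mathfrak g_{\bar 1}$ be either * a basic classical Lie superalgebra over $k$ of type I, that is, a finite dimensional simple Lie superalgebra with a non-degenerate invariant bilinear form, such that the $\mathfrak g_{\bar 0}$-module $\mathfrak g_{\bar 1}$ is completely reducible and is the direct sum of two irreducible modules; or * $\mathfrak{sl}(n,n)$ for some $n\ge 1$. Then $\mathfrak g$ has a distinguished $\mathbb Z$-grading, i.e. a $\mathbb Z$-grading $\mathfrak g=\mathfrak g_{-1}\oplus\mathfrak g_0\oplus\mathfrak g_1$ of Lie superalgebras with $\mathfrak g_0=\mathfrak g_{\bar 0}$ and $\mathfrak g_{-1}\oplus\mathfrak g_1=\mathfrak g_{\bar 1}$. Fix any such grading, and let $M$ be an irreducible finite dimensional $(\mathfrak g_0\otimes A)$-module. Let $\mathfrak g_1\otimes A$ act on $M$ by zero and put $$\bar V(M)=U(\mathfrak g\otimes A)\otimes_{U((\mathfrak g_0\oplus\mathfrak g_1)\otimes A)}M .$$ The module $\bar V(M)$ has a unique maximal proper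 submodule $N(M)$, namely the sum of all its proper submodules. Let $V(M)=\bar V(M)/N(M)$ be its irreducible quotient. Then: 1. $M$ and $V(M)$ have the same annihilator in $A$: the largest ideal $I$ of $A$ with $(\mathfrak g_0\otimes I)M=0$ equals the largest ideal $I$ of $A$ with $(\mathfrak g\otimes I)V(M)=0$. 2. $V(M)$ is finite dimensional if and only if $M$ is a generalized evaluation module, that is, if and only if there are pairwise distinct maximal ideals $\mathfrak m_1,\dots,\mathfrak m_\ell$ of $A$ ($\ell\ge 0$), positive integers $n_1,\dots,n_\ell$, and finite dimensional $(\mathfrak g_0\otimes A/\mathfrak m_i^{n_i})$-modules $V_i$ such that $M\cong V_1\otimes\cdots\otimes V_\ell$, where $\mathfrak g_0\otimes A$ acts on the tensor product through the quotient map $\mathfrak g_0\otimes A\to\bigoplus_{i=1}^{\ell}\mathfrak g_0\otimes(A/\mathfrak m_i^{n_i})$ (for $\ell=0$ the tensor product is the trivial one-dimensional module). -/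

import Mathlib

open scoped TensorProduct

universe u v w z

noncomputable section

/-! ### Lie superalgebras -/

/-- The sign `(-1)^(ij)` for parities `i`, `j`. -/
def superSign (k : Type*) [Field k] (i j : ZMod 2) : k :=
  if i = 1 ∧ j = 1 then -1 else 1

/-- A Lie superalgebra over `k`: a `ℤ/2`-graded vector space (`part 0` is the even part and
`part 1` the odd part) with a bilinear bracket that is graded, super skew-symmetric and satisfies
the super Jacobi identity. -/
class LieSuperalgebra (k : Type*) (L : Type*) [Field k] [AddCommGroup L] [Module k L] where
  part : ZMod 2 → Submodule k L
  isCompl : IsCompl (part 0) (part 1)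
  bracket : L →ₗ[k] L →ₗ[k] L
  bracket_mem : ∀ {i j : ZMod 2} {x y : L}, x ∈ part i → y ∈ part j → bracket x y ∈ part (i + j)
  skew : ∀ {i j : ZMod 2} {x y : L}, x ∈ part i → y ∈ part j →
    bracket x y = -(superSign k i j • bracket y x)
  jacobi : ∀ {i j : ZMod 2} {x y : L} (z : L), x ∈ part i → y ∈ part j →
    bracket x (bracket y z) = bracket (bracket x y) z + superSign k i j • bracket y (bracket x z)

namespace LieSuperalgebra

section Basic

variable (k : Type*) (L : Type*) [Field k] [AddCommGroup L] [Module k L] [LieSuperalgebra k L]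

/-- The projection onto the even part along the odd part. -/
def evenProj : L →ₗ[k] (part 0 : Submodule k L) :=
  Submodule.projectionOnto _ _ (isCompl (k := k) (L := L))

variable {k L}

theorem bracket_even_mem {x y : L} {j : ZMod 2} (hx : x ∈ (part 0 : Submodule k L))
    (hy : y ∈ (part j : Submodule k L)) : bracket (k := k) x y ∈ (part j : Submodule k L) := by
  simpa using bracket_mem hx hy

/-- The even part is a Lie algebra. -/
instance evenLieRing [CharZero k] : LieRing (part 0 : Submodule k L) where
  bracket x y := ⟨bracket (k := k) (x : L) (y : L), bracket_even_mem x.2 y.2⟩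
  add_lie x y z := Subtype.ext (by simp)
  lie_add x y z := Subtype.ext (by simp)
  lie_self x := by
    apply Subtype.ext
    have h := skew x.2 x.2
    simp only [superSign, zero_ne_one, and_self, if_false, one_smul] at h
    have h2 : (2 : k) • (bracket (k := k) (x : L) (x : L)) = 0 := by
      rw [two_smul]
      nth_rewrite 1 [h]
      simp
    exact (smul_eq_zero.mp h2).resolve_left two_ne_zero
  leibniz_lie x y z := Subtype.ext (by
    have h := jacobi (z : L) x.2 y.2
    simpa [superSign] using h)

instance evenLieAlgebra [CharZero k] : LieAlgebra k (part 0 : Submodule k L) where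
  lie_smul t x y := Subtype.ext (by
    change bracket (k := k) (x : L) (t • (y : L)) = t • bracket (k := k) (x : L) (y : L)
    simp)

/-- The odd part is a module over the even part. -/
instance oddLieRingModule [CharZero k] :
    LieRingModule (part 0 : Submodule k L) (part 1 : Submodule k L) where
  bracket x y := ⟨bracket (k := k) (x : L) (y : L), bracket_even_mem x.2 y.2⟩
  add_lie x y z := Subtype.ext (by simp)
  lie_add x y z := Subtype.ext (by simp)
  leibniz_lie x y z := Subtype.ext (by
    have h := jacobi (z : L) x.2 y.2
    simp only [superSign, zero_ne_one, and_self, if_false, one_smul] at h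
    exact h)

instance oddLieModule [CharZero k] :
    LieModule k (part 0 : Submodule k L) (part 1 : Submodule k L) where
  smul_lie t x y := Subtype.ext (by
    change bracket (k := k) (t • (x : L)) (y : L) = t • bracket (k := k) (x : L) (y : L)
    simp)
  lie_smul t x y := Subtype.ext (by
    change bracket (k := k) (x : L) (t • (y : L)) = t • bracket (k := k) (x : L) (y : L)
    simp)

end Basic

/-- An isomorphism of Lie superalgebras. -/
structure Iso (k L L' : Type*) [Field k] [AddCommGroup L] [Module k L] [LieSuperalgebra k L]
    [AddCommGroup L'] [Module k L'] [LieSuperalgebra k L'] extends L ≃ₗ[k] L' where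
  map_part : ∀ (i : ZMod 2) (x : L), x ∈ (part i : Submodule k L) → toFun x ∈ (part i : Submodule k L')
  map_bracket : ∀ x y : L,
    toFun (bracket (k := k) x y) = bracket (k := k) (toFun x) (toFun y)

/-! ### Subsuperalgebras -/

/-- A subsuperalgebra: a `ℤ/2`-graded subspace that is closed under the bracket. -/
structure Sub (k L : Type*) [Field k] [AddCommGroup L] [Module k L] [LieSuperalgebra k L] where
  carrier : Submodule k L
  graded : ∀ x ∈ carrier, ∃ y ∈ carrier, ∃ z ∈ carrier,
    y ∈ (part 0 : Submodule k L) ∧ z ∈ (part 1 : Submodule k L) ∧ x = y + z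
  closed : ∀ x ∈ carrier, ∀ y ∈ carrier, bracket (k := k) x y ∈ carrier

instance subLieSuperalgebra {k L : Type*} [Field k] [AddCommGroup L] [Module k L]
    [LieSuperalgebra k L] (p : Sub k L) : LieSuperalgebra k p.carrier where
  part i := (part i : Submodule k L).comap p.carrier.subtype
  isCompl := by
    constructor
    · rw [Submodule.disjoint_def]
      intro x h0 h1
      have h := Submodule.disjoint_def.mp (isCompl (k := k) (L := L)).disjoint x.1 h0 h1
      exact Subtype.ext h
    · rw [codisjoint_iff, eq_top_iff]
      rintro ⟨x, hx⟩ -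
      obtain ⟨y, hy, z, hz, hy0, hz1, rfl⟩ := p.graded x hx
      exact Submodule.mem_sup.mpr ⟨⟨y, hy⟩, hy0, ⟨z, hz⟩, hz1, rfl⟩
  bracket := LinearMap.mk₂ k (fun x y => ⟨bracket (k := k) x.1 y.1, p.closed _ x.2 _ y.2⟩)
    (fun _ _ _ => Subtype.ext (by simp)) (fun _ _ _ => Subtype.ext (by simp))
    (fun _ _ _ => Subtype.ext (by simp)) (fun _ _ _ => Subtype.ext (by simp))
  bracket_mem hx hy := bracket_mem (k := k) (L := L) hx hy
  skew hx hy := Subtype.ext (skew (k := k) (L := L) hx hy)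
  jacobi z hx hy := Subtype.ext (jacobi (k := k) (L := L) z.1 hx hy)

/-! ### Simple, classical and basic classical Lie superalgebras -/

section Classical

variable (k : Type*) (L : Type*) [Field k] [AddCommGroup L] [Module k L] [LieSuperalgebra k L]

/-- A simple Lie superalgebra: the bracket is not zero and there are no graded ideals besides
`0` and the whole algebra. -/
def IsSimple : Prop :=
  (∃ x y : L, bracket (k := k) x y ≠ 0) ∧
  ∀ I : Submodule k L,
    (∀ x ∈ I, ∃ y ∈ I, ∃ z ∈ I,
      y ∈ (part 0 : Submodule k L) ∧ z ∈ (part 1 : Submodule k L) ∧ x = y + z) →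
    (∀ x : L, ∀ y ∈ I, bracket (k := k) x y ∈ I) → I = ⊥ ∨ I = ⊤

variable [CharZero k]

/-- A classical Lie superalgebra: finite dimensional and simple, with the odd part completely
reducible over the even part. -/
def IsClassical : Prop :=
  FiniteDimensional k L ∧ IsSimple k L ∧
  ComplementedLattice (LieSubmodule k (part 0 : Submodule k L) (part 1 : Submodule k L))

/-- A basic classical Lie superalgebra: a classical one with a non-degenerate invariant bilinear
form. -/
def IsBasicClassical : Prop :=
  IsClassical k L ∧ ∃ B : LinearMap.BilinForm k L, B.Nondegenerate ∧
    ∀ x y z : L, B (bracket (k := k) x y) z = B x (bracket (k := k) y z)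

/-- Type I: the odd part is the direct sum of two irreducible modules over the even part. -/
def IsTypeI : Prop :=
  ∃ W₁ W₂ : LieSubmodule k (part 0 : Submodule k L) (part 1 : Submodule k L),
    IsCompl W₁ W₂ ∧
    LieModule.IsIrreducible k (part 0 : Submodule k L) W₁ ∧
    LieModule.IsIrreducible k (part 0 : Submodule k L) W₂

/-- A distinguished `ℤ`-grading `L = L₋₁ ⊕ L₀ ⊕ L₁`, with `L₀` the even part and `L₋₁ ⊕ L₁` the
odd part. -/
structure DistinguishedGrading where
  piece : ℤ → Submodule k L
  isInternal : DirectSum.IsInternal piece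
  bracket_mem : ∀ {i j : ℤ} {x y : L}, x ∈ piece i → y ∈ piece j →
    bracket (k := k) x y ∈ piece (i + j)
  piece_eq_bot : ∀ i : ℤ, 1 < |i| → piece i = ⊥
  piece_zero : piece 0 = part 0
  piece_odd : piece (-1) ⊔ piece 1 = part 1

end Classical

/-! ### The Lie superalgebras `gl(n,n)` and `sl(n,n)` -/

/-- The space of `2n × 2n` matrices in block form, underlying `gl(n,n)`. -/
def Gl (k : Type*) (n : ℕ) : Type _ := Matrix (Fin n ⊕ Fin n) (Fin n ⊕ Fin n) k

section Gl

variable (k : Type*) [Field k] (n : ℕ)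

instance : Ring (Gl k n) := inferInstanceAs (Ring (Matrix (Fin n ⊕ Fin n) (Fin n ⊕ Fin n) k))

instance : Algebra k (Gl k n) :=
  inferInstanceAs (Algebra k (Matrix (Fin n ⊕ Fin n) (Fin n ⊕ Fin n) k))

/-- Block diagonal matrices are even, block off-diagonal ones are odd. -/
def glPart (i : ZMod 2) : Submodule k (Gl k n) where
  carrier := {X | ∀ a b : Fin n ⊕ Fin n, (if a.isLeft = b.isLeft then (0 : ZMod 2) else 1) ≠ i →
    X a b = 0}
  add_mem' {X Y} hX hY a b h := by
    change X a b + Y a b = 0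
    rw [hX a b h, hY a b h, add_zero]
  zero_mem' _ _ _ := rfl
  smul_mem' t X hX a b h := by
    change t * X a b = 0
    rw [hX a b h, mul_zero]

/-- The block off-diagonal part of a matrix. -/
def glOdd : Gl k n →ₗ[k] Gl k n where
  toFun X := fun a b => if a.isLeft = b.isLeft then 0 else X a b
  map_add' X Y := by
    funext a b
    change (if _ then _ else X a b + Y a b) = (if _ then _ else X a b) + (if _ then _ else Y a b)
    split_ifs <;> simp
  map_smul' t X := by
    funext a b
    change (if _ then _ else t * X a b) = t * (if _ then _ else X a b)
    split_ifs <;> simp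

variable {k n}

theorem glOdd_of_even {X : Gl k n} (h : X ∈ glPart k n 0) : glOdd k n X = 0 := by
  funext a b
  change (if a.isLeft = b.isLeft then 0 else X a b) = 0
  split_ifs with hab
  · rfl
  · exact h a b (by simp [hab])

theorem glOdd_of_odd {X : Gl k n} (h : X ∈ glPart k n 1) : glOdd k n X = X := by
  funext a b
  change (if a.isLeft = b.isLeft then 0 else X a b) = X a b
  split_ifs with hab
  · exact (h a b (by simp [hab])).symm
  · rfl

theorem glOdd_mem (X : Gl k n) : glOdd k n X ∈ glPart k n 1 := by
  intro a b h
  change (if a.isLeft = b.isLeft then 0 else X a b) = 0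
  split_ifs with hab
  · rfl
  · simp [hab] at h

theorem sub_glOdd_mem (X : Gl k n) : X - glOdd k n X ∈ glPart k n 0 := by
  intro a b h
  change X a b - (if a.isLeft = b.isLeft then 0 else X a b) = 0
  split_ifs with hab
  · simp [hab] at h
  · simp

theorem glMul_mem {i j : ZMod 2} {X Y : Gl k n} (hX : X ∈ glPart k n i) (hY : Y ∈ glPart k n j) :
    X * Y ∈ glPart k n (i + j) := by
  intro a b h
  change (∑ c, X a c * Y c b) = 0
  refine Finset.sum_eq_zero fun c _ => ?_
  by_cases h1 : (if a.isLeft = c.isLeft then (0 : ZMod 2) else 1) = i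
  · by_cases h2 : (if c.isLeft = b.isLeft then (0 : ZMod 2) else 1) = j
    · refine absurd ?_ h
      rw [← h1, ← h2]
      cases a.isLeft <;> cases b.isLeft <;> cases c.isLeft <;> decide
    · rw [hY c b h2, mul_zero]
  · rw [hX a c h1, zero_mul]

variable (k n)

/-- The supercommutator, that is `X Y - (-1)^(ij) Y X` for `X` of parity `i` and `Y` of
parity `j` (see `glBracket_apply`), extended bilinearly. -/
def glBracket : Gl k n →ₗ[k] Gl k n →ₗ[k] Gl k n :=
  LinearMap.mul k (Gl k n) - (LinearMap.mul k (Gl k n)).flip +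
    (2 : k) • ((LinearMap.mul k (Gl k n)).compl₁₂ (glOdd k n) (glOdd k n)).flip

variable {k n}

theorem parity_cases (i : ZMod 2) : i = 0 ∨ i = 1 := by
  revert i; decide

theorem glBracket_apply {i j : ZMod 2} {X Y : Gl k n} (hX : X ∈ glPart k n i)
    (hY : Y ∈ glPart k n j) :
    glBracket k n X Y = X * Y - superSign k i j • (Y * X) := by
  have h : glBracket k n X Y = X * Y - Y * X + (2 : k) • (glOdd k n Y * glOdd k n X) := rfl
  rw [h]
  rcases parity_cases i with rfl | rfl <;> rcases parity_cases j with rfl | rfl <;>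
    simp only [glOdd_of_even, glOdd_of_odd, hX, hY, superSign, two_smul] <;> simp

theorem glBracket_mem {i j : ZMod 2} {X Y : Gl k n} (hX : X ∈ glPart k n i)
    (hY : Y ∈ glPart k n j) : glBracket k n X Y ∈ glPart k n (i + j) := by
  rw [glBracket_apply hX hY]
  refine Submodule.sub_mem _ (glMul_mem hX hY) (Submodule.smul_mem _ _ ?_)
  rw [add_comm]
  exact glMul_mem hY hX

theorem glPart_isCompl : IsCompl (glPart k n 0) (glPart k n 1) := by
  constructor
  · rw [Submodule.disjoint_def]
    intro X h0 h1
    rw [← glOdd_of_odd h1, glOdd_of_even h0]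
  · rw [codisjoint_iff, eq_top_iff]
    intro X _
    have h := Submodule.add_mem_sup (sub_glOdd_mem X) (glOdd_mem X)
    simpa using h

variable (k n)

instance glLieSuperalgebra : LieSuperalgebra k (Gl k n) where
  part := glPart k n
  isCompl := glPart_isCompl
  bracket := glBracket k n
  bracket_mem := glBracket_mem
  skew {i j X Y} hX hY := by
    rw [glBracket_apply hX hY, glBracket_apply hY hX]
    rcases parity_cases i with rfl | rfl <;> rcases parity_cases j with rfl | rfl <;>
      simp [superSign, add_comm]
  jacobi {i j X Y} Z hX hY := by
    have key : ∀ (l : ZMod 2) (Z : Gl k n), Z ∈ glPart k n l →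
        glBracket k n X (glBracket k n Y Z) = glBracket k n (glBracket k n X Y) Z +
          superSign k i j • glBracket k n Y (glBracket k n X Z) := by
      intro l Z hZ
      rw [glBracket_apply hX (glBracket_mem hY hZ), glBracket_apply (glBracket_mem hX hY) hZ,
        glBracket_apply hY (glBracket_mem hX hZ), glBracket_apply hX hY, glBracket_apply hX hZ,
        glBracket_apply hY hZ]
      have h11 : (1 : ZMod 2) + 1 = 0 := by decide
      rcases parity_cases i with rfl | rfl <;> rcases parity_cases j with rfl | rfl <;>
        rcases parity_cases l with rfl | rfl <;>
        simp [superSign, h11] <;> noncomm_ring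
    have hZ : Z = (Z - glOdd k n Z) + glOdd k n Z := by simp
    rw [hZ]
    simp only [map_add, smul_add]
    rw [key 0 _ (sub_glOdd_mem Z), key 1 _ (glOdd_mem Z)]
    abel

/-- The supertrace. -/
def supertrace : Gl k n →ₗ[k] k where
  toFun X := (∑ a, X (Sum.inl a) (Sum.inl a)) - ∑ a, X (Sum.inr a) (Sum.inr a)
  map_add' X Y := by
    change (∑ a, (X (Sum.inl a) (Sum.inl a) + Y (Sum.inl a) (Sum.inl a))) -
      ∑ a, (X (Sum.inr a) (Sum.inr a) + Y (Sum.inr a) (Sum.inr a)) = _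
    simp only [Finset.sum_add_distrib]
    ring
  map_smul' t X := by
    change (∑ a, t * X (Sum.inl a) (Sum.inl a)) - ∑ a, t * X (Sum.inr a) (Sum.inr a) = t * _
    simp only [← Finset.mul_sum]
    ring

variable {k n}

theorem supertrace_odd {X : Gl k n} (h : X ∈ glPart k n 1) : supertrace k n X = 0 := by
  change (∑ a, X (Sum.inl a) (Sum.inl a)) - ∑ a, X (Sum.inr a) (Sum.inr a) = 0
  rw [Finset.sum_eq_zero fun a _ => h _ _ (by simp), Finset.sum_eq_zero fun a _ => h _ _ (by simp),
    sub_zero]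

theorem supertrace_bracket (X Y : Gl k n) : supertrace k n (glBracket k n X Y) = 0 := by
  change (∑ a, ((∑ c, X (Sum.inl a) c * Y c (Sum.inl a)) - (∑ c, Y (Sum.inl a) c * X c (Sum.inl a))
      + 2 * ∑ c, glOdd k n Y (Sum.inl a) c * glOdd k n X c (Sum.inl a))) -
    ∑ a, ((∑ c, X (Sum.inr a) c * Y c (Sum.inr a)) - (∑ c, Y (Sum.inr a) c * X c (Sum.inr a))
      + 2 * ∑ c, glOdd k n Y (Sum.inr a) c * glOdd k n X c (Sum.inr a)) = 0
  have o1 : ∀ (Z : Gl k n) (a b : Fin n), glOdd k n Z (Sum.inl a) (Sum.inl b) = 0 := fun _ _ _ => rfl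
  have o2 : ∀ (Z : Gl k n) (a b : Fin n), glOdd k n Z (Sum.inr a) (Sum.inr b) = 0 := fun _ _ _ => rfl
  have o3 : ∀ (Z : Gl k n) (a b : Fin n),
    glOdd k n Z (Sum.inl a) (Sum.inr b) = Z (Sum.inl a) (Sum.inr b) := fun _ _ _ => rfl
  have o4 : ∀ (Z : Gl k n) (a b : Fin n),
    glOdd k n Z (Sum.inr a) (Sum.inl b) = Z (Sum.inr a) (Sum.inl b) := fun _ _ _ => rfl
  simp only [Fintype.sum_sum_type, o1, o2, o3, o4, zero_mul, Finset.sum_const_zero, zero_add,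
    add_zero, Finset.sum_add_distrib, Finset.sum_sub_distrib, ← Finset.mul_sum]
  have c : ∀ (p q : Fin n ⊕ Fin n → Fin n ⊕ Fin n → k) (s t : Fin n → Fin n ⊕ Fin n),
      (∑ a, ∑ b, p (s a) (t b) * q (t b) (s a)) = ∑ a, ∑ b, q (t a) (s b) * p (s b) (t a) := by
    intro p q s t
    rw [Finset.sum_comm]
    exact Finset.sum_congr rfl fun _ _ => Finset.sum_congr rfl fun _ _ => mul_comm _ _
  rw [c X Y Sum.inl Sum.inl, c X Y Sum.inl Sum.inr, c X Y Sum.inr Sum.inl, c X Y Sum.inr Sum.inr]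
  ring

variable (k n)

/-- `sl(n,n)`, the matrices of supertrace zero. -/
def slSuper : Sub k (Gl k n) where
  carrier := LinearMap.ker (supertrace k n)
  graded X hX := by
    refine ⟨X - glOdd k n X, ?_, glOdd k n X, supertrace_odd (glOdd_mem X), sub_glOdd_mem X,
      glOdd_mem X, by simp⟩
    rw [LinearMap.mem_ker, map_sub, supertrace_odd (glOdd_mem X), LinearMap.mem_ker.mp hX, sub_zero]
  closed X _ Y _ := supertrace_bracket X Y

end Gl

/-! ### Map superalgebras -/

section MapSuperalgebra

variable (k A L : Type*) [Field k] [CommRing A] [Algebra k A] [AddCommGroup L] [Module k L]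
  [LieSuperalgebra k L]

/-- The part `A ⊗ Lᵢ` of `A ⊗ L`. -/
def mapPart (i : ZMod 2) : Submodule k (A ⊗[k] L) :=
  LinearMap.range (LinearMap.lTensor A (part i : Submodule k L).subtype)

/-- The bracket `[f₁ ⊗ u₁, f₂ ⊗ u₂] = f₁ f₂ ⊗ [u₁, u₂]`. -/
def mapBracket : A ⊗[k] L →ₗ[k] A ⊗[k] L →ₗ[k] A ⊗[k] L :=
  TensorProduct.map₂ (LinearMap.mul k A) bracket

variable {k A L}

@[simp] theorem mapBracket_tmul (a b : A) (x y : L) :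
    mapBracket k A L (a ⊗ₜ x) (b ⊗ₜ y) = (a * b) ⊗ₜ bracket (k := k) x y := by
  simp [mapBracket]

theorem mapPart_induction {i : ZMod 2} {P : A ⊗[k] L → Prop} (h0 : P 0)
    (hadd : ∀ x y, P x → P y → P (x + y))
    (ht : ∀ (a : A) (x : L), x ∈ (part i : Submodule k L) → P (a ⊗ₜ x))
    {x : A ⊗[k] L} (hx : x ∈ mapPart k A L i) : P x := by
  obtain ⟨y, rfl⟩ := hx
  induction y using TensorProduct.induction_on with
  | zero => simpa using h0
  | tmul a x => exact ht a x.1 x.2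
  | add y z hy hz => rw [map_add]; exact hadd _ _ hy hz

theorem tmul_mem_mapPart {i : ZMod 2} (a : A) {x : L} (hx : x ∈ (part i : Submodule k L)) :
    a ⊗ₜ x ∈ mapPart k A L i :=
  ⟨a ⊗ₜ ⟨x, hx⟩, rfl⟩

/-- The map Lie superalgebra `A ⊗ L`. -/
instance mapLieSuperalgebra : LieSuperalgebra k (A ⊗[k] L) where
  part := mapPart k A L
  isCompl := by
    constructor
    · rw [Submodule.disjoint_def]
      intro x h0 h1
      have e1 : LinearMap.lTensor A ((part 0 : Submodule k L).subtype ∘ₗ evenProj k L) x = 0 := by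
        refine mapPart_induction (P := fun x => LinearMap.lTensor A
          ((part 0 : Submodule k L).subtype ∘ₗ evenProj k L) x = 0) (map_zero _)
          (fun x y hx hy => by rw [map_add, hx, hy, add_zero]) (fun a x hx => ?_) h1
        have : evenProj k L x = 0 := (Submodule.projectionOnto_apply_eq_zero_iff _).mpr hx
        simp [this]
      have e0 : LinearMap.lTensor A ((part 0 : Submodule k L).subtype ∘ₗ evenProj k L) x = x := by
        refine mapPart_induction (P := fun x => LinearMap.lTensor A
          ((part 0 : Submodule k L).subtype ∘ₗ evenProj k L) x = x) (map_zero _)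
          (fun x y hx hy => by rw [map_add, hx, hy]) (fun a x hx => ?_) h0
        have : evenProj k L x = ⟨x, hx⟩ :=
          Submodule.projectionOnto_apply_left (isCompl (k := k) (L := L)) ⟨x, hx⟩
        simp [this]
      rw [← e0, e1]
    · rw [codisjoint_iff, eq_top_iff]
      rintro x -
      induction x using TensorProduct.induction_on with
      | zero => exact Submodule.zero_mem _
      | add x y hx hy => exact Submodule.add_mem _ hx hy
      | tmul a x =>
        have hx : x ∈ (part 0 : Submodule k L) ⊔ part 1 := by
          rw [(isCompl (k := k) (L := L)).sup_eq_top]; trivial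
        obtain ⟨y, hy, z, hz, rfl⟩ := Submodule.mem_sup.mp hx
        rw [TensorProduct.tmul_add]
        exact Submodule.add_mem_sup (tmul_mem_mapPart a hy) (tmul_mem_mapPart a hz)
  bracket := mapBracket k A L
  bracket_mem {i j x y} hx hy := by
    refine mapPart_induction (P := fun x => mapBracket k A L x y ∈ mapPart k A L (i + j))
      (by simp) (fun x x' h h' => by simpa using Submodule.add_mem _ h h') (fun a x hx => ?_) hx
    refine mapPart_induction (P := fun y => mapBracket k A L (a ⊗ₜ x) y ∈ mapPart k A L (i + j))
      (by simp) (fun y y' h h' => by simpa using Submodule.add_mem _ h h') (fun b y hy => ?_) hy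
    rw [mapBracket_tmul]
    exact tmul_mem_mapPart _ (bracket_mem hx hy)
  skew {i j x y} hx hy := by
    refine mapPart_induction (P := fun x => mapBracket k A L x y =
      -(superSign k i j • mapBracket k A L y x))
      (by simp) (fun x x' h h' => by simp [h, h', add_comm]) (fun a x hx => ?_) hx
    refine mapPart_induction (P := fun y => mapBracket k A L (a ⊗ₜ x) y =
      -(superSign k i j • mapBracket k A L y (a ⊗ₜ x)))
      (by simp) (fun y y' h h' => by simp [h, h', add_comm]) (fun b y hy => ?_) hy
    rw [mapBracket_tmul, mapBracket_tmul, skew hx hy, mul_comm, TensorProduct.tmul_neg,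
      TensorProduct.tmul_smul]
  jacobi {i j x y} z hx hy := by
    refine mapPart_induction (P := fun x => mapBracket k A L x (mapBracket k A L y z) =
      mapBracket k A L (mapBracket k A L x y) z +
        superSign k i j • mapBracket k A L y (mapBracket k A L x z))
      (by simp) (fun x x' h h' => by
        simp only [map_add, LinearMap.add_apply, h, h', smul_add]; abel) (fun a x hx => ?_) hx
    refine mapPart_induction (P := fun y => mapBracket k A L (a ⊗ₜ x) (mapBracket k A L y z) =
      mapBracket k A L (mapBracket k A L (a ⊗ₜ x) y) z +
        superSign k i j • mapBracket k A L y (mapBracket k A L (a ⊗ₜ x) z))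
      (by simp) (fun x x' h h' => by
        simp only [map_add, LinearMap.add_apply, h, h', smul_add]; abel) (fun b y hy => ?_) hy
    induction z using TensorProduct.induction_on with
    | zero => simp
    | add z z' h h' => simp only [map_add, h, h', smul_add]; abel
    | tmul c z =>
      simp only [mapBracket_tmul]
      rw [jacobi z hx hy, TensorProduct.tmul_add, TensorProduct.tmul_smul, ← mul_assoc,
        ← mul_assoc, mul_comm b a]

end MapSuperalgebra

/-! ### The universal enveloping superalgebra -/

section Enveloping

variable (k L : Type*) [Field k] [AddCommGroup L] [Module k L] [LieSuperalgebra k L]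

/-- The relations `x y = (-1)^(ij) y x + [x, y]`, for `x` of parity `i` and `y` of parity `j`. -/
inductive EnvelopingRel : TensorAlgebra k L → TensorAlgebra k L → Prop
  | intro {i j : ZMod 2} {x y : L} (hx : x ∈ (part i : Submodule k L))
      (hy : y ∈ (part j : Submodule k L)) :
    EnvelopingRel (TensorAlgebra.ι k x * TensorAlgebra.ι k y)
      (superSign k i j • (TensorAlgebra.ι k y * TensorAlgebra.ι k x) +
        TensorAlgebra.ι k (bracket (k := k) x y))

/-- The universal enveloping superalgebra `U(L)`, as an associative algebra. -/
def Enveloping : Type _ := RingQuot (EnvelopingRel k L)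

instance : Ring (Enveloping k L) := inferInstanceAs (Ring (RingQuot (EnvelopingRel k L)))

instance : Algebra k (Enveloping k L) :=
  inferInstanceAs (Algebra k (RingQuot (EnvelopingRel k L)))

namespace Enveloping

/-- The canonical map `L → U(L)`. -/
def ι : L →ₗ[k] Enveloping k L :=
  (RingQuot.mkAlgHom k (EnvelopingRel k L)).toLinearMap ∘ₗ TensorAlgebra.ι k

variable {k L}

theorem ι_mul_ι {i j : ZMod 2} {x y : L} (hx : x ∈ (part i : Submodule k L))
    (hy : y ∈ (part j : Submodule k L)) :
    ι k L x * ι k L y = superSign k i j • (ι k L y * ι k L x) + ι k L (bracket (k := k) x y) := by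
  have h := RingQuot.mkAlgHom_rel k (EnvelopingRel.intro hx hy)
  simp only [map_mul, map_add, map_smul] at h
  exact h

/-- A linear map from `L` to an associative algebra that respects the relations extends to
`U(L)`. -/
def lift {R : Type*} [Ring R] [Algebra k R] (f : L →ₗ[k] R)
    (hf : ∀ {i j : ZMod 2} {x y : L}, x ∈ (part i : Submodule k L) → y ∈ (part j : Submodule k L) →
      f x * f y = superSign k i j • (f y * f x) + f (bracket (k := k) x y)) :
    Enveloping k L →ₐ[k] R :=
  RingQuot.liftAlgHom k ⟨TensorAlgebra.lift k f, by
    rintro _ _ ⟨hx, hy⟩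
    simpa using hf hx hy⟩

@[simp] theorem lift_ι {R : Type*} [Ring R] [Algebra k R] (f : L →ₗ[k] R)
    (hf : ∀ {i j : ZMod 2} {x y : L}, x ∈ (part i : Submodule k L) → y ∈ (part j : Submodule k L) →
      f x * f y = superSign k i j • (f y * f x) + f (bracket (k := k) x y)) (x : L) :
    lift f hf (ι k L x) = f x := by
  have h := RingQuot.liftAlgHom_mkAlgHom_apply k (TensorAlgebra.lift k f) (s := EnvelopingRel k L)
    (by rintro _ _ ⟨hx, hy⟩; simpa using hf hx hy) (TensorAlgebra.ι k x)
  rw [TensorAlgebra.lift_ι_apply] at h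
  exact h

end Enveloping

end Enveloping

/-! ### Extension of scalars along `φ : R → S` -/

section Induced

variable {k R S : Type*} [Field k] [Ring R] [Algebra k R] [Ring S] [Algebra k S] (φ : R →ₐ[k] S)
  (M : Type*) [AddCommGroup M] [Module k M] (ρ : R →ₐ[k] Module.End k M)

/-- The `S`-submodule of `S ⊗ₖ M` generated by the elements `s φ(r) ⊗ m - s ⊗ r m`. -/
def balancing : Submodule S (S ⊗[k] M) :=
  Submodule.span S {t | ∃ (s : S) (r : R) (m : M), t = (s * φ r) ⊗ₜ m - s ⊗ₜ (ρ r m)}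

/-- The tensor product `S ⊗_R M`, where `M` is an `R`-module through `ρ` and `S` is a right
`R`-module through `φ`. -/
abbrev Induced : Type _ := (S ⊗[k] M) ⧸ balancing φ M ρ

end Induced

/-! ### Kac modules over map superalgebras and their irreducible quotients -/

namespace DistinguishedGrading

section Parabolic

variable {k L : Type*} [Field k] [AddCommGroup L] [Module k L] [LieSuperalgebra k L]

theorem piece_one_le (D : DistinguishedGrading k L) : D.piece 1 ≤ part 1 :=
  le_sup_right.trans D.piece_odd.le

/-- The subsuperalgebra `L₀ ⊕ L₁`. -/
def parabolic (D : DistinguishedGrading k L) : Sub k L where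
  carrier := D.piece 0 ⊔ D.piece 1
  graded x hx := by
    obtain ⟨y, hy, z, hz, rfl⟩ := Submodule.mem_sup.mp hx
    exact ⟨y, Submodule.mem_sup_left hy, z, Submodule.mem_sup_right hz, D.piece_zero ▸ hy,
      D.piece_one_le hz, rfl⟩
  closed x hx x' hx' := by
    obtain ⟨y, hy, z, hz, rfl⟩ := Submodule.mem_sup.mp hx
    obtain ⟨y', hy', z', hz', rfl⟩ := Submodule.mem_sup.mp hx'
    have h00 := D.bracket_mem hy hy'
    have h01 := D.bracket_mem hy hz'
    have h10 := D.bracket_mem hz hy'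
    have h11 := D.bracket_mem hz hz'
    rw [D.piece_eq_bot (1 + 1) (by decide), Submodule.mem_bot] at h11
    simp only [map_add, LinearMap.add_apply, h11, add_zero, zero_add] at h00 h01 h10 ⊢
    exact Submodule.add_mem _
      (Submodule.add_mem _ (Submodule.mem_sup_left h00) (Submodule.mem_sup_right h10))
      (Submodule.mem_sup_right h01)

theorem mem_piece_one_of_odd (D : DistinguishedGrading k L) {x : L}
    (hx : x ∈ D.parabolic.carrier) (h1 : x ∈ (part 1 : Submodule k L)) : x ∈ D.piece 1 := by
  obtain ⟨y, hy, z, hz, rfl⟩ := Submodule.mem_sup.mp hx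
  have hy1 : y ∈ (part 1 : Submodule k L) := by
    have := Submodule.sub_mem _ h1 (D.piece_one_le hz)
    simpa using this
  have : y = 0 := Submodule.disjoint_def.mp (isCompl (k := k) (L := L)).disjoint y
    (D.piece_zero ▸ hy) hy1
  simpa [this] using hz

theorem bracket_odd_eq_zero (D : DistinguishedGrading k L) {x y : D.parabolic.carrier}
    (hx : x ∈ (part 1 : Submodule k D.parabolic.carrier))
    (hy : y ∈ (part 1 : Submodule k D.parabolic.carrier)) : bracket (k := k) x y = 0 := by
  have h := D.bracket_mem (D.mem_piece_one_of_odd x.2 hx) (D.mem_piece_one_of_odd y.2 hy)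
  rw [D.piece_eq_bot (1 + 1) (by decide), Submodule.mem_bot] at h
  exact Subtype.ext h

/-- The projection `L₀ ⊕ L₁ → L₀`. -/
def levi (D : DistinguishedGrading k L) : D.parabolic.carrier →ₗ[k] (part 0 : Submodule k L) :=
  evenProj k L ∘ₗ D.parabolic.carrier.subtype

theorem levi_odd (D : DistinguishedGrading k L) {x : D.parabolic.carrier}
    (hx : x ∈ (part 1 : Submodule k D.parabolic.carrier)) : D.levi x = 0 :=
  (Submodule.projectionOnto_apply_eq_zero_iff (isCompl (k := k) (L := L)) (x := x.1)).mpr hx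

theorem levi_even (D : DistinguishedGrading k L) {x : D.parabolic.carrier}
    (hx : x ∈ (part 0 : Submodule k D.parabolic.carrier)) : D.levi x = ⟨x.1, hx⟩ :=
  Submodule.projectionOnto_apply_left (isCompl (k := k) (L := L)) ⟨x.1, hx⟩

end Parabolic

section Kac

variable {k L : Type*} [Field k] [CharZero k] [AddCommGroup L] [Module k L] [LieSuperalgebra k L]
  (D : DistinguishedGrading k L) (A : Type*) [CommRing A] [Algebra k A]
  (M : Type*) [AddCommGroup M] [Module k M] [LieRingModule (A ⊗[k] (part 0 : Submodule k L)) M]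
  [LieModule k (A ⊗[k] (part 0 : Submodule k L)) M]

/-- The action of `A ⊗ (L₀ ⊕ L₁)` on an `A ⊗ L₀`-module `M`, with `A ⊗ L₁` acting by zero. -/
def parabolicAction : A ⊗[k] D.parabolic.carrier →ₗ[k] Module.End k M :=
  (LieModule.toEnd k (A ⊗[k] (part 0 : Submodule k L)) M : _ →ₗ[k] Module.End k M) ∘ₗ
    LinearMap.lTensor A D.levi

theorem levi_bracket_even {x y : D.parabolic.carrier}
    (hx : x ∈ (part 0 : Submodule k D.parabolic.carrier))
    (hy : y ∈ (part 0 : Submodule k D.parabolic.carrier)) :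
    D.levi (bracket (k := k) x y) = ⁅D.levi x, D.levi y⁆ := by
  rw [D.levi_even hx, D.levi_even hy, D.levi_even (bracket_even_mem hx hy)]
  rfl

theorem parabolicAction_tmul (a : A) (x : D.parabolic.carrier) (m : M) :
    D.parabolicAction A M (a ⊗ₜ x) m =
      ⁅(a ⊗ₜ[k] D.levi x : A ⊗[k] (part 0 : Submodule k L)), m⁆ := rfl

theorem parabolicAction_rel (a b : A) {i j : ZMod 2} {x y : D.parabolic.carrier}
    (hx : x ∈ (part i : Submodule k D.parabolic.carrier))
    (hy : y ∈ (part j : Submodule k D.parabolic.carrier)) :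
    D.parabolicAction A M (a ⊗ₜ x) * D.parabolicAction A M (b ⊗ₜ y) =
      superSign k i j • (D.parabolicAction A M (b ⊗ₜ y) * D.parabolicAction A M (a ⊗ₜ x)) +
        D.parabolicAction A M ((a * b) ⊗ₜ bracket (k := k) x y) := by
  ext m
  simp only [Module.End.mul_apply, LinearMap.add_apply, LinearMap.smul_apply,
    parabolicAction_tmul]
  rcases parity_cases i with rfl | rfl <;> rcases parity_cases j with rfl | rfl
  · rw [D.levi_bracket_even hx hy, ← LieAlgebra.ExtendScalars.bracket_tmul, lie_lie]
    simp [superSign]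
  · have h : bracket (k := k) x y ∈ (part 1 : Submodule k D.parabolic.carrier) :=
      bracket_even_mem hx hy
    simp [D.levi_odd hy, D.levi_odd h]
  · have h : bracket (k := k) x y ∈ (part 1 : Submodule k D.parabolic.carrier) := by
      simpa using LieSuperalgebra.bracket_mem hx hy
    simp [D.levi_odd hx, D.levi_odd h]
  · simp [D.levi_odd hx, D.levi_odd hy, D.bracket_odd_eq_zero hx hy]

/-- The representation of `U(A ⊗ (L₀ ⊕ L₁))` on `M`. -/
def parabolicRep : Enveloping k (A ⊗[k] D.parabolic.carrier) →ₐ[k] Module.End k M :=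
  Enveloping.lift (D.parabolicAction A M) (fun hx hy => by
    refine mapPart_induction (P := fun x => D.parabolicAction A M x * _ = _ • (_ * _) +
      D.parabolicAction A M (mapBracket k A D.parabolic.carrier x _)) (by simp)
      (fun x x' h h' => by
        simp only [map_add, LinearMap.add_apply, add_mul, mul_add, h, h', smul_add]; abel)
      (fun a x hx => ?_) hx
    refine mapPart_induction (P := fun y => _ * D.parabolicAction A M y = _ • (_ * _) +
      D.parabolicAction A M (mapBracket k A D.parabolic.carrier _ y)) (by simp)
      (fun x x' h h' => by simp only [map_add, add_mul, mul_add, h, h', smul_add]; abel)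
      (fun b y hy => ?_) hy
    rw [mapBracket_tmul]
    exact D.parabolicAction_rel A M a b hx hy)

/-- The map `U(A ⊗ (L₀ ⊕ L₁)) → U(A ⊗ L)` induced by the inclusion. -/
def parabolicInclusion :
    Enveloping k (A ⊗[k] D.parabolic.carrier) →ₐ[k] Enveloping k (A ⊗[k] L) :=
  Enveloping.lift (Enveloping.ι k (A ⊗[k] L) ∘ₗ LinearMap.lTensor A D.parabolic.carrier.subtype)
    (fun hx hy => by
      have key : ∀ x y : A ⊗[k] D.parabolic.carrier,
          LinearMap.lTensor A D.parabolic.carrier.subtype (bracket (k := k) x y) =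
            bracket (k := k) (LinearMap.lTensor A D.parabolic.carrier.subtype x)
              (LinearMap.lTensor A D.parabolic.carrier.subtype y) := by
        intro x y
        change LinearMap.lTensor A _ (mapBracket k A _ x y) = mapBracket k A L _ _
        induction x using TensorProduct.induction_on with
        | zero => simp
        | add x x' h h' => simp only [map_add, LinearMap.add_apply, h, h']
        | tmul a x =>
          induction y using TensorProduct.induction_on with
          | zero => simp
          | add y y' h h' => simp only [map_add, h, h']
          | tmul b y =>
            simp only [mapBracket_tmul, LinearMap.lTensor_tmul]
            rfl
      have mem : ∀ {i : ZMod 2} {x : A ⊗[k] D.parabolic.carrier},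
          x ∈ (part i : Submodule k (A ⊗[k] D.parabolic.carrier)) →
          LinearMap.lTensor A D.parabolic.carrier.subtype x ∈
            (part i : Submodule k (A ⊗[k] L)) := by
        intro i x hx
        refine mapPart_induction (P := fun x => LinearMap.lTensor A D.parabolic.carrier.subtype x ∈
          mapPart k A L i) (by simp) (fun x y h h' => by simpa using Submodule.add_mem _ h h')
          (fun a x hx => ?_) hx
        exact tmul_mem_mapPart a hx
      simp only [LinearMap.comp_apply, key]
      exact Enveloping.ι_mul_ι (mem hx) (mem hy))

/-- The generalized Kac module `U(A ⊗ L) ⊗_{U(A ⊗ (L₀ ⊕ L₁))} M`. -/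
abbrev KacModule : Type _ := Induced (D.parabolicInclusion A) M (D.parabolicRep A M)

/-- The sum `N(M)` of all proper submodules of the generalized Kac module. -/
def maxSubmodule : Submodule (Enveloping k (A ⊗[k] L)) (D.KacModule A M) :=
  sSup {N | N ≠ ⊤}

/-- The quotient `V(M)` of the generalized Kac module by `N(M)`. -/
abbrev KacQuotient : Type _ := D.KacModule A M ⧸ D.maxSubmodule A M

/-- The largest ideal `I` of `A` such that `I ⊗ L` annihilates `V(M)`. -/
def annKacQuotient : Ideal A :=
  sSup {I | ∀ a ∈ I, ∀ (x : L) (v : D.KacQuotient A M),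
    Enveloping.ι k (A ⊗[k] L) (a ⊗ₜ x) • v = 0}

end Kac

end DistinguishedGrading

end LieSuperalgebra

/-! ### Generalized evaluation modules for a Lie algebra -/

section Evaluation

/-- The largest ideal `I` of `A` such that `I ⊗ G` annihilates the `A ⊗ G`-module `M`. -/
def annMapModule (k A G M : Type*) [Field k] [CommRing A] [Algebra k A] [LieRing G]
    [LieAlgebra k G] [AddCommGroup M] [LieRingModule (A ⊗[k] G) M] : Ideal A :=
  sSup {I | ∀ a ∈ I, ∀ (x : G) (m : M), ⁅(a ⊗ₜ[k] x : A ⊗[k] G), m⁆ = 0}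

/-- The `A ⊗ G`-module `M` is a generalized evaluation module: for some distinct maximal ideals
`𝔪₁, …, 𝔪ₗ` of `A`, some positive integers `n₁, …, nₗ` and some finite dimensional
`(A / 𝔪ᵢ ^ nᵢ) ⊗ G`-modules `Vᵢ`, it is isomorphic to `V₁ ⊗ ⋯ ⊗ Vₗ`, on which `y ∈ A ⊗ G` acts by
`∑ᵢ 1 ⊗ ⋯ ⊗ yᵢ ⊗ ⋯ ⊗ 1` with `yᵢ` the action on `Vᵢ` of the image of `y` in
`(A / 𝔪ᵢ ^ nᵢ) ⊗ G`. -/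
def IsGeneralizedEvaluation (k : Type u) (A G M : Type*) [Field k] [CommRing A] [Algebra k A]
    [LieRing G] [LieAlgebra k G] [AddCommGroup M] [Module k M] [LieRingModule (A ⊗[k] G) M] : Prop :=
  ∃ (l : ℕ) (𝔪 : Fin l → MaximalSpectrum A) (n : Fin l → ℕ) (V : Fin l → Type u)
    (_ : ∀ i, AddCommGroup (V i)) (_ : ∀ i, Module k (V i))
    (_ : ∀ i, LieRingModule ((A ⧸ (𝔪 i).asIdeal ^ n i) ⊗[k] G) (V i))
    (_ : ∀ i, LieModule k ((A ⧸ (𝔪 i).asIdeal ^ n i) ⊗[k] G) (V i))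
    (e : M ≃ₗ[k] ⨂[k] i, V i),
    Function.Injective 𝔪 ∧ (∀ i, 0 < n i) ∧ (∀ i, FiniteDimensional k (V i)) ∧
    ∀ (y : A ⊗[k] G) (m : M),
      e ⁅y, m⁆ = ∑ i, PiTensorProduct.map
        (Function.update (fun j => (LinearMap.id : V j →ₗ[k] V j)) i
          (LieModule.toEnd k ((A ⧸ (𝔪 i).asIdeal ^ n i) ⊗[k] G) (V i)
            (LinearMap.rTensor G (Ideal.Quotient.mkₐ k ((𝔪 i).asIdeal ^ n i)).toLinearMap y)))
        (e m)

end Evaluation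

end

/-! Everything rests on a projection V̄(M) → M. To obtain it, the induced module is compared with
the model Λ(A ⊗ L₋₁) ⊗ M, on which A ⊗ L acts explicitly: degree -1 by left multiplication, degree 0
by derivations extending the action on M, degree 1 by the recursion that the brackets with degree -1
force (`modelAction`). The model takes the place of the Poincaré–Birkhoff–Witt theorem. The
universal property of induction gives `toModel`, and projecting further onto Λ⁰ ⊗ M gives `kacProj`,
which is A ⊗ L₀-linear and splits M → V̄(M). On the other side, V̄(M) is spanned by words in A ⊗ L₋₁
applied to M.

Since A ⊗ L₋₁ is odd with zero bracket, its elements anticommute in U(A ⊗ L), and a word with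
letters in a space of dimension d vanishes as soon as its length exceeds d (`word_eq_zero`). This
nilpotence yields a Nakayama lemma, `eq_top_of_map_kacProj`: a submodule that projects onto M is
everything. As M is irreducible, every proper submodule projects to 0, so N(M) consists of the v
with `kacProj` (s v) = 0 for all s (`maxSubmodule_eq_kacRadical`). Membership in N(M) is thus tested
inside M. The annihilators agree because, when I ⊗ L₀ kills M, the vectors (a ⊗ f) m with a ∈ I
generate a submodule that projects to 0.

For the second claim, both conditions are equivalent to this: some ideal of finite codimension kills
M. If V(M) is finite dimensional, the kernel of A → Hom(L, End V(M)) has finite codimension, and the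
ideal it generates kills brackets, which span at least L₀ in both families. If conversely such an
ideal kills M, it kills V(M); then a finite dimensional space of letters suffices and nilpotence
bounds the words. For evaluation modules, an ideal of finite codimension contains an intersection of
powers of maximal ideals, the Chinese remainder theorem splits the action on M into commuting
actions, and a finite dimensional irreducible module over commuting algebras is a tensor product by
the density theorem (`exists_multilinear_of_irreducible`).

A distinguished grading amounts to a splitting S ⊕ T of the odd part into L₀-stable subspaces with
[S, S] = [T, T] = 0. In type I, simplicity forces the vanishing
(`IsSimple.bracket_eq_zero_of_irreducible`); for sl(n,n) the off-diagonal blocks serve. -/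

noncomputable section
/-! ### The induced module of a three-term graded Lie superalgebra on an exterior algebra -/

/-- Brackets of a Lie superalgebra `F ⊕ G ⊕ P` with degrees `-1, 0, 1`, and a representation of
its degree zero part `G` on `M`. -/
structure TripleAction (k F G P M : Type*) [Field k] [AddCommGroup F] [Module k F]
    [AddCommGroup G] [Module k G] [AddCommGroup P] [Module k P] [AddCommGroup M] [Module k M] where
  gf : G →ₗ[k] F →ₗ[k] F
  pf : P →ₗ[k] F →ₗ[k] G
  gp : G →ₗ[k] P →ₗ[k] P
  gg : G →ₗ[k] G →ₗ[k] G
  ρ : G →ₗ[k] Module.End k M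
  gf_gg : ∀ x y f, gf (gg x y) f = gf x (gf y f) - gf y (gf x f)
  pf_gp : ∀ x e f, pf (gp x e) f = gg x (pf e f) - pf e (gf x f)
  gf_pf_self : ∀ e f, gf (pf e f) f = 0
  gp_pf : ∀ e e' f, gp (pf e f) e' + gp (pf e' f) e = 0
  ρ_gg : ∀ x y, ρ (gg x y) = ρ x * ρ y - ρ y * ρ x

namespace TripleAction

variable {k F G P M : Type*} [Field k] [AddCommGroup F] [Module k F]
    [AddCommGroup G] [Module k G] [AddCommGroup P] [Module k P] [AddCommGroup M] [Module k M]

/-- Left multiplication by elements of `F` on `Λ(F) ⊗ M`. -/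
def low (k F M : Type*) [Field k] [AddCommGroup F] [Module k F] [AddCommGroup M] [Module k M] :
    F →ₗ[k] Module.End k (ExteriorAlgebra k F ⊗[k] M) :=
  LinearMap.rTensorHom M ∘ₗ LinearMap.mul k (ExteriorAlgebra k F) ∘ₗ ExteriorAlgebra.ι k

@[simp] theorem low_tmul (f : F) (w : ExteriorAlgebra k F) (m : M) :
    low k F M f (w ⊗ₜ m) = (ExteriorAlgebra.ι k f * w) ⊗ₜ m := rfl

theorem low_low_self (f : F) (v : ExteriorAlgebra k F ⊗[k] M) :
    low k F M f (low k F M f v) = 0 := by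
  induction v using TensorProduct.induction_on with
  | zero => simp
  | add x y hx hy => simp [hx, hy]
  | tmul w m => simp [← mul_assoc]

theorem low_low_swap (f f' : F) (v : ExteriorAlgebra k F ⊗[k] M) :
    low k F M f (low k F M f' v) = - low k F M f' (low k F M f v) := by
  have h := low_low_self (f + f') v
  simp only [map_add, LinearMap.add_apply, low_low_self, zero_add, add_zero] at h
  exact eq_neg_of_add_eq_zero_right h

/-- 1 ⊗ M generates Λ(F) ⊗ M under left multiplications, so an operator identity need only be
checked on 1 ⊗ M and carried past one factor from F. The relations among the operators of G and P
are proved this way. -/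
theorem induction_low {p : ExteriorAlgebra k F ⊗[k] M → Prop}
    (h1 : ∀ m : M, p (1 ⊗ₜ m)) (hadd : ∀ x y, p x → p y → p (x + y))
    (hlow : ∀ f v, p v → p (low k F M f v)) (v : ExteriorAlgebra k F ⊗[k] M) : p v := by
  induction v using TensorProduct.induction_on with
  | zero => simpa using h1 0
  | add x y hx hy => exact hadd x y hx hy
  | tmul w m =>
    induction w using CliffordAlgebra.left_induction with
    | algebraMap r =>
      rw [Algebra.algebraMap_eq_smul_one, TensorProduct.smul_tmul]
      exact h1 _
    | add x y hx hy =>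
      rw [TensorProduct.add_tmul]
      exact hadd _ _ hx hy
    | ι_mul x f hx => exact hlow f _ hx

variable (T : TripleAction k F G P M)

/-- One step of the recursion that defines the action of `x : G`. -/
def levelFold (x : G) : F →ₗ[k]
    ExteriorAlgebra k F × (M →ₗ[k] ExteriorAlgebra k F ⊗[k] M) →ₗ[k]
      (M →ₗ[k] ExteriorAlgebra k F ⊗[k] M) :=
  LinearMap.mk₂ k (fun f p => TensorProduct.mk k (ExteriorAlgebra k F) M (ExteriorAlgebra.ι k (T.gf x f) * p.1) +
    low k F M f ∘ₗ p.2)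
    (fun f f' p => by
      ext m
      simp [add_mul]; abel)
    (fun c f p => by
      ext m
      simp [TensorProduct.smul_tmul'])
    (fun f p p' => by
      ext m
      simp [mul_add]; abel)
    (fun c f p => by
      ext m
      simp [TensorProduct.smul_tmul'])

theorem levelFold_apply (x : G) (f : F) (w : ExteriorAlgebra k F)
    (S : M →ₗ[k] ExteriorAlgebra k F ⊗[k] M) (m : M) :
    T.levelFold x f (w, S) m = low k F M (T.gf x f) (w ⊗ₜ m) + low k F M f (S m) := rfl

/-- Consistency of the fold: the step repeated with the same f must be multiplication by the
quadratic form, here 0. The terms (x·f) ∧ f ∧ w and f ∧ (x·f) ∧ w cancel. The fold carries w beside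
the partial result because the derivation rule needs both. -/
theorem levelFold_self (x : G) (f : F) (w : ExteriorAlgebra k F)
    (S : M →ₗ[k] ExteriorAlgebra k F ⊗[k] M) :
    T.levelFold x f (CliffordAlgebra.ι 0 f * w, T.levelFold x f (w, S)) =
      (0 : QuadraticForm k F) f • S := by
  ext m
  have h : ((CliffordAlgebra.ι 0 f * w : ExteriorAlgebra k F) ⊗ₜ[k] m) =
    low k F M f (w ⊗ₜ m) := rfl
  rw [levelFold_apply, levelFold_apply, h, low_low_swap (T.gf x f), map_add, low_low_self]
  simp

/-- The action of `x : G` on `Λ(F) ⊗ M`. -/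
def levelAux (x : G) : Module.End k (ExteriorAlgebra k F ⊗[k] M) :=
  TensorProduct.lift (CliffordAlgebra.foldr' 0 (T.levelFold x) (T.levelFold_self x)
    (TensorProduct.mk k (ExteriorAlgebra k F) M 1 ∘ₗ T.ρ x))

theorem levelAux_one (x : G) (m : M) : T.levelAux x (1 ⊗ₜ m) = 1 ⊗ₜ T.ρ x m := by
  have h := CliffordAlgebra.foldr'_algebraMap 0 (T.levelFold x) (T.levelFold_self x)
    (TensorProduct.mk k (ExteriorAlgebra k F) M 1 ∘ₗ T.ρ x) 1
  rw [RingHom.map_one, one_smul] at h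
  rw [levelAux, TensorProduct.lift.tmul]
  exact congr($h m)

theorem levelAux_low (x : G) (f : F) (v : ExteriorAlgebra k F ⊗[k] M) :
    T.levelAux x (low k F M f v) = low k F M (T.gf x f) v + low k F M f (T.levelAux x v) := by
  induction v using TensorProduct.induction_on with
  | zero => simp
  | add a b ha hb => simp only [map_add, ha, hb]; abel
  | tmul w m =>
    have h := CliffordAlgebra.foldr'_ι_mul 0 (T.levelFold x) (T.levelFold_self x)
      (TensorProduct.mk k (ExteriorAlgebra k F) M 1 ∘ₗ T.ρ x) f w
    rw [low_tmul, levelAux, TensorProduct.lift.tmul, TensorProduct.lift.tmul]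
    exact congr($h m)

/-- The action of `G` on `Λ(F) ⊗ M`. -/
def level : G →ₗ[k] Module.End k (ExteriorAlgebra k F ⊗[k] M) where
  toFun := T.levelAux
  map_add' x y := by
    refine LinearMap.ext fun v => ?_
    refine induction_low (p := fun v => T.levelAux (x + y) v = (T.levelAux x + T.levelAux y) v)
      (fun m => ?_) (fun a b ha hb => by rw [map_add, map_add, ha, hb]) (fun f v hv => ?_) v
    · simp [levelAux_one, TensorProduct.tmul_add]
    · rw [LinearMap.add_apply] at hv
      rw [levelAux_low, hv]
      simp only [LinearMap.add_apply, levelAux_low, map_add]; abel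
  map_smul' c x := by
    refine LinearMap.ext fun v => ?_
    refine induction_low (p := fun v => T.levelAux (c • x) v = (c • T.levelAux x) v)
      (fun m => ?_) (fun a b ha hb => by rw [map_add, map_add, ha, hb]) (fun f v hv => ?_) v
    · simp [levelAux_one]
    · rw [LinearMap.smul_apply] at hv
      rw [levelAux_low, hv]
      simp only [LinearMap.smul_apply, levelAux_low, map_smul, smul_add]

theorem level_one (x : G) (m : M) : T.level x (1 ⊗ₜ m) = 1 ⊗ₜ T.ρ x m := T.levelAux_one x m

theorem level_low (x : G) (f : F) (v : ExteriorAlgebra k F ⊗[k] M) :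
    T.level x (low k F M f v) = low k F M (T.gf x f) v + low k F M f (T.level x v) :=
  T.levelAux_low x f v

theorem level_gg (x y : G) (v : ExteriorAlgebra k F ⊗[k] M) :
    T.level (T.gg x y) v = T.level x (T.level y v) - T.level y (T.level x v) := by
  refine induction_low (p := fun v => T.level (T.gg x y) v = T.level x (T.level y v) -
    T.level y (T.level x v)) (fun m => ?_) (fun a b ha hb => ?_) (fun f v hv => ?_) v
  · simp [level_one, T.ρ_gg, TensorProduct.tmul_sub]
  · simp only [map_add, ha, hb]; abel
  · simp only [level_low, hv, T.gf_gg, map_add, map_sub, LinearMap.sub_apply]; abel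

/-- One step of the recursion that defines the action of `e : P`. -/
def raiseFold (e : P) : F →ₗ[k]
    ExteriorAlgebra k F × (M →ₗ[k] ExteriorAlgebra k F ⊗[k] M) →ₗ[k]
      (M →ₗ[k] ExteriorAlgebra k F ⊗[k] M) :=
  LinearMap.mk₂ k (fun f p => T.level (T.pf e f) ∘ₗ TensorProduct.mk k (ExteriorAlgebra k F) M p.1 -
    low k F M f ∘ₗ p.2)
    (fun f f' p => by
      ext m
      simp; abel)
    (fun c f p => by
      ext m
      simp [smul_sub])
    (fun f p p' => by
      ext m
      simp; abel)
    (fun c f p => by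
      ext m
      simp [smul_sub])

theorem raiseFold_apply (e : P) (f : F) (w : ExteriorAlgebra k F)
    (S : M →ₗ[k] ExteriorAlgebra k F ⊗[k] M) (m : M) :
    T.raiseFold e f (w, S) m = T.level (T.pf e f) (w ⊗ₜ m) - low k F M f (S m) := rfl

/-- Two steps leave left multiplication by [[e, f], f], so `gf_pf_self` is exactly the condition
that makes the recursion consistent. -/
theorem raiseFold_self (e : P) (f : F) (w : ExteriorAlgebra k F)
    (S : M →ₗ[k] ExteriorAlgebra k F ⊗[k] M) :
    T.raiseFold e f (CliffordAlgebra.ι 0 f * w, T.raiseFold e f (w, S)) =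
      (0 : QuadraticForm k F) f • S := by
  ext m
  have h : ((CliffordAlgebra.ι 0 f * w : ExteriorAlgebra k F) ⊗ₜ[k] m) =
    low k F M f (w ⊗ₜ m) := rfl
  rw [raiseFold_apply, raiseFold_apply, h, level_low, T.gf_pf_self, map_sub, low_low_self]
  simp

/-- The action of `e : P` on `Λ(F) ⊗ M`. -/
def raiseAux (e : P) : Module.End k (ExteriorAlgebra k F ⊗[k] M) :=
  TensorProduct.lift (CliffordAlgebra.foldr' 0 (T.raiseFold e) (T.raiseFold_self e)
    (0 : M →ₗ[k] ExteriorAlgebra k F ⊗[k] M))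

theorem raiseAux_one (e : P) (m : M) : T.raiseAux e (1 ⊗ₜ m) = 0 := by
  have h := CliffordAlgebra.foldr'_algebraMap 0 (T.raiseFold e) (T.raiseFold_self e)
    (0 : M →ₗ[k] ExteriorAlgebra k F ⊗[k] M) 1
  rw [RingHom.map_one, one_smul] at h
  rw [raiseAux, TensorProduct.lift.tmul]
  exact congr($h m)

theorem raiseAux_low (e : P) (f : F) (v : ExteriorAlgebra k F ⊗[k] M) :
    T.raiseAux e (low k F M f v) = T.level (T.pf e f) v - low k F M f (T.raiseAux e v) := by
  induction v using TensorProduct.induction_on with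
  | zero => simp
  | add a b ha hb => simp only [map_add, ha, hb]; abel
  | tmul w m =>
    have h := CliffordAlgebra.foldr'_ι_mul 0 (T.raiseFold e) (T.raiseFold_self e)
      (0 : M →ₗ[k] ExteriorAlgebra k F ⊗[k] M) f w
    rw [low_tmul, raiseAux, TensorProduct.lift.tmul, TensorProduct.lift.tmul]
    exact congr($h m)

/-- The action of `P` on `Λ(F) ⊗ M`. -/
def raise : P →ₗ[k] Module.End k (ExteriorAlgebra k F ⊗[k] M) where
  toFun := T.raiseAux
  map_add' x y := by
    refine LinearMap.ext fun v => ?_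
    refine induction_low (p := fun v => T.raiseAux (x + y) v = (T.raiseAux x + T.raiseAux y) v)
      (fun m => ?_) (fun a b ha hb => by rw [map_add, map_add, ha, hb]) (fun f v hv => ?_) v
    · simp [raiseAux_one]
    · rw [LinearMap.add_apply] at hv
      rw [raiseAux_low, hv]
      simp only [LinearMap.add_apply, raiseAux_low, map_add]; abel
  map_smul' c x := by
    refine LinearMap.ext fun v => ?_
    refine induction_low (p := fun v => T.raiseAux (c • x) v = (c • T.raiseAux x) v)
      (fun m => ?_) (fun a b ha hb => by rw [map_add, map_add, ha, hb]) (fun f v hv => ?_) v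
    · simp [raiseAux_one]
    · rw [LinearMap.smul_apply] at hv
      rw [raiseAux_low, hv]
      simp only [LinearMap.smul_apply, raiseAux_low, map_smul, smul_sub]

theorem raise_one (e : P) (m : M) : T.raise e (1 ⊗ₜ m) = 0 := T.raiseAux_one e m

theorem raise_low (e : P) (f : F) (v : ExteriorAlgebra k F ⊗[k] M) :
    T.raise e (low k F M f v) = T.level (T.pf e f) v - low k F M f (T.raise e v) :=
  T.raiseAux_low e f v

theorem raise_gp (x : G) (e : P) (v : ExteriorAlgebra k F ⊗[k] M) :
    T.raise (T.gp x e) v = T.level x (T.raise e v) - T.raise e (T.level x v) := by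
  refine induction_low (p := fun v => T.raise (T.gp x e) v = T.level x (T.raise e v) -
    T.raise e (T.level x v)) (fun m => ?_) (fun a b ha hb => ?_) (fun f v hv => ?_) v
  · simp [level_one, raise_one]
  · simp only [map_add, ha, hb]; abel
  · simp only [level_low, raise_low, hv, T.pf_gp, T.level_gg, map_add, map_sub,
      LinearMap.sub_apply]; abel

/-- Moving both operators past f produces the actions of [[e, f], e'] and [[e', f], e], which cancel
by `gp_pf`; the rest is the inductive hypothesis. -/
theorem raise_raise (e e' : P) (v : ExteriorAlgebra k F ⊗[k] M) :
    T.raise e (T.raise e' v) = - T.raise e' (T.raise e v) := by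
  refine induction_low (p := fun v => T.raise e (T.raise e' v) = - T.raise e' (T.raise e v))
    (fun m => ?_) (fun a b ha hb => ?_) (fun f v hv => ?_) v
  · simp [raise_one]
  · simp only [map_add, ha, hb]; abel
  · have h1 := T.raise_gp (T.pf e f) e' v
    have h2 := T.raise_gp (T.pf e' f) e v
    have h3 : T.raise (T.gp (T.pf e f) e') v + T.raise (T.gp (T.pf e' f) e) v = 0 := by
      rw [← LinearMap.add_apply, ← map_add, T.gp_pf]; simp
    rw [h1, h2] at h3
    simp only [raise_low, map_sub, hv, map_neg]
    rw [← sub_eq_zero, ← neg_eq_zero, ← h3]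
    abel

/-- The projection of `Λ(F) ⊗ M` onto `M`. -/
def proj (k F M : Type*) [Field k] [AddCommGroup F] [Module k F] [AddCommGroup M] [Module k M] :
    ExteriorAlgebra k F ⊗[k] M →ₗ[k] M :=
  TensorProduct.lid k M ∘ₗ LinearMap.rTensor M ExteriorAlgebra.algebraMapInv.toLinearMap

theorem proj_one (m : M) : proj k F M (1 ⊗ₜ m) = m := by simp [proj]

theorem proj_low (f : F) (v : ExteriorAlgebra k F ⊗[k] M) : proj k F M (low k F M f v) = 0 := by
  induction v using TensorProduct.induction_on with
  | zero => simp
  | add a b ha hb => simp only [map_add, ha, hb, add_zero]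
  | tmul w m => simp [proj, ExteriorAlgebra.algebraMapInv]

/-- G acts by derivations and so preserves the positive degree part, which the projection kills. -/
theorem proj_level (x : G) (v : ExteriorAlgebra k F ⊗[k] M) :
    proj k F M (T.level x v) = T.ρ x (proj k F M v) := by
  refine induction_low (p := fun v => proj k F M (T.level x v) = T.ρ x (proj k F M v))
    (fun m => ?_) (fun a b ha hb => ?_) (fun f v hv => ?_) v
  · simp [level_one, proj_one]
  · simp only [map_add, ha, hb]
  · simp [level_low, proj_low]

end TripleAction

/-! ### The exterior algebra model as a module over the enveloping superalgebra. -/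

namespace LieSuperalgebra

theorem Enveloping.induction {k L : Type*} [Field k] [AddCommGroup L] [Module k L]
    [LieSuperalgebra k L] {p : Enveloping k L → Prop}
    (algebraMap : ∀ c : k, p (algebraMap k _ c)) (ι : ∀ x : L, p (Enveloping.ι k L x))
    (mul : ∀ s t, p s → p t → p (s * t)) (add : ∀ s t, p s → p t → p (s + t))
    (s : Enveloping k L) : p s := by
  obtain ⟨t, rfl⟩ := RingQuot.mkAlgHom_surjective k (EnvelopingRel k L) s
  induction t using TensorAlgebra.induction with
  | algebraMap c =>
    rw [AlgHom.commutes]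
    exact algebraMap c
  | ι x => exact ι x
  | mul a b ha hb =>
    rw [map_mul]
    exact mul _ _ ha hb
  | add a b ha hb =>
    rw [map_add]
    exact add _ _ ha hb

namespace DistinguishedGrading

section Pieces

variable {k L : Type*} [Field k] [AddCommGroup L] [Module k L] [LieSuperalgebra k L]
  (D : DistinguishedGrading k L)

theorem piece_neg_one_le : D.piece (-1) ≤ part 1 :=
  le_sup_left.trans D.piece_odd.le

/-- The projection onto a homogeneous component. -/
def component (i : ℤ) : L →ₗ[k] D.piece i :=
  DirectSum.component k ℤ (fun i => D.piece i) i ∘ₗ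
    (LinearEquiv.ofBijective (DirectSum.coeLinearMap D.piece) D.isInternal).symm.toLinearMap

theorem component_same {i : ℤ} {x : L} (hx : x ∈ D.piece i) : D.component i x = ⟨x, hx⟩ :=
  D.isInternal.ofBijective_coeLinearMap_same ⟨x, hx⟩

theorem component_of_ne {i j : ℤ} (hij : i ≠ j) {x : L} (hx : x ∈ D.piece i) :
    D.component j x = 0 :=
  D.isInternal.ofBijective_coeLinearMap_of_ne hij ⟨x, hx⟩

theorem mem_zero {x : L} (hx : x ∈ (part 0 : Submodule k L)) : x ∈ D.piece 0 := D.piece_zero ▸ hx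

theorem evenProj_even {x : L} (hx : x ∈ (part 0 : Submodule k L)) : evenProj k L x = ⟨x, hx⟩ :=
  Submodule.projectionOnto_apply_left (isCompl (k := k) (L := L)) ⟨x, hx⟩

theorem evenProj_odd {x : L} (hx : x ∈ (part 1 : Submodule k L)) : evenProj k L x = 0 :=
  (Submodule.projectionOnto_apply_eq_zero_iff (isCompl (k := k) (L := L)) (x := x)).mpr hx

theorem odd_induction {p : L → Prop} (hadd : ∀ x y, p x → p y → p (x + y))
    (hneg : ∀ x ∈ D.piece (-1), p x) (hpos : ∀ x ∈ D.piece 1, p x) {x : L}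
    (hx : x ∈ (part 1 : Submodule k L)) : p x := by
  obtain ⟨y, hy, z, hz, rfl⟩ := Submodule.mem_sup.mp (D.piece_odd ▸ hx)
  exact hadd _ _ (hneg y hy) (hpos z hz)

theorem piece_induction {p : L → Prop} (hadd : ∀ x y, p x → p y → p (x + y))
    (hneg : ∀ x ∈ D.piece (-1), p x) (hzero : ∀ x ∈ (part 0 : Submodule k L), p x)
    (hpos : ∀ x ∈ D.piece 1, p x) (x : L) : p x := by
  have hx : x ∈ (part 0 : Submodule k L) ⊔ part 1 := by
    rw [(isCompl (k := k) (L := L)).sup_eq_top]; trivial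
  obtain ⟨y, hy, z, hz, rfl⟩ := Submodule.mem_sup.mp hx
  exact hadd _ _ (hzero y hy) (D.odd_induction hadd hneg hpos hz)

theorem bracket_neg_neg {x y : L} (hx : x ∈ D.piece (-1)) (hy : y ∈ D.piece (-1)) :
    bracket (k := k) x y = 0 := by
  have h := D.bracket_mem hx hy
  rwa [D.piece_eq_bot (-1 + -1) (by decide), Submodule.mem_bot] at h

theorem bracket_pos_pos {x y : L} (hx : x ∈ D.piece 1) (hy : y ∈ D.piece 1) :
    bracket (k := k) x y = 0 := by
  have h := D.bracket_mem hx hy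
  rwa [D.piece_eq_bot (1 + 1) (by decide), Submodule.mem_bot] at h

theorem bracket_zero_left_mem {i : ℤ} {x y : L} (hx : x ∈ (part 0 : Submodule k L))
    (hy : y ∈ D.piece i) : bracket (k := k) x y ∈ D.piece i := by
  have h := D.bracket_mem (D.mem_zero hx) hy
  rwa [zero_add] at h

theorem bracket_pos_neg_mem {x y : L} (hx : x ∈ D.piece 1) (hy : y ∈ D.piece (-1)) :
    bracket (k := k) x y ∈ (part 0 : Submodule k L) := by
  have h := D.bracket_mem hx hy
  rwa [add_neg_cancel, D.piece_zero] at h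

theorem bracket_bracket_even {x y : L} (z : L) (hx : x ∈ (part 0 : Submodule k L)) {j : ZMod 2}
    (hy : y ∈ (part j : Submodule k L)) :
    bracket (k := k) (bracket (k := k) x y) z =
      bracket (k := k) x (bracket (k := k) y z) - bracket (k := k) y (bracket (k := k) x z) := by
  rw [jacobi z hx hy]
  simp [superSign]

theorem bracket_bracket_odd {x y : L} (z : L) (hx : x ∈ (part 1 : Submodule k L))
    (hy : y ∈ (part 1 : Submodule k L)) :
    bracket (k := k) (bracket (k := k) x y) z =
      bracket (k := k) x (bracket (k := k) y z) + bracket (k := k) y (bracket (k := k) x z) := by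
  rw [jacobi z hx hy]
  simp [superSign]

theorem skew_even {x y : L} {j : ZMod 2} (hx : x ∈ (part 0 : Submodule k L))
    (hy : y ∈ (part j : Submodule k L)) :
    bracket (k := k) x y = -bracket (k := k) y x := by
  rw [skew hx hy]
  simp [superSign]

theorem skew_odd {x y : L} (hx : x ∈ (part 1 : Submodule k L))
    (hy : y ∈ (part 1 : Submodule k L)) :
    bracket (k := k) x y = bracket (k := k) y x := by
  rw [skew hx hy]
  simp [superSign]

/-- The bracket of the even part with a homogeneous component. -/
def evenBracket (i : ℤ) : (part 0 : Submodule k L) →ₗ[k] D.piece i →ₗ[k] D.piece i :=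
  LinearMap.mk₂ k (fun x y => ⟨bracket (k := k) x.1 y.1, D.bracket_zero_left_mem x.2 y.2⟩)
    (fun _ _ _ => Subtype.ext (by simp)) (fun _ _ _ => Subtype.ext (by simp))
    (fun _ _ _ => Subtype.ext (by simp)) (fun _ _ _ => Subtype.ext (by simp))

/-- The bracket of the components of degree `1` and `-1`. -/
def oddBracket : D.piece 1 →ₗ[k] D.piece (-1) →ₗ[k] (part 0 : Submodule k L) :=
  LinearMap.mk₂ k (fun x y => ⟨bracket (k := k) x.1 y.1, D.bracket_pos_neg_mem x.2 y.2⟩)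
    (fun _ _ _ => Subtype.ext (by simp)) (fun _ _ _ => Subtype.ext (by simp))
    (fun _ _ _ => Subtype.ext (by simp)) (fun _ _ _ => Subtype.ext (by simp))

theorem coe_evenBracket (i : ℤ) (x : (part 0 : Submodule k L)) (y : D.piece i) :
    (D.evenBracket i x y : L) = bracket (k := k) (x : L) (y : L) := rfl

theorem coe_oddBracket (x : D.piece 1) (y : D.piece (-1)) :
    (D.oddBracket x y : L) = bracket (k := k) (x : L) (y : L) := rfl

/-- Super Jacobi with [f, f'] = 0. On the diagonal it says 2 [[e, f], f] = 0, the consistency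
condition for the raising operators. -/
theorem evenBracket_oddBracket_neg (e : D.piece 1) (f f' : D.piece (-1)) :
    D.evenBracket (-1) (D.oddBracket e f) f' + D.evenBracket (-1) (D.oddBracket e f') f = 0 := by
  apply Subtype.ext
  simp only [coe_evenBracket, coe_oddBracket, Submodule.coe_add, Submodule.coe_zero]
  rw [bracket_bracket_odd _ (D.piece_one_le e.2) (D.piece_neg_one_le f.2),
    D.bracket_neg_neg f.2 f'.2, map_zero, zero_add,
    skew_even (D.bracket_pos_neg_mem e.2 f'.2) (D.piece_neg_one_le f.2), add_neg_cancel]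

/-- Super Jacobi with [e, e'] = 0; it makes the raising operators anticommute. -/
theorem evenBracket_oddBracket_pos (e e' : D.piece 1) (f : D.piece (-1)) :
    D.evenBracket 1 (D.oddBracket e f) e' + D.evenBracket 1 (D.oddBracket e' f) e = 0 := by
  apply Subtype.ext
  simp only [coe_evenBracket, coe_oddBracket, Submodule.coe_add, Submodule.coe_zero]
  rw [bracket_bracket_odd _ (D.piece_one_le e.2) (D.piece_neg_one_le f.2),
    D.bracket_pos_pos e.2 e'.2, map_zero, add_zero,
    skew_even (D.bracket_pos_neg_mem e'.2 f.2) (D.piece_one_le e.2),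
    skew_odd (D.piece_neg_one_le f.2) (D.piece_one_le e'.2), add_neg_cancel]

theorem parabolicInclusion_ι (A : Type*) [CommRing A] [Algebra k A]
    (x : A ⊗[k] D.parabolic.carrier) :
    D.parabolicInclusion A (Enveloping.ι k (A ⊗[k] D.parabolic.carrier) x) =
      Enveloping.ι k (A ⊗[k] L) (LinearMap.lTensor A D.parabolic.carrier.subtype x) := by
  rw [parabolicInclusion]
  generalize_proofs
  apply Enveloping.lift_ι
  assumption

variable [CharZero k]

theorem coe_even_lie (x y : (part 0 : Submodule k L)) :
    ((⁅x, y⁆ : (part 0 : Submodule k L)) : L) = bracket (k := k) (x : L) (y : L) := rfl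

theorem evenBracket_lie {i : ℤ} (x y : (part 0 : Submodule k L)) (f : D.piece i) :
    D.evenBracket i ⁅x, y⁆ f =
      D.evenBracket i x (D.evenBracket i y f) - D.evenBracket i y (D.evenBracket i x f) := by
  apply Subtype.ext
  simp only [coe_evenBracket, Submodule.coe_sub, coe_even_lie]
  exact bracket_bracket_even _ x.2 y.2

theorem oddBracket_evenBracket (x : (part 0 : Submodule k L)) (e : D.piece 1) (f : D.piece (-1)) :
    D.oddBracket (D.evenBracket 1 x e) f =
      ⁅x, D.oddBracket e f⁆ - D.oddBracket e (D.evenBracket (-1) x f) := by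
  apply Subtype.ext
  simp only [coe_evenBracket, coe_oddBracket, Submodule.coe_sub, coe_even_lie]
  exact bracket_bracket_even _ x.2 (D.piece_one_le e.2)

end Pieces

section Action

variable {k L : Type*} [Field k] [CharZero k] [AddCommGroup L] [Module k L] [LieSuperalgebra k L]
  (D : DistinguishedGrading k L) (A : Type*) [CommRing A] [Algebra k A]
  (M : Type*) [AddCommGroup M] [Module k M] [LieRingModule (A ⊗[k] (part 0 : Submodule k L)) M]
  [LieModule k (A ⊗[k] (part 0 : Submodule k L)) M]

/-- The brackets of `A ⊗ L` together with the action of `A ⊗ L₀` on `M`. -/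
def tripleAction : TripleAction k (A ⊗[k] D.piece (-1)) (A ⊗[k] (part 0 : Submodule k L))
    (A ⊗[k] D.piece 1) M where
  gf := TensorProduct.map₂ (LinearMap.mul k A) (D.evenBracket (-1))
  pf := TensorProduct.map₂ (LinearMap.mul k A) D.oddBracket
  gp := TensorProduct.map₂ (LinearMap.mul k A) (D.evenBracket 1)
  gg := LieModule.toEnd k (A ⊗[k] (part 0 : Submodule k L)) (A ⊗[k] (part 0 : Submodule k L))
  ρ := LieModule.toEnd k (A ⊗[k] (part 0 : Submodule k L)) M
  gf_gg x y f := by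
    induction x using TensorProduct.induction_on with
    | zero => simp
    | add x x' h h' => simp only [map_add, LinearMap.add_apply, h, h']; abel
    | tmul a x =>
      induction y using TensorProduct.induction_on with
      | zero => simp
      | add x x' h h' => simp only [map_add, LinearMap.add_apply, h, h']; abel
      | tmul b y =>
        induction f using TensorProduct.induction_on with
        | zero => simp
        | add x x' h h' => simp only [map_add, h, h']; abel
        | tmul c f =>
          simp only [LieHom.coe_toLinearMap, LieModule.toEnd_apply_apply,
            LieAlgebra.ExtendScalars.bracket_tmul, TensorProduct.map₂_apply_tmul, TensorProduct.map_tmul,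
            LinearMap.mul_apply', D.evenBracket_lie, TensorProduct.tmul_sub, mul_assoc,
            mul_left_comm b a c]
  pf_gp x e f := by
    induction x using TensorProduct.induction_on with
    | zero => simp
    | add x x' h h' => simp only [map_add, LinearMap.add_apply, h, h']; abel
    | tmul a x =>
      induction e using TensorProduct.induction_on with
      | zero => simp
      | add x x' h h' => simp only [map_add, LinearMap.add_apply, h, h']; abel
      | tmul b y =>
        induction f using TensorProduct.induction_on with
        | zero => simp
        | add x x' h h' => simp only [map_add, h, h']; abel
        | tmul c f =>
          simp only [LieHom.coe_toLinearMap, LieModule.toEnd_apply_apply,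
            LieAlgebra.ExtendScalars.bracket_tmul, TensorProduct.map₂_apply_tmul, TensorProduct.map_tmul,
            LinearMap.mul_apply', D.oddBracket_evenBracket, TensorProduct.tmul_sub, mul_assoc,
            mul_left_comm b a c]
  gf_pf_self e f := by
    -- The condition is quadratic in f and does not pass to sums of tensors. Its polarisation is
    -- trilinear, so pure tensors suffice, and the diagonal case is recovered by dividing by 2.
    have key : ∀ (e : A ⊗[k] D.piece 1) (f f' : A ⊗[k] D.piece (-1)),
        TensorProduct.map₂ (LinearMap.mul k A) (D.evenBracket (-1))
          (TensorProduct.map₂ (LinearMap.mul k A) D.oddBracket e f) f' +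
        TensorProduct.map₂ (LinearMap.mul k A) (D.evenBracket (-1))
          (TensorProduct.map₂ (LinearMap.mul k A) D.oddBracket e f') f = 0 := by
      intro e f f'
      induction e using TensorProduct.induction_on with
      | zero => simp
      | add x x' h h' =>
        simp only [map_add, LinearMap.add_apply]
        rw [add_add_add_comm, h, h', add_zero]
      | tmul a x =>
        induction f using TensorProduct.induction_on with
        | zero => simp
        | add x x' h h' =>
          simp only [map_add, LinearMap.add_apply]
          rw [add_add_add_comm, h, h', add_zero]
        | tmul b y =>
          induction f' using TensorProduct.induction_on with
          | zero => simp
          | add x x' h h' =>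
            simp only [map_add, LinearMap.add_apply]
            rw [add_add_add_comm, h, h', add_zero]
          | tmul c f =>
            simp only [TensorProduct.map₂_apply_tmul, TensorProduct.map_tmul, LinearMap.mul_apply']
            rw [mul_right_comm a c b, ← TensorProduct.tmul_add, D.evenBracket_oddBracket_neg,
              TensorProduct.tmul_zero]
    have h := key e f f
    rw [← two_smul k] at h
    exact (smul_eq_zero.mp h).resolve_left two_ne_zero
  gp_pf e e' f := by
    induction e using TensorProduct.induction_on with
    | zero => simp
    | add x x' h h' =>
      simp only [map_add, LinearMap.add_apply]
      rw [add_add_add_comm, h, h', add_zero]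
    | tmul a x =>
      induction e' using TensorProduct.induction_on with
      | zero => simp
      | add x x' h h' =>
        simp only [map_add, LinearMap.add_apply]
        rw [add_add_add_comm, h, h', add_zero]
      | tmul b y =>
        induction f using TensorProduct.induction_on with
        | zero => simp
        | add x x' h h' =>
          simp only [map_add, LinearMap.add_apply]
          rw [add_add_add_comm, h, h', add_zero]
        | tmul c f =>
          simp only [TensorProduct.map₂_apply_tmul, TensorProduct.map_tmul, LinearMap.mul_apply']
          rw [mul_right_comm b c a, mul_comm b a, mul_right_comm a c b, ← TensorProduct.tmul_add,
            D.evenBracket_oddBracket_pos, TensorProduct.tmul_zero]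
  ρ_gg x y := by
    ext m
    simp

theorem tripleAction_gf_tmul (a b : A) (x : (part 0 : Submodule k L)) (f : D.piece (-1)) :
    (D.tripleAction A M).gf (a ⊗ₜ x) (b ⊗ₜ f) = (a * b) ⊗ₜ D.evenBracket (-1) x f := by
  simp [tripleAction]

theorem tripleAction_gp_tmul (a b : A) (x : (part 0 : Submodule k L)) (e : D.piece 1) :
    (D.tripleAction A M).gp (a ⊗ₜ x) (b ⊗ₜ e) = (a * b) ⊗ₜ D.evenBracket 1 x e := by
  simp [tripleAction]

theorem tripleAction_pf_tmul (a b : A) (e : D.piece 1) (f : D.piece (-1)) :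
    (D.tripleAction A M).pf (a ⊗ₜ e) (b ⊗ₜ f) = (a * b) ⊗ₜ D.oddBracket e f := by
  simp [tripleAction]

theorem tripleAction_gg_tmul (a b : A) (x y : (part 0 : Submodule k L)) :
    (D.tripleAction A M).gg (a ⊗ₜ x) (b ⊗ₜ y) = (a * b) ⊗ₜ ⁅x, y⁆ := by
  simp [tripleAction]

theorem tripleAction_ρ (x : A ⊗[k] (part 0 : Submodule k L)) (m : M) :
    (D.tripleAction A M).ρ x m = ⁅x, m⁆ := rfl

/-- The exterior algebra model of the generalized Kac module. -/
abbrev KacModel : Type _ := ExteriorAlgebra k (A ⊗[k] D.piece (-1)) ⊗[k] M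

instance modelEndRing : Ring (Module.End k (D.KacModel A M)) :=
  @Module.End.instRing k (D.KacModel A M) _ TensorProduct.addCommGroup _

/-- The action of `A ⊗ L` on the exterior algebra model. -/
def modelAction : A ⊗[k] L →ₗ[k] Module.End k (D.KacModel A M) :=
  TripleAction.low k _ M ∘ₗ LinearMap.lTensor A (D.component (-1)) +
    (D.tripleAction A M).level ∘ₗ LinearMap.lTensor A (evenProj k L) +
    (D.tripleAction A M).raise ∘ₗ LinearMap.lTensor A (D.component 1)

theorem modelAction_neg (a : A) {f : L} (hf : f ∈ D.piece (-1)) :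
    D.modelAction A M (a ⊗ₜ f) = TripleAction.low k _ M (a ⊗ₜ ⟨f, hf⟩) := by
  simp [modelAction, D.component_same hf, evenProj_odd (D.piece_neg_one_le hf),
    D.component_of_ne (show (-1 : ℤ) ≠ 1 by decide) hf]

theorem modelAction_zero (a : A) {x : L} (hx : x ∈ (part 0 : Submodule k L)) :
    D.modelAction A M (a ⊗ₜ x) = (D.tripleAction A M).level (a ⊗ₜ ⟨x, hx⟩) := by
  simp [modelAction, evenProj_even hx,
    D.component_of_ne (show (0 : ℤ) ≠ 1 by decide) (D.mem_zero hx),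
    D.component_of_ne (show (0 : ℤ) ≠ -1 by decide) (D.mem_zero hx)]

theorem modelAction_pos (a : A) {e : L} (he : e ∈ D.piece 1) :
    D.modelAction A M (a ⊗ₜ e) = (D.tripleAction A M).raise (a ⊗ₜ ⟨e, he⟩) := by
  simp [modelAction, D.component_same he, evenProj_odd (D.piece_one_le he),
    D.component_of_ne (show (1 : ℤ) ≠ -1 by decide) he]

theorem modelAction_even_left (a b : A) {x : L} (hx : x ∈ (part 0 : Submodule k L)) (y : L) :
    D.modelAction A M (a ⊗ₜ x) * D.modelAction A M (b ⊗ₜ y) =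
      D.modelAction A M (b ⊗ₜ y) * D.modelAction A M (a ⊗ₜ x) +
        D.modelAction A M ((a * b) ⊗ₜ bracket (k := k) x y) := by
  refine D.piece_induction (p := fun y => D.modelAction A M (a ⊗ₜ x) * D.modelAction A M (b ⊗ₜ y) =
      D.modelAction A M (b ⊗ₜ y) * D.modelAction A M (a ⊗ₜ x) +
        D.modelAction A M ((a * b) ⊗ₜ bracket (k := k) x y)) (fun y y' h h' => ?_)
    (fun f hf => ?_) (fun y hy => ?_) (fun e he => ?_) y
  · simp only [TensorProduct.tmul_add, map_add, mul_add, add_mul, h, h']; abel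
  · refine LinearMap.ext fun v => ?_
    simp only [Module.End.mul_apply, LinearMap.add_apply]
    rw [D.modelAction_zero A M _ hx, D.modelAction_neg A M _ hf,
      D.modelAction_neg A M _ (D.bracket_zero_left_mem hx hf), TripleAction.level_low,
      tripleAction_gf_tmul, add_comm]
    rfl
  · refine LinearMap.ext fun v => ?_
    simp only [Module.End.mul_apply, LinearMap.add_apply]
    rw [D.modelAction_zero A M _ hx, D.modelAction_zero A M _ hy,
      D.modelAction_zero A M _ (bracket_even_mem hx hy)]
    have h := (D.tripleAction A M).level_gg (a ⊗ₜ ⟨x, hx⟩) (b ⊗ₜ ⟨y, hy⟩) v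
    rw [tripleAction_gg_tmul] at h
    exact (add_eq_of_eq_sub' h).symm
  · refine LinearMap.ext fun v => ?_
    simp only [Module.End.mul_apply, LinearMap.add_apply]
    rw [D.modelAction_zero A M _ hx, D.modelAction_pos A M _ he,
      D.modelAction_pos A M _ (D.bracket_zero_left_mem hx he)]
    have h := (D.tripleAction A M).raise_gp (a ⊗ₜ ⟨x, hx⟩) (b ⊗ₜ ⟨e, he⟩) v
    rw [tripleAction_gp_tmul] at h
    exact (add_eq_of_eq_sub' h).symm

theorem modelAction_pos_neg (a b : A) {e f : L} (he : e ∈ D.piece 1) (hf : f ∈ D.piece (-1)) :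
    D.modelAction A M (a ⊗ₜ e) * D.modelAction A M (b ⊗ₜ f) =
      -(D.modelAction A M (b ⊗ₜ f) * D.modelAction A M (a ⊗ₜ e)) +
        D.modelAction A M ((a * b) ⊗ₜ bracket (k := k) e f) := by
  refine LinearMap.ext fun v => ?_
  simp only [Module.End.mul_apply, LinearMap.add_apply, LinearMap.neg_apply]
  rw [D.modelAction_pos A M _ he, D.modelAction_neg A M _ hf,
    D.modelAction_zero A M _ (D.bracket_pos_neg_mem he hf), TripleAction.raise_low,
    tripleAction_pf_tmul, sub_eq_add_neg, add_comm]
  rfl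

theorem modelAction_odd (a b : A) {x y : L} (hx : x ∈ (part 1 : Submodule k L))
    (hy : y ∈ (part 1 : Submodule k L)) :
    D.modelAction A M (a ⊗ₜ x) * D.modelAction A M (b ⊗ₜ y) =
      -(D.modelAction A M (b ⊗ₜ y) * D.modelAction A M (a ⊗ₜ x)) +
        D.modelAction A M ((a * b) ⊗ₜ bracket (k := k) x y) := by
  refine D.odd_induction (p := fun x => D.modelAction A M (a ⊗ₜ x) * D.modelAction A M (b ⊗ₜ y) =
      -(D.modelAction A M (b ⊗ₜ y) * D.modelAction A M (a ⊗ₜ x)) +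
        D.modelAction A M ((a * b) ⊗ₜ bracket (k := k) x y)) (fun x x' h h' => ?_)
    (fun f hf => ?_) (fun e he => ?_) hx
  · simp only [TensorProduct.tmul_add, map_add, LinearMap.add_apply, mul_add, add_mul, h, h']; abel
  · refine D.odd_induction (p := fun y => D.modelAction A M (a ⊗ₜ f) * D.modelAction A M (b ⊗ₜ y) =
      -(D.modelAction A M (b ⊗ₜ y) * D.modelAction A M (a ⊗ₜ f)) +
        D.modelAction A M ((a * b) ⊗ₜ bracket (k := k) f y)) (fun y y' h h' => ?_)
      (fun f' hf' => ?_) (fun e he => ?_) hy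
    · simp only [TensorProduct.tmul_add, map_add, mul_add, add_mul, h, h']; abel
    · refine LinearMap.ext fun v => ?_
      rw [D.bracket_neg_neg hf hf', D.modelAction_neg A M _ hf, D.modelAction_neg A M _ hf']
      simp only [TensorProduct.tmul_zero, map_zero, add_zero]
      exact TripleAction.low_low_swap _ _ v
    · have h := D.modelAction_pos_neg A M b a he hf
      rw [h, mul_comm b a, skew_odd (D.piece_neg_one_le hf) (D.piece_one_le he)]
      abel
  · refine D.odd_induction (p := fun y => D.modelAction A M (a ⊗ₜ e) * D.modelAction A M (b ⊗ₜ y) =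
      -(D.modelAction A M (b ⊗ₜ y) * D.modelAction A M (a ⊗ₜ e)) +
        D.modelAction A M ((a * b) ⊗ₜ bracket (k := k) e y)) (fun y y' h h' => ?_)
      (fun f hf => D.modelAction_pos_neg A M a b he hf) (fun e' he' => ?_) hy
    · simp only [TensorProduct.tmul_add, map_add, mul_add, add_mul, h, h']; abel
    · refine LinearMap.ext fun v => ?_
      rw [D.bracket_pos_pos he he', D.modelAction_pos A M _ he, D.modelAction_pos A M _ he']
      simp only [TensorProduct.tmul_zero, map_zero, add_zero]
      exact TripleAction.raise_raise _ _ _ v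

/-- Skew symmetry turns an even right factor into an even left one, which leaves only that case and
the case of two odd factors. -/
theorem modelAction_rel (a b : A) {i j : ZMod 2} {x y : L}
    (hx : x ∈ (part i : Submodule k L)) (hy : y ∈ (part j : Submodule k L)) :
    D.modelAction A M (a ⊗ₜ x) * D.modelAction A M (b ⊗ₜ y) =
      superSign k i j • (D.modelAction A M (b ⊗ₜ y) * D.modelAction A M (a ⊗ₜ x)) +
        D.modelAction A M ((a * b) ⊗ₜ bracket (k := k) x y) := by
  rcases parity_cases i with rfl | rfl
  · rw [D.modelAction_even_left A M a b hx y]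
    simp [superSign]
  rcases parity_cases j with rfl | rfl
  · rw [D.modelAction_even_left A M b a hy x, mul_comm b a, skew_even hy hx]
    simp [superSign, TensorProduct.tmul_neg]
  · rw [D.modelAction_odd A M a b hx hy, superSign, if_pos ⟨rfl, rfl⟩, neg_one_smul]

theorem modelAction_mul {i j : ZMod 2} {x y : A ⊗[k] L}
    (hx : x ∈ (part i : Submodule k (A ⊗[k] L))) (hy : y ∈ (part j : Submodule k (A ⊗[k] L))) :
    D.modelAction A M x * D.modelAction A M y =
      superSign k i j • (D.modelAction A M y * D.modelAction A M x) +
        D.modelAction A M (bracket (k := k) x y) := by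
  change _ = _ + D.modelAction A M (mapBracket k A L x y)
  refine mapPart_induction (P := fun x => D.modelAction A M x * D.modelAction A M y =
    superSign k i j • (D.modelAction A M y * D.modelAction A M x) +
      D.modelAction A M (mapBracket k A L x y)) ?_ (fun x x' h h' => ?_) (fun a x hx => ?_) hx
  · simp only [map_zero, zero_mul, mul_zero, smul_zero, add_zero, LinearMap.zero_apply]
  · simp only [map_add, LinearMap.add_apply, add_mul, mul_add, h, h', smul_add]; abel
  refine mapPart_induction (P := fun y => D.modelAction A M (a ⊗ₜ x) * D.modelAction A M y =
    superSign k i j • (D.modelAction A M y * D.modelAction A M (a ⊗ₜ x)) +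
      D.modelAction A M (mapBracket k A L (a ⊗ₜ x) y)) ?_ (fun y y' h h' => ?_)
      (fun b y hy => ?_) hy
  · simp only [map_zero, zero_mul, mul_zero, smul_zero, add_zero]
  · simp only [map_add, add_mul, mul_add, h, h', smul_add]; abel
  rw [mapBracket_tmul]
  exact D.modelAction_rel A M a b hx hy

/-- The representation of `U(A ⊗ L)` on the exterior algebra model. -/
def modelRep : Enveloping k (A ⊗[k] L) →ₐ[k] Module.End k (D.KacModel A M) :=
  Enveloping.lift (D.modelAction A M) (fun hx hy => D.modelAction_mul A M hx hy)

theorem modelRep_ι (x : A ⊗[k] L) :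
    D.modelRep A M (Enveloping.ι k (A ⊗[k] L) x) = D.modelAction A M x :=
  Enveloping.lift_ι _ _ x

theorem parabolicRep_ι (x : A ⊗[k] D.parabolic.carrier) :
    D.parabolicRep A M (Enveloping.ι k (A ⊗[k] D.parabolic.carrier) x) = D.parabolicAction A M x := by
  rw [parabolicRep]
  generalize_proofs
  apply Enveloping.lift_ι
  assumption

/-- Degree 1 kills 1 ⊗ M and degree 0 acts there as on M. This equivariance is what the universal
property of the induced module needs in order to give a map to the model. -/
theorem modelRep_parabolicInclusion (r : Enveloping k (A ⊗[k] D.parabolic.carrier)) (m : M) :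
    D.modelRep A M (D.parabolicInclusion A r) (1 ⊗ₜ m) = 1 ⊗ₜ D.parabolicRep A M r m := by
  refine Enveloping.induction (p := fun r => ∀ m : M, D.modelRep A M (D.parabolicInclusion A r)
    (1 ⊗ₜ m) = 1 ⊗ₜ D.parabolicRep A M r m) (fun c m => ?_) (fun x => ?_) (fun s t hs ht m => ?_)
    (fun s t hs ht m => ?_) r m
  · simp
  · rw [parabolicInclusion_ι, modelRep_ι, parabolicRep_ι]
    induction x using TensorProduct.induction_on with
    | zero => simp
    | add x y hx hy =>
      intro m
      simp only [map_add, LinearMap.add_apply, hx, hy, TensorProduct.tmul_add]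
    | tmul a x =>
      intro m
      obtain ⟨x, hx⟩ := x
      obtain ⟨y, hy, e, he, rfl⟩ := Submodule.mem_sup.mp hx
      have hy' : y ∈ (part 0 : Submodule k L) := D.piece_zero ▸ hy
      rw [parabolicAction_tmul, LinearMap.lTensor_tmul]
      have hl : D.levi ⟨y + e, hx⟩ = ⟨y, hy'⟩ := by
        change evenProj k L (y + e) = _
        rw [map_add, evenProj_even hy', evenProj_odd (D.piece_one_le he), add_zero]
      rw [hl]
      change D.modelAction A M (a ⊗ₜ (y + e)) _ = _
      rw [TensorProduct.tmul_add, map_add, D.modelAction_zero A M a hy', D.modelAction_pos A M a he,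
        LinearMap.add_apply, TripleAction.level_one, TripleAction.raise_one, add_zero]
      rfl
  · simp only [map_mul, Module.End.mul_apply, hs, ht]
  · simp only [map_add, LinearMap.add_apply, hs, ht, TensorProduct.tmul_add]

end Action

end DistinguishedGrading

end LieSuperalgebra

/-! ### Words in the degree -1 part of the enveloping superalgebra. -/

namespace LieSuperalgebra

namespace DistinguishedGrading

section Words

variable {k L : Type*} [Field k] [AddCommGroup L] [Module k L] [LieSuperalgebra k L]
  (D : DistinguishedGrading k L) (A : Type*) [CommRing A] [Algebra k A]

theorem ι_tmul_mul (a b : A) {i j : ZMod 2} {x y : L}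
    (hx : x ∈ (part i : Submodule k L)) (hy : y ∈ (part j : Submodule k L)) :
    Enveloping.ι k (A ⊗[k] L) (a ⊗ₜ x) * Enveloping.ι k (A ⊗[k] L) (b ⊗ₜ y) =
      superSign k i j • (Enveloping.ι k (A ⊗[k] L) (b ⊗ₜ y) * Enveloping.ι k (A ⊗[k] L) (a ⊗ₜ x)) +
        Enveloping.ι k (A ⊗[k] L) ((a * b) ⊗ₜ bracket (k := k) x y) := by
  rw [← mapBracket_tmul]
  exact Enveloping.ι_mul_ι (tmul_mem_mapPart a hx) (tmul_mem_mapPart b hy)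

/-- The inclusion of `A ⊗ L₋₁` in `U(A ⊗ L)`. -/
def negι : A ⊗[k] D.piece (-1) →ₗ[k] Enveloping k (A ⊗[k] L) :=
  Enveloping.ι k (A ⊗[k] L) ∘ₗ LinearMap.lTensor A (D.piece (-1)).subtype

@[simp] theorem negι_tmul (a : A) (f : D.piece (-1)) :
    D.negι A (a ⊗ₜ f) = Enveloping.ι k (A ⊗[k] L) (a ⊗ₜ (f : L)) := rfl

theorem even_mul_negι (a b : A) {x : L} (hx : x ∈ (part 0 : Submodule k L)) (f : D.piece (-1)) :
    Enveloping.ι k (A ⊗[k] L) (a ⊗ₜ x) * D.negι A (b ⊗ₜ f) =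
      D.negι A (b ⊗ₜ f) * Enveloping.ι k (A ⊗[k] L) (a ⊗ₜ x) +
        D.negι A ((a * b) ⊗ₜ ⟨bracket (k := k) x f, D.bracket_zero_left_mem hx f.2⟩) := by
  have h := ι_tmul_mul A a b hx (D.piece_neg_one_le f.2)
  simpa [superSign] using h

theorem pos_mul_negι (a b : A) {e : L} (he : e ∈ D.piece 1) (f : D.piece (-1)) :
    Enveloping.ι k (A ⊗[k] L) (a ⊗ₜ e) * D.negι A (b ⊗ₜ f) =
      -(D.negι A (b ⊗ₜ f) * Enveloping.ι k (A ⊗[k] L) (a ⊗ₜ e)) +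
        Enveloping.ι k (A ⊗[k] L) ((a * b) ⊗ₜ bracket (k := k) e (f : L)) := by
  have h := ι_tmul_mul A a b (D.piece_one_le he) (D.piece_neg_one_le f.2)
  simpa [superSign] using h

theorem mapBracket_neg_neg (x y : A ⊗[k] D.piece (-1)) :
    mapBracket k A L (LinearMap.lTensor A (D.piece (-1)).subtype x)
      (LinearMap.lTensor A (D.piece (-1)).subtype y) = 0 := by
  induction x using TensorProduct.induction_on with
  | zero => simp
  | add x x' h h' => rw [map_add, map_add, LinearMap.add_apply, h, h', add_zero]
  | tmul a x =>
    induction y using TensorProduct.induction_on with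
    | zero => simp
    | add y y' h h' => rw [map_add, map_add, h, h', add_zero]
    | tmul b y => simp [D.bracket_neg_neg x.2 y.2]

theorem lTensor_neg_mem (x : A ⊗[k] D.piece (-1)) :
    LinearMap.lTensor A (D.piece (-1)).subtype x ∈ (part 1 : Submodule k (A ⊗[k] L)) := by
  induction x using TensorProduct.induction_on with
  | zero => rw [map_zero]; exact Submodule.zero_mem _
  | add x x' h h' => rw [map_add]; exact Submodule.add_mem _ h h'
  | tmul a x => exact tmul_mem_mapPart a (D.piece_neg_one_le x.2)

/-- Brackets inside degree -1 vanish, so the relation between two odd elements is pure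
anticommutation. -/
theorem negι_mul_negι (x y : A ⊗[k] D.piece (-1)) :
    D.negι A x * D.negι A y = -(D.negι A y * D.negι A x) := by
  have h := Enveloping.ι_mul_ι (D.lTensor_neg_mem A x) (D.lTensor_neg_mem A y)
  have h0 : bracket (k := k) (LinearMap.lTensor A (D.piece (-1)).subtype x)
      (LinearMap.lTensor A (D.piece (-1)).subtype y) = 0 := D.mapBracket_neg_neg A x y
  rw [h0, map_zero, add_zero, superSign, if_pos ⟨rfl, rfl⟩, neg_one_smul] at h
  exact h

theorem negι_mul_self [CharZero k] (x : A ⊗[k] D.piece (-1)) : D.negι A x * D.negι A x = 0 := by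
  have h := eq_neg_iff_add_eq_zero.mp (D.negι_mul_negι A x x)
  rw [← two_smul k] at h
  exact (smul_eq_zero.mp h).resolve_left two_ne_zero

/-- The product of a list of elements of `A ⊗ L₋₁` in `U(A ⊗ L)`. -/
def word (l : List (A ⊗[k] D.piece (-1))) : Enveloping k (A ⊗[k] L) := (l.map (D.negι A)).prod

@[simp] theorem word_nil : D.word A [] = 1 := rfl

@[simp] theorem word_cons (f : A ⊗[k] D.piece (-1)) (l : List (A ⊗[k] D.piece (-1))) :
    D.word A (f :: l) = D.negι A f * D.word A l := by simp [word]

theorem word_append (l l' : List (A ⊗[k] D.piece (-1))) :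
    D.word A (l ++ l') = D.word A l * D.word A l' := by simp [word]

/-- Words are images under the algebra map Λ(A ⊗ L₋₁) → U(A ⊗ L) given by anticommutation, and more
than dim X vectors of X are dependent, so their exterior product is 0. This nilpotence drives both
the description of N(M) and the finite dimensionality of V(M). -/
theorem word_eq_zero [CharZero k] (X : Submodule k (A ⊗[k] D.piece (-1))) [FiniteDimensional k X]
    (l : List (A ⊗[k] D.piece (-1))) (hl : ∀ f ∈ l, f ∈ X)
    (hlen : Module.finrank k X < l.length) : D.word A l = 0 := by
  let ψ := ExteriorAlgebra.lift k ⟨D.negι A, D.negι_mul_self A⟩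
  have hψ : D.word A l = ψ (ExteriorAlgebra.ιMulti k l.length l.get) := by
    rw [ExteriorAlgebra.ιMulti_apply, map_list_prod, List.map_ofFn]
    simp only [word]
    congr 1
    apply List.ext_get
    · simp
    · intro n h1 h2
      simp [ψ]
  let v : Fin l.length → X := fun i => ⟨l.get i, hl _ (l.get_mem i)⟩
  have hv : ¬ LinearIndependent k v := fun h => by
    have := h.fintype_card_le_finrank
    rw [Fintype.card_fin] at this
    omega
  have h0 : (ExteriorAlgebra.ιMulti k l.length).compLinearMap X.subtype v = 0 :=
    AlternatingMap.map_linearDependent _ v hv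
  rw [hψ]
  have h1 : ExteriorAlgebra.ιMulti k l.length l.get = 0 := h0
  rw [h1, map_zero]

variable {K : Type*} [AddCommGroup K] [Module k K] [Module (Enveloping k (A ⊗[k] L)) K]

/-- The span of the products of at least `r` elements of `X` applied to elements of `Y`. -/
def wordSpan (X : Submodule k (A ⊗[k] D.piece (-1))) (r : ℕ) (Y : Submodule k K) :
    Submodule k K :=
  Submodule.span k {v | ∃ l : List (A ⊗[k] D.piece (-1)), (∀ f ∈ l, f ∈ X) ∧ r ≤ l.length ∧
    ∃ y ∈ Y, v = D.word A l • y}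

theorem wordSpan_anti {X : Submodule k (A ⊗[k] D.piece (-1))} {r s : ℕ} (h : r ≤ s)
    {Y : Submodule k K} : D.wordSpan A X s Y ≤ D.wordSpan A X r Y :=
  Submodule.span_mono fun _ ⟨l, hl, hs, hy⟩ => ⟨l, hl, h.trans hs, hy⟩

theorem wordSpan_mono {X X' : Submodule k (A ⊗[k] D.piece (-1))} {r : ℕ} (h : X ≤ X')
    {Y : Submodule k K} : D.wordSpan A X r Y ≤ D.wordSpan A X' r Y :=
  Submodule.span_mono fun _ ⟨l, hl, hs, hy⟩ => ⟨l, fun f hf => h (hl f hf), hs, hy⟩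

theorem le_wordSpan {X : Submodule k (A ⊗[k] D.piece (-1))} {Y : Submodule k K} :
    Y ≤ D.wordSpan A X 0 Y := fun y hy =>
  Submodule.subset_span ⟨[], by simp, le_rfl, y, hy, by simp⟩

/-- A ⊗ L₋₁ may be infinite dimensional, but a single vector involves finitely many letters, which
brings it within reach of `word_eq_zero`. -/
theorem exists_finset_mem_wordSpan {r : ℕ} {Y : Submodule k K} {v : K}
    (hv : v ∈ D.wordSpan A ⊤ r Y) :
    ∃ s : Finset (A ⊗[k] D.piece (-1)), v ∈ D.wordSpan A (Submodule.span k s) r Y := by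
  classical
  induction hv using Submodule.span_induction with
  | mem v hv =>
    obtain ⟨l, -, hr, y, hy, rfl⟩ := hv
    exact ⟨l.toFinset, Submodule.subset_span
      ⟨l, fun f hf => Submodule.subset_span (by simpa using hf), hr, y, hy, rfl⟩⟩
  | zero => exact ⟨∅, Submodule.zero_mem _⟩
  | add x y _ _ hx hy =>
    obtain ⟨s, hs⟩ := hx
    obtain ⟨t, ht⟩ := hy
    refine ⟨s ∪ t, Submodule.add_mem _ (D.wordSpan_mono A (Submodule.span_mono ?_) hs)
      (D.wordSpan_mono A (Submodule.span_mono ?_) ht)⟩ <;> simp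
  | smul c x _ hx =>
    obtain ⟨s, hs⟩ := hx
    exact ⟨s, Submodule.smul_mem _ _ hs⟩

variable [IsScalarTower k (Enveloping k (A ⊗[k] L)) K]

theorem word_smul_mem_wordSpan {X : Submodule k (A ⊗[k] D.piece (-1))} {r s : ℕ}
    {Y : Submodule k K} {l : List (A ⊗[k] D.piece (-1))} (hl : ∀ f ∈ l, f ∈ X)
    (hr : r ≤ l.length) {v : K} (hv : v ∈ D.wordSpan A X s Y) :
    D.word A l • v ∈ D.wordSpan A X (r + s) Y := by
  induction hv using Submodule.span_induction with
  | mem v hv =>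
    obtain ⟨l', hl', hs, y, hy, rfl⟩ := hv
    refine Submodule.subset_span ⟨l ++ l', ?_, by simp; omega, y, hy, ?_⟩
    · intro f hf
      rcases List.mem_append.mp hf with h | h
      exacts [hl f h, hl' f h]
    · rw [word_append, mul_smul]
  | zero => rw [smul_zero]; exact Submodule.zero_mem _
  | add x y _ _ hx hy => rw [smul_add]; exact Submodule.add_mem _ hx hy
  | smul c x _ hx => rw [smul_algebra_smul_comm]; exact Submodule.smul_mem _ _ hx

theorem negι_smul_mem_wordSpan {r : ℕ} {Y : Submodule k K} (f : A ⊗[k] D.piece (-1)) {v : K}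
    (hv : v ∈ D.wordSpan A ⊤ r Y) : D.negι A f • v ∈ D.wordSpan A ⊤ (1 + r) Y := by
  have h := D.word_smul_mem_wordSpan A (X := ⊤) (l := [f]) (r := 1) (fun _ _ => trivial) le_rfl hv
  simpa using h

/-- An even element moves through a word letter by letter; each commutator merely replaces a letter
by another one from A ⊗ L₋₁. -/
theorem even_smul_mem_wordSpan {Y : Submodule k K}
    (heven : ∀ (a : A) (x : L), x ∈ (part 0 : Submodule k L) → ∀ y ∈ Y,
      Enveloping.ι k (A ⊗[k] L) (a ⊗ₜ x) • y ∈ Y)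
    (a : A) {x : L} (hx : x ∈ (part 0 : Submodule k L)) {v : K} (hv : v ∈ D.wordSpan A ⊤ 0 Y) :
    Enveloping.ι k (A ⊗[k] L) (a ⊗ₜ x) • v ∈ D.wordSpan A ⊤ 0 Y := by
  induction hv using Submodule.span_induction with
  | zero => rw [smul_zero]; exact Submodule.zero_mem _
  | add x y _ _ hx hy => rw [smul_add]; exact Submodule.add_mem _ hx hy
  | smul c x _ hx => rw [smul_algebra_smul_comm]; exact Submodule.smul_mem _ _ hx
  | mem v hv =>
    obtain ⟨l, -, -, y, hy, rfl⟩ := hv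
    induction l generalizing a x with
    | nil => simpa using D.le_wordSpan A (heven a x hx y hy)
    | cons f l ih =>
      have hl : D.word A l • y ∈ D.wordSpan A ⊤ 0 Y :=
        Submodule.subset_span ⟨l, fun _ _ => trivial, Nat.zero_le _, y, hy, rfl⟩
      rw [word_cons, ← mul_smul, ← mul_assoc]
      induction f using TensorProduct.induction_on with
      | zero => simp
      | add f f' h h' =>
        rw [map_add, mul_add, add_mul, add_smul]
        exact Submodule.add_mem _ h h'
      | tmul b f =>
        rw [D.even_mul_negι A a b hx, add_mul, add_smul, mul_assoc, mul_smul, mul_smul, mul_smul]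
        exact Submodule.add_mem _
          (D.wordSpan_anti A (Nat.zero_le _) (D.negι_smul_mem_wordSpan A _ (ih a hx)))
          (D.wordSpan_anti A (Nat.zero_le _) (D.negι_smul_mem_wordSpan A _ hl))

/-- Moving a degree 1 element past a letter costs a sign and a bracket in A ⊗ L₀, which
`even_smul_mem_wordSpan` absorbs. -/
theorem pos_smul_mem_wordSpan {Y : Submodule k K}
    (heven : ∀ (a : A) (x : L), x ∈ (part 0 : Submodule k L) → ∀ y ∈ Y,
      Enveloping.ι k (A ⊗[k] L) (a ⊗ₜ x) • y ∈ Y)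
    (hpos : ∀ (a : A) (e : L), e ∈ D.piece 1 → ∀ y ∈ Y,
      Enveloping.ι k (A ⊗[k] L) (a ⊗ₜ e) • y ∈ Y)
    (a : A) {e : L} (he : e ∈ D.piece 1) {v : K} (hv : v ∈ D.wordSpan A ⊤ 0 Y) :
    Enveloping.ι k (A ⊗[k] L) (a ⊗ₜ e) • v ∈ D.wordSpan A ⊤ 0 Y := by
  induction hv using Submodule.span_induction with
  | zero => rw [smul_zero]; exact Submodule.zero_mem _
  | add x y _ _ hx hy => rw [smul_add]; exact Submodule.add_mem _ hx hy
  | smul c x _ hx => rw [smul_algebra_smul_comm]; exact Submodule.smul_mem _ _ hx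
  | mem v hv =>
    obtain ⟨l, -, -, y, hy, rfl⟩ := hv
    induction l generalizing a e with
    | nil => simpa using D.le_wordSpan A (hpos a e he y hy)
    | cons f l ih =>
      have hl : D.word A l • y ∈ D.wordSpan A ⊤ 0 Y :=
        Submodule.subset_span ⟨l, fun _ _ => trivial, Nat.zero_le _, y, hy, rfl⟩
      rw [word_cons, ← mul_smul, ← mul_assoc]
      induction f using TensorProduct.induction_on with
      | zero => simp
      | add f f' h h' =>
        rw [map_add, mul_add, add_mul, add_smul]
        exact Submodule.add_mem _ h h'
      | tmul b f =>
        rw [D.pos_mul_negι A a b he, add_mul, add_smul, neg_mul, neg_smul, mul_assoc, mul_smul,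
          mul_smul, mul_smul]
        exact Submodule.add_mem _ (Submodule.neg_mem _
          (D.wordSpan_anti A (Nat.zero_le _) (D.negι_smul_mem_wordSpan A _ (ih a he))))
          (D.even_smul_mem_wordSpan A heven _ (D.bracket_pos_neg_mem he f.2) hl)

/-- The spanning half of Poincaré–Birkhoff–Witt: for Y stable under A ⊗ (L₀ ⊕ L₁), the submodule
generated by Y needs only words in degree -1. -/
theorem smul_mem_wordSpan {Y : Submodule k K}
    (heven : ∀ (a : A) (x : L), x ∈ (part 0 : Submodule k L) → ∀ y ∈ Y,
      Enveloping.ι k (A ⊗[k] L) (a ⊗ₜ x) • y ∈ Y)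
    (hpos : ∀ (a : A) (e : L), e ∈ D.piece 1 → ∀ y ∈ Y,
      Enveloping.ι k (A ⊗[k] L) (a ⊗ₜ e) • y ∈ Y)
    (s : Enveloping k (A ⊗[k] L)) {v : K} (hv : v ∈ D.wordSpan A ⊤ 0 Y) :
    s • v ∈ D.wordSpan A ⊤ 0 Y := by
  refine Enveloping.induction (p := fun s => ∀ v ∈ D.wordSpan A ⊤ 0 Y, s • v ∈ D.wordSpan A ⊤ 0 Y)
    (fun c v hv => ?_) (fun x v hv => ?_) (fun s t hs ht v hv => ?_) (fun s t hs ht v hv => ?_) s v hv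
  · rw [algebraMap_smul]
    exact Submodule.smul_mem _ _ hv
  · induction x using TensorProduct.induction_on with
    | zero => simp
    | add x y hx hy =>
      rw [map_add, add_smul]
      exact Submodule.add_mem _ hx hy
    | tmul a x =>
      refine D.piece_induction (p := fun x => Enveloping.ι k (A ⊗[k] L) (a ⊗ₜ x) • v ∈
        D.wordSpan A ⊤ 0 Y) (fun x y hx hy => ?_) (fun f hf => ?_)
        (fun x hx => D.even_smul_mem_wordSpan A heven a hx hv)
        (fun e he => D.pos_smul_mem_wordSpan A heven hpos a he hv) x
      · rw [TensorProduct.tmul_add, map_add, add_smul]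
        exact Submodule.add_mem _ hx hy
      · exact D.wordSpan_anti A (Nat.zero_le _) (D.negι_smul_mem_wordSpan A (a ⊗ₜ ⟨f, hf⟩) hv)
  · rw [mul_smul]
    exact hs _ (ht _ hv)
  · rw [add_smul]
    exact Submodule.add_mem _ (hs _ hv) (ht _ hv)

end Words

/-! ### The generalized Kac module and its largest proper submodule. -/

section KacModule

variable {k L : Type*} [Field k] [CharZero k] [AddCommGroup L] [Module k L] [LieSuperalgebra k L]
  (D : DistinguishedGrading k L) (A : Type*) [CommRing A] [Algebra k A]
  (M : Type*) [AddCommGroup M] [Module k M] [LieRingModule (A ⊗[k] (part 0 : Submodule k L)) M]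
  [LieModule k (A ⊗[k] (part 0 : Submodule k L)) M]

/-- The canonical map from `M` to the generalized Kac module. -/
def kacMk : M →ₗ[k] D.KacModule A M :=
  ((balancing (D.parabolicInclusion A) M (D.parabolicRep A M)).mkQ.restrictScalars k) ∘ₗ
    TensorProduct.mk k (Enveloping k (A ⊗[k] L)) M 1

theorem smul_kacMk (s : Enveloping k (A ⊗[k] L)) (m : M) :
    s • D.kacMk A M m = Submodule.Quotient.mk (s ⊗ₜ m) := by
  change s • Submodule.Quotient.mk (1 ⊗ₜ m) = _
  rw [← Submodule.Quotient.mk_smul, TensorProduct.smul_tmul', smul_eq_mul, mul_one]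

theorem parabolicInclusion_smul_kacMk (r : Enveloping k (A ⊗[k] D.parabolic.carrier)) (m : M) :
    D.parabolicInclusion A r • D.kacMk A M m = D.kacMk A M (D.parabolicRep A M r m) := by
  rw [smul_kacMk]
  change _ = Submodule.Quotient.mk (1 ⊗ₜ _)
  rw [Submodule.Quotient.eq]
  refine Submodule.subset_span ⟨1, r, m, by rw [one_mul]⟩

theorem ι_even_smul_kacMk (a : A) (x : (part 0 : Submodule k L)) (m : M) :
    Enveloping.ι k (A ⊗[k] L) (a ⊗ₜ (x : L)) • D.kacMk A M m =
      D.kacMk A M ⁅(a ⊗ₜ[k] x : A ⊗[k] (part 0 : Submodule k L)), m⁆ := by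
  have h := D.parabolicInclusion_smul_kacMk A M (Enveloping.ι k _
    (a ⊗ₜ ⟨(x : L), Submodule.mem_sup_left (D.mem_zero x.2)⟩)) m
  rw [parabolicInclusion_ι, parabolicRep_ι, parabolicAction_tmul] at h
  have hl : D.levi ⟨(x : L), Submodule.mem_sup_left (D.mem_zero x.2)⟩ = x := evenProj_even x.2
  rw [hl] at h
  exact h

theorem ι_pos_smul_kacMk (a : A) {e : L} (he : e ∈ D.piece 1) (m : M) :
    Enveloping.ι k (A ⊗[k] L) (a ⊗ₜ e) • D.kacMk A M m = 0 := by
  have h := D.parabolicInclusion_smul_kacMk A M (Enveloping.ι k _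
    (a ⊗ₜ ⟨e, Submodule.mem_sup_right he⟩)) m
  rw [parabolicInclusion_ι, parabolicRep_ι, parabolicAction_tmul] at h
  have hl : D.levi ⟨e, Submodule.mem_sup_right he⟩ = 0 := by
    change evenProj k L e = 0
    exact evenProj_odd (D.piece_one_le he)
  rw [hl, TensorProduct.tmul_zero, zero_lie, map_zero] at h
  exact h

theorem kac_smul_induction {p : D.KacModule A M → Prop} (hadd : ∀ v w, p v → p w → p (v + w))
    (hsmul : ∀ (s : Enveloping k (A ⊗[k] L)) (m : M), p (s • D.kacMk A M m)) (v : D.KacModule A M) : p v := by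
  obtain ⟨t, rfl⟩ := Submodule.Quotient.mk_surjective _ v
  induction t using TensorProduct.induction_on with
  | zero => simpa using hsmul 0 0
  | add x y hx hy => exact hadd _ _ hx hy
  | tmul s m =>
    rw [← smul_kacMk]
    exact hsmul s m

theorem wordSpan_range_kacMk : D.wordSpan A ⊤ 0 (LinearMap.range (D.kacMk A M)) = ⊤ := by
  rw [eq_top_iff]
  rintro v -
  refine D.kac_smul_induction A M (p := fun v => v ∈ D.wordSpan A ⊤ 0 (LinearMap.range _))
    (fun v w hv hw => Submodule.add_mem _ hv hw) (fun s m => ?_) v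
  refine D.smul_mem_wordSpan A ?_ ?_ s (D.le_wordSpan A ⟨m, rfl⟩)
  · rintro a x hx _ ⟨m, rfl⟩
    exact ⟨_, (D.ι_even_smul_kacMk A M a ⟨x, hx⟩ m).symm⟩
  · rintro a e he _ ⟨m, rfl⟩
    rw [D.ι_pos_smul_kacMk A M a he]
    exact Submodule.zero_mem _

theorem kac_induction {p : D.KacModule A M → Prop} (hmk : ∀ m, p (D.kacMk A M m))
    (hadd : ∀ v w, p v → p w → p (v + w)) (hneg : ∀ f v, p v → p (D.negι A f • v))
    (v : D.KacModule A M) : p v := by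
  have hv : v ∈ D.wordSpan A ⊤ 0 (LinearMap.range (D.kacMk A M)) := by
    rw [wordSpan_range_kacMk]; trivial
  -- The predicate is not assumed stable under scalars while linear spans are. With c quantified,
  -- the scalar can be pushed through the word into M.
  suffices h : ∀ c : k, p (c • v) by simpa using h 1
  induction hv using Submodule.span_induction with
  | zero => intro c; simpa using hmk 0
  | add x y _ _ hx hy => intro c; rw [smul_add]; exact hadd _ _ (hx c) (hy c)
  | smul d x _ hx => intro c; rw [smul_smul]; exact hx _
  | mem v hv =>
    obtain ⟨l, -, -, _, ⟨m, rfl⟩, rfl⟩ := hv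
    intro c
    rw [← smul_algebra_smul_comm, ← map_smul]
    induction l with
    | nil =>
      rw [word_nil, one_smul]
      exact hmk _
    | cons f l ih =>
      rw [word_cons, mul_smul]
      exact hneg _ _ ih

/-- The action on the highest component of the exterior algebra model. -/
def toModelAux : Enveloping k (A ⊗[k] L) ⊗[k] M →ₗ[k] D.KacModel A M :=
  TensorProduct.lift (LinearMap.mk₂ k (fun s m => D.modelRep A M s (1 ⊗ₜ m))
    (fun s t m => by rw [map_add, LinearMap.add_apply])
    (fun c s m => by rw [map_smul, LinearMap.smul_apply])
    (fun s m m' => by rw [TensorProduct.tmul_add, map_add])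
    (fun c s m => by rw [TensorProduct.tmul_smul, map_smul]))

theorem toModelAux_tmul (s : Enveloping k (A ⊗[k] L)) (m : M) :
    D.toModelAux A M (s ⊗ₜ m) = D.modelRep A M s (1 ⊗ₜ m) := rfl

theorem toModelAux_smul (s : Enveloping k (A ⊗[k] L)) (t : Enveloping k (A ⊗[k] L) ⊗[k] M) :
    D.toModelAux A M (s • t) = D.modelRep A M s (D.toModelAux A M t) := by
  induction t using TensorProduct.induction_on with
  | zero => simp
  | add x y hx hy => rw [smul_add, map_add, map_add, map_add, hx, hy]
  | tmul s' m =>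
    rw [TensorProduct.smul_tmul', toModelAux_tmul, toModelAux_tmul, smul_eq_mul, map_mul]
    rfl

theorem toModelAux_balancing {t : Enveloping k (A ⊗[k] L) ⊗[k] M}
    (ht : t ∈ balancing (D.parabolicInclusion A) M (D.parabolicRep A M)) :
    D.toModelAux A M t = 0 := by
  induction ht using Submodule.span_induction with
  | mem t ht =>
    obtain ⟨s, r, m, rfl⟩ := ht
    rw [map_sub, toModelAux_tmul, toModelAux_tmul, map_mul, Module.End.mul_apply,
      modelRep_parabolicInclusion, sub_self]
  | zero => rw [map_zero]
  | add x y _ _ hx hy => rw [map_add, hx, hy, add_zero]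
  | smul s x _ hx => rw [toModelAux_smul, hx, map_zero]

/-- The map from the generalized Kac module to the exterior algebra model. -/
def toModel : D.KacModule A M →ₗ[k] D.KacModel A M :=
  ((balancing (D.parabolicInclusion A) M (D.parabolicRep A M)).restrictScalars k).liftQ
    (D.toModelAux A M) (fun _ ht => D.toModelAux_balancing A M ht) ∘ₗ
    (Submodule.Quotient.restrictScalarsEquiv k
      (balancing (D.parabolicInclusion A) M (D.parabolicRep A M))).symm.toLinearMap

theorem toModel_mk (t : Enveloping k (A ⊗[k] L) ⊗[k] M) :
    D.toModel A M (Submodule.Quotient.mk t) = D.toModelAux A M t := rfl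

theorem toModel_kacMk (m : M) : D.toModel A M (D.kacMk A M m) = 1 ⊗ₜ m := by
  change D.toModelAux A M (1 ⊗ₜ m) = _
  rw [toModelAux_tmul, map_one, Module.End.one_apply]

theorem toModel_smul (s : Enveloping k (A ⊗[k] L)) (v : D.KacModule A M) :
    D.toModel A M (s • v) = D.modelRep A M s (D.toModel A M v) := by
  obtain ⟨t, rfl⟩ := Submodule.Quotient.mk_surjective _ v
  rw [← Submodule.Quotient.mk_smul, toModel_mk, toModel_mk, toModelAux_smul]

/-- The projection of the generalized Kac module onto `M`. -/
def kacProj : D.KacModule A M →ₗ[k] M := TripleAction.proj k _ M ∘ₗ D.toModel A M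

/-- In particular M embeds in V̄(M); this is the half of Poincaré–Birkhoff–Witt for which the model
is built. -/
theorem kacProj_kacMk (m : M) : D.kacProj A M (D.kacMk A M m) = m := by
  rw [kacProj, LinearMap.comp_apply, toModel_kacMk, TripleAction.proj_one]

theorem kacProj_negι_smul (f : A ⊗[k] D.piece (-1)) (v : D.KacModule A M) :
    D.kacProj A M (D.negι A f • v) = 0 := by
  induction f using TensorProduct.induction_on with
  | zero => simp
  | add x y hx hy => rw [map_add, add_smul, map_add, hx, hy, add_zero]
  | tmul a f =>
    rw [kacProj, LinearMap.comp_apply, negι_tmul, toModel_smul, modelRep_ι,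
      D.modelAction_neg A M a f.2, TripleAction.proj_low]

theorem kacProj_even_smul (a : A) (x : (part 0 : Submodule k L)) (v : D.KacModule A M) :
    D.kacProj A M (Enveloping.ι k (A ⊗[k] L) (a ⊗ₜ (x : L)) • v) =
      ⁅(a ⊗ₜ[k] x : A ⊗[k] (part 0 : Submodule k L)), D.kacProj A M v⁆ := by
  rw [kacProj, LinearMap.comp_apply, toModel_smul, modelRep_ι,
      D.modelAction_zero A M a x.2, TripleAction.proj_level, tripleAction_ρ]
  rfl

/-- The projection is the identity on M and kills every vector that begins with a letter, so what
remains of v after removing its M-component consists of nonempty words. -/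
theorem sub_kacMk_kacProj_mem (v : D.KacModule A M) :
    v - D.kacMk A M (D.kacProj A M v) ∈ D.wordSpan A ⊤ 1 (LinearMap.range (D.kacMk A M)) := by
  refine D.kac_induction A M (p := fun v => v - D.kacMk A M (D.kacProj A M v) ∈
    D.wordSpan A ⊤ 1 (LinearMap.range (D.kacMk A M))) (fun m => ?_) (fun v w hv hw => ?_)
    (fun f v _ => ?_) v
  · rw [kacProj_kacMk, sub_self]
    exact Submodule.zero_mem _
  · rw [map_add, map_add, add_sub_add_comm]
    exact Submodule.add_mem _ hv hw
  · rw [kacProj_negι_smul, map_zero, sub_zero]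
    refine D.negι_smul_mem_wordSpan A f (r := 0) ?_
    rw [wordSpan_range_kacMk]; trivial

theorem eq_top_of_kacMk_mem {N : Submodule (Enveloping k (A ⊗[k] L)) (D.KacModule A M)}
    (h : ∀ m, D.kacMk A M m ∈ N) : N = ⊤ := by
  rw [eq_top_iff]
  rintro v -
  exact D.kac_smul_induction A M (p := fun v => v ∈ N) (fun v w hv hw => N.add_mem hv hw)
    (fun s m => N.smul_mem s (h m)) v

/-- A Nakayama argument. Modulo N each m is a combination of nonempty words applied to M, and
substituting this into itself makes the words ever longer. As M is finite dimensional, finitely many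
letters serve all m, so the long words vanish and m lies in N. -/
theorem eq_top_of_map_kacProj [FiniteDimensional k M]
    {N : Submodule (Enveloping k (A ⊗[k] L)) (D.KacModule A M)}
    (h : ∀ m, ∃ n ∈ N, D.kacProj A M n = m) : N = ⊤ := by
  classical
  let Y := LinearMap.range (D.kacMk A M)
  let b := Module.finBasis k M
  choose n hn hnb using fun i => h (b i)
  have hq : ∀ i, ∃ s : Finset (A ⊗[k] D.piece (-1)),
      n i - D.kacMk A M (b i) ∈ D.wordSpan A (Submodule.span k s) 1 Y := fun i => by
    have := D.sub_kacMk_kacProj_mem A M (n i)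
    rw [hnb] at this
    exact D.exists_finset_mem_wordSpan A this
  choose s hs using hq
  -- One finite dimensional space of letters that works for all basis vectors at once.
  let X := Submodule.span k ((Finset.univ.biUnion s : Finset _) : Set (A ⊗[k] D.piece (-1)))
  have hX : FiniteDimensional k X := FiniteDimensional.span_finset k _
  have hsub : ∀ m, ∃ q ∈ D.wordSpan A X 1 Y, D.kacMk A M m - q ∈ N := by
    intro m
    have hm : m ∈ Submodule.span k (Set.range b) := by rw [b.span_eq]; trivial
    induction hm using Submodule.span_induction with
    | mem m hm =>
      obtain ⟨i, rfl⟩ := hm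
      refine ⟨-(n i - D.kacMk A M (b i)), Submodule.neg_mem _
        (D.wordSpan_mono A (Submodule.span_mono ?_) (hs i)), ?_⟩
      · exact_mod_cast Finset.subset_biUnion_of_mem s (Finset.mem_univ i)
      · simpa using hn i
    | zero => exact ⟨0, Submodule.zero_mem _, by simp⟩
    | add x y _ _ hx hy =>
      obtain ⟨q, hq, hqN⟩ := hx
      obtain ⟨r, hr, hrN⟩ := hy
      refine ⟨q + r, Submodule.add_mem _ hq hr, ?_⟩
      rw [map_add, add_sub_add_comm]
      exact N.add_mem hqN hrN
    | smul c x _ hx =>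
      obtain ⟨q, hq, hqN⟩ := hx
      refine ⟨c • q, Submodule.smul_mem _ _ hq, ?_⟩
      rw [map_smul, ← smul_sub]
      exact N.smul_of_tower_mem c hqN
  -- Downward induction on the minimal word length r; i is the distance to dim X + 1, the first
  -- length at which all words vanish.
  have key : ∀ i r, r + i = Module.finrank k X + 1 →
      ∀ v ∈ D.wordSpan A X r Y, v ∈ N := by
    intro i
    induction i with
    | zero =>
      intro r hr v hv
      suffices D.wordSpan A X r Y ≤ ⊥ by
        rw [(Submodule.mem_bot k).mp (this hv)]
        exact N.zero_mem
      refine Submodule.span_le.mpr ?_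
      rintro _ ⟨l, hl, hlen, y, -, rfl⟩
      rw [D.word_eq_zero A X l hl (by omega), zero_smul]
      exact Submodule.zero_mem _
    | succ i ih =>
      intro r hr v hv
      refine (Submodule.span_le (p := N.restrictScalars k)).mpr ?_ hv
      rintro _ ⟨l, hl, hlen, _, ⟨m, rfl⟩, rfl⟩
      obtain ⟨q, hq, hqN⟩ := hsub m
      have h1 := N.smul_mem (D.word A l) hqN
      have h2 := ih (r + 1) (by omega) _ (D.word_smul_mem_wordSpan A hl hlen hq)
      have h3 := N.add_mem h1 h2
      rwa [← smul_add, sub_add_cancel] at h3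
  exact D.eq_top_of_kacMk_mem A M fun m =>
    key (Module.finrank k X + 1) 0 (by omega) _ (D.le_wordSpan A ⟨m, rfl⟩)

/-- The largest submodule contained in the kernel of the projection onto `M`. -/
def kacRadical : Submodule (Enveloping k (A ⊗[k] L)) (D.KacModule A M) where
  carrier := {v | ∀ s : Enveloping k (A ⊗[k] L), D.kacProj A M (s • v) = 0}
  add_mem' {v w} hv hw s := by rw [smul_add, map_add, hv s, hw s, add_zero]
  zero_mem' s := by rw [smul_zero, map_zero]
  smul_mem' t v hv s := by rw [smul_smul]; exact hv _

theorem kacProj_eq_zero_of_mem {v : D.KacModule A M} (hv : v ∈ D.kacRadical A M) :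
    D.kacProj A M v = 0 := by
  simpa using hv 1

variable [LieModule.IsIrreducible k (A ⊗[k] (part 0 : Submodule k L)) M]

/-- The image in `M` of a submodule of the generalized Kac module. -/
def projSubmodule (N : Submodule (Enveloping k (A ⊗[k] L)) (D.KacModule A M)) :
    LieSubmodule k (A ⊗[k] (part 0 : Submodule k L)) M where
  toSubmodule := (N.restrictScalars k).map (D.kacProj A M)
  lie_mem {x m} hm := by
    obtain ⟨v, hv, rfl⟩ := hm
    induction x using TensorProduct.induction_on with
    | zero => rw [zero_lie]; exact Submodule.zero_mem _
    | add x y hx hy => rw [add_lie]; exact Submodule.add_mem _ hx hy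
    | tmul a x =>
      rw [← kacProj_even_smul]
      exact ⟨_, N.smul_mem _ hv, rfl⟩

/-- A proper N does not project onto M, hence projects to 0 by irreducibility; so do all multiples s
v of its elements, which puts N in the radical. The radical is itself proper because it misses the
nonzero vectors of M. -/
theorem maxSubmodule_eq_kacRadical [FiniteDimensional k M] :
    D.maxSubmodule A M = D.kacRadical A M := by
  apply le_antisymm
  · refine sSup_le fun N hN v hv s => ?_
    rcases eq_bot_or_eq_top (D.projSubmodule A M N) with h | h
    · have h1 : D.kacProj A M (s • v) ∈ D.projSubmodule A M N := ⟨_, N.smul_mem s hv, rfl⟩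
      rw [h] at h1
      simpa using h1
    · refine absurd (D.eq_top_of_map_kacProj A M fun m => ?_) hN
      have h1 : m ∈ D.projSubmodule A M N := by rw [h]; trivial
      exact h1
  · refine le_sSup fun h => ?_
    have : Nontrivial M := LieModule.nontrivial_of_isIrreducible k
      (A ⊗[k] (part 0 : Submodule k L)) M
    obtain ⟨m, hm⟩ := exists_ne (0 : M)
    have h1 : D.kacMk A M m ∈ D.kacRadical A M := by rw [h]; trivial
    have h2 := D.kacProj_eq_zero_of_mem A M h1
    rw [kacProj_kacMk] at h2
    exact hm h2

theorem maxSubmodule_ne_top [FiniteDimensional k M] : D.maxSubmodule A M ≠ ⊤ := by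
  rw [maxSubmodule_eq_kacRadical]
  intro h
  have : Nontrivial M := LieModule.nontrivial_of_isIrreducible k
    (A ⊗[k] (part 0 : Submodule k L)) M
  obtain ⟨m, hm⟩ := exists_ne (0 : M)
  have h1 : D.kacMk A M m ∈ D.kacRadical A M := by rw [h]; trivial
  have h2 := D.kacProj_eq_zero_of_mem A M h1
  rw [kacProj_kacMk] at h2
  exact hm h2

theorem isCoatom_maxSubmodule [FiniteDimensional k M] : IsCoatom (D.maxSubmodule A M) := by
  refine ⟨D.maxSubmodule_ne_top A M, fun N hN => ?_⟩
  by_contra h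
  exact hN.not_ge (le_sSup h)

end KacModule

end DistinguishedGrading

end LieSuperalgebra

namespace LieSuperalgebra

namespace DistinguishedGrading

/-! ### Finite dimensionality and ideals of finite codimension. -/

section Finiteness

variable {k L : Type*} [Field k] [AddCommGroup L] [Module k L] [LieSuperalgebra k L]
  (D : DistinguishedGrading k L) (A : Type*) [CommRing A] [Algebra k A]
  {V : Type*} [AddCommGroup V] [Module k V] [Module (Enveloping k (A ⊗[k] L)) V]
  [IsScalarTower k (Enveloping k (A ⊗[k] L)) V]

/-- Words of a fixed length sweep out an iterated bilinear image of X and Y, which is finite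
dimensional, and only lengths up to dim X contribute. -/
theorem finiteDimensional_wordSpan [CharZero k] (X : Submodule k (A ⊗[k] D.piece (-1)))
    [FiniteDimensional k X] (Y : Submodule k V) [FiniteDimensional k Y] :
    FiniteDimensional k (D.wordSpan A X 0 Y) := by
  let act : A ⊗[k] D.piece (-1) →ₗ[k] V →ₗ[k] V :=
    (Algebra.lsmul k k V).toLinearMap ∘ₗ D.negι A
  let T : ℕ → Submodule k V := fun n => Nat.rec Y (fun _ T => Submodule.map₂ act X T) n
  have hT : ∀ n, (T n).FG := by
    intro n
    induction n with
    | zero => exact (Submodule.fg_iff_finiteDimensional Y).mpr inferInstance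
    | succ n ih => exact Submodule.FG.map₂ _ (Submodule.fg_iff_finiteDimensional _ |>.mpr ‹_›) ih
  have hle : D.wordSpan A X 0 Y ≤ ⨆ n ∈ Finset.range (Module.finrank k X + 1), T n := by
    refine Submodule.span_le.mpr ?_
    rintro _ ⟨l, hl, -, y, hy, rfl⟩
    by_cases hlen : Module.finrank k X < l.length
    · rw [D.word_eq_zero A X l hl hlen, zero_smul]
      exact Submodule.zero_mem _
    have hmem : D.word A l • y ∈ T l.length := by
      clear hlen
      induction l with
      | nil => simpa using! hy
      | cons f l ih =>
        rw [word_cons, mul_smul]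
        exact Submodule.apply_mem_map₂ act (hl f (by simp)) (ih fun g hg => hl g (by simp [hg]))
    exact Submodule.mem_iSup_of_mem l.length
      (Submodule.mem_iSup_of_mem (Finset.mem_range.mpr (by omega)) hmem)
  have hfg : (⨆ n ∈ Finset.range (Module.finrank k X + 1), T n).FG :=
    Submodule.fg_biSup _ _ fun n _ => hT n
  have := (Submodule.fg_iff_finiteDimensional _).mp hfg
  exact Submodule.finiteDimensional_of_le hle

/-- Since I acts by zero, the coefficients of letters may be taken in a finite dimensional
complement C of I, so words over the image of C ⊗ L₋₁ already span V. -/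
theorem finiteDimensional_of_annihilates [CharZero k] [FiniteDimensional k L] {I : Ideal A}
    [FiniteDimensional k (A ⧸ I)]
    (hI : ∀ a ∈ I, ∀ (x : L) (v : V), Enveloping.ι k (A ⊗[k] L) (a ⊗ₜ x) • v = 0)
    (Y : Submodule k V) [FiniteDimensional k Y] (hY : D.wordSpan A ⊤ 0 Y = ⊤) :
    FiniteDimensional k V := by
  obtain ⟨C, hC⟩ := exists_isCompl (I.restrictScalars k)
  have hCfin : FiniteDimensional k C := by
    have e := Submodule.quotientEquivOfIsCompl _ _ hC
    have : FiniteDimensional k (A ⧸ I.restrictScalars k) :=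
      inferInstanceAs (FiniteDimensional k (A ⧸ I))
    exact e.finiteDimensional
  let X : Submodule k (A ⊗[k] D.piece (-1)) :=
    LinearMap.range (TensorProduct.map C.subtype (LinearMap.id : D.piece (-1) →ₗ[k] _))
  have hX : ∀ f : A ⊗[k] D.piece (-1), ∃ f' ∈ X, ∀ v : V, D.negι A f • v = D.negι A f' • v := by
    intro f
    induction f using TensorProduct.induction_on with
    | zero => exact ⟨0, Submodule.zero_mem _, fun _ => rfl⟩
    | add f g hf hg =>
      obtain ⟨f', hf', hf⟩ := hf
      obtain ⟨g', hg', hg⟩ := hg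
      exact ⟨f' + g', Submodule.add_mem _ hf' hg', fun v => by
        rw [map_add, map_add, add_smul, add_smul, hf, hg]⟩
    | tmul a f =>
      have ha : a ∈ I.restrictScalars k ⊔ C := by rw [hC.sup_eq_top]; trivial
      obtain ⟨b, hb, c, hc, rfl⟩ := Submodule.mem_sup.mp ha
      refine ⟨c ⊗ₜ f, ⟨(⟨c, hc⟩ : C) ⊗ₜ f, rfl⟩, fun v => ?_⟩
      rw [TensorProduct.add_tmul, map_add, add_smul, negι_tmul, hI b hb, zero_add]
  have hword : ∀ (l : List (A ⊗[k] D.piece (-1))), ∃ l' : List (A ⊗[k] D.piece (-1)),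
      (∀ f ∈ l', f ∈ X) ∧ ∀ v : V, D.word A l • v = D.word A l' • v := by
    intro l
    induction l with
    | nil => exact ⟨[], by simp, fun _ => rfl⟩
    | cons f l ih =>
      obtain ⟨l', hl', h⟩ := ih
      obtain ⟨f', hf', hf⟩ := hX f
      refine ⟨f' :: l', by simpa using ⟨hf', hl'⟩, fun v => ?_⟩
      rw [word_cons, word_cons, mul_smul, mul_smul, h, hf]
  have hle : D.wordSpan A ⊤ 0 Y ≤ D.wordSpan A X 0 Y := by
    refine Submodule.span_le.mpr ?_
    rintro _ ⟨l, -, -, y, hy, rfl⟩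
    obtain ⟨l', hl', h⟩ := hword l
    exact Submodule.subset_span ⟨l', hl', Nat.zero_le _, y, hy, h y⟩
  have hfin := D.finiteDimensional_wordSpan A X Y
  rw [hY, top_le_iff] at hle
  rw [hle] at hfin
  exact Module.Finite.of_surjective (⊤ : Submodule k V).subtype fun v => ⟨⟨v, trivial⟩, rfl⟩

/-- The c in A for which c ⊗ L acts by zero form a subspace of finite codimension, a priori not an
ideal. A multiple bc still kills brackets, because (bc) ⊗ [x, y] is the supercommutator of b ⊗ x and
c ⊗ y. -/
theorem exists_ideal_of_finiteDimensional [FiniteDimensional k L] [FiniteDimensional k V]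
    (hL : (part 0 : Submodule k L) ≤
      Submodule.span k {z | ∃ x y : L, z = bracket (k := k) x y}) :
    ∃ I : Ideal A, FiniteDimensional k (A ⧸ I) ∧
      ∀ a ∈ I, ∀ x ∈ (part 0 : Submodule k L), ∀ v : V,
        Enveloping.ι k (A ⊗[k] L) (a ⊗ₜ x) • v = 0 := by
  let φ : A →ₗ[k] L →ₗ[k] Module.End k V :=
    TensorProduct.curry ((Algebra.lsmul k k V).toLinearMap ∘ₗ Enveloping.ι k (A ⊗[k] L))
  have hφ : ∀ c ∈ LinearMap.ker φ, ∀ (x : L) (v : V),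
      Enveloping.ι k (A ⊗[k] L) (c ⊗ₜ x) • v = 0 := fun c hc x v =>
    congr($(LinearMap.mem_ker.mp hc) x v)
  have hbr : ∀ c ∈ LinearMap.ker φ, ∀ (b : A) (x y : L) (v : V),
      Enveloping.ι k (A ⊗[k] L) ((b * c) ⊗ₜ bracket (k := k) x y) • v = 0 := by
    intro c hc b x y v
    have hom : ∀ {i j : ZMod 2} {x y : L}, x ∈ (part i : Submodule k L) →
        y ∈ (part j : Submodule k L) →
        Enveloping.ι k (A ⊗[k] L) ((b * c) ⊗ₜ bracket (k := k) x y) • v = 0 := by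
      intro i j x y hx hy
      have h := congr($(ι_tmul_mul A b c hx hy) • v)
      rw [add_smul, smul_assoc, mul_smul, mul_smul, hφ c hc, hφ c hc, smul_zero, smul_zero,
        zero_add] at h
      exact h.symm
    have dec : ∀ x : L, ∃ x₀ ∈ (part 0 : Submodule k L), ∃ x₁ ∈ (part 1 : Submodule k L),
        x₀ + x₁ = x := fun x => by
      have hx : x ∈ (part 0 : Submodule k L) ⊔ part 1 := by
        rw [(isCompl (k := k) (L := L)).sup_eq_top]; trivial
      exact Submodule.mem_sup.mp hx
    obtain ⟨x₀, hx₀, x₁, hx₁, rfl⟩ := dec x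
    obtain ⟨y₀, hy₀, y₁, hy₁, rfl⟩ := dec y
    simp only [map_add, LinearMap.add_apply, TensorProduct.tmul_add, add_smul]
    rw [hom hx₀ hy₀, hom hx₀ hy₁, hom hx₁ hy₀, hom hx₁ hy₁]
    simp
  refine ⟨Ideal.span (LinearMap.ker φ : Set A), ?_, ?_⟩
  · have hle : LinearMap.ker φ ≤ (Ideal.span (LinearMap.ker φ : Set A)).restrictScalars k :=
      fun a ha => Ideal.subset_span ha
    have h1 : FiniteDimensional k (A ⧸ LinearMap.ker φ) :=
      Module.Finite.equiv φ.quotKerEquivRange.symm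
    have h2 : FiniteDimensional k (A ⧸ (Ideal.span (LinearMap.ker φ : Set A)).restrictScalars k) :=
      Module.Finite.of_surjective (Submodule.factor hle) (Submodule.factor_surjective hle)
    exact h2
  · intro a ha x hx v
    -- The factor b makes the statement stable under multiplication by A, as induction over the
    -- generated ideal requires.
    suffices h : ∀ b : A, Enveloping.ι k (A ⊗[k] L) ((b * a) ⊗ₜ x) • v = 0 by simpa using h 1
    induction ha using Submodule.span_induction with
    | zero => simp
    | add a a' _ _ ha ha' =>
      intro b
      rw [mul_add, TensorProduct.add_tmul, map_add, add_smul, ha, ha', add_zero]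
    | smul b' a _ ha =>
      intro b
      rw [smul_eq_mul, ← mul_assoc]
      exact ha _
    | mem c hc =>
      intro b
      have hx' := hL hx
      clear hx
      induction hx' using Submodule.span_induction with
      | zero => simp
      | add x y _ _ hx hy => rw [TensorProduct.tmul_add, map_add, add_smul, hx, hy, add_zero]
      | smul t x _ hx => rw [TensorProduct.tmul_smul, map_smul, smul_assoc, hx, smul_zero]
      | mem z hz =>
        obtain ⟨x, y, rfl⟩ := hz
        exact hbr c hc b x y v

end Finiteness

/-! ### Annihilators of M and of V(M). -/

section Annihilator

variable {k L : Type*} [Field k] [CharZero k] [AddCommGroup L] [Module k L] [LieSuperalgebra k L]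
  (D : DistinguishedGrading k L) (A : Type*) [CommRing A] [Algebra k A]
  (M : Type*) [AddCommGroup M] [Module k M] [LieRingModule (A ⊗[k] (part 0 : Submodule k L)) M]
  [LieModule k (A ⊗[k] (part 0 : Submodule k L)) M]

/-- The vectors (a ⊗ f) m with a ∈ I span a space stable under A ⊗ (L₀ ⊕ L₁): applying b ⊗ e leaves
only (ba ⊗ [e, f]) m, which is 0 since I is an ideal killing M. The submodule they generate is
spanned by words on them, each beginning with a letter, and so projects to 0. -/
theorem kacProj_smul_negι_kacMk {I : Ideal A}
    (hI : ∀ a ∈ I, ∀ (x : (part 0 : Submodule k L)) (m : M),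
      ⁅(a ⊗ₜ[k] x : A ⊗[k] (part 0 : Submodule k L)), m⁆ = 0)
    {a : A} (ha : a ∈ I) (f : D.piece (-1)) (m : M) :
    D.negι A (a ⊗ₜ f) • D.kacMk A M m ∈ D.kacRadical A M := by
  let Y : Submodule k (D.KacModule A M) := Submodule.span k
    {v | ∃ a ∈ I, ∃ (f : D.piece (-1)) (m : M), v = D.negι A (a ⊗ₜ f) • D.kacMk A M m}
  have heven : ∀ (b : A) (x : L), x ∈ (part 0 : Submodule k L) → ∀ y ∈ Y,
      Enveloping.ι k (A ⊗[k] L) (b ⊗ₜ x) • y ∈ Y := by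
    intro b x hx y hy
    induction hy using Submodule.span_induction with
    | zero => rw [smul_zero]; exact Submodule.zero_mem _
    | add x y _ _ hx hy => rw [smul_add]; exact Submodule.add_mem _ hx hy
    | smul c x _ hx => rw [smul_algebra_smul_comm]; exact Submodule.smul_mem _ _ hx
    | mem v hv =>
      obtain ⟨a, ha, f, m, rfl⟩ := hv
      rw [← mul_smul, D.even_mul_negι A b a hx, add_smul, mul_smul,
        D.ι_even_smul_kacMk A M b ⟨x, hx⟩]
      exact Submodule.add_mem _ (Submodule.subset_span ⟨a, ha, f, _, rfl⟩)
        (Submodule.subset_span ⟨b * a, I.mul_mem_left b ha, _, m, rfl⟩)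
  have hpos : ∀ (b : A) (e : L), e ∈ D.piece 1 → ∀ y ∈ Y,
      Enveloping.ι k (A ⊗[k] L) (b ⊗ₜ e) • y ∈ Y := by
    intro b e he y hy
    induction hy using Submodule.span_induction with
    | zero => rw [smul_zero]; exact Submodule.zero_mem _
    | add x y _ _ hx hy => rw [smul_add]; exact Submodule.add_mem _ hx hy
    | smul c x _ hx => rw [smul_algebra_smul_comm]; exact Submodule.smul_mem _ _ hx
    | mem v hv =>
      obtain ⟨a, ha, f, m, rfl⟩ := hv
      rw [← mul_smul, D.pos_mul_negι A b a he, add_smul, neg_smul, mul_smul,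
        D.ι_pos_smul_kacMk A M b he,
        D.ι_even_smul_kacMk A M (b * a) ⟨_, D.bracket_pos_neg_mem he f.2⟩,
        hI _ (I.mul_mem_left b ha), smul_zero, map_zero, neg_zero, add_zero]
      exact Submodule.zero_mem _
  have hproj : ∀ v ∈ D.wordSpan A ⊤ 0 Y, D.kacProj A M v = 0 := by
    intro v hv
    induction hv using Submodule.span_induction with
    | zero => rw [map_zero]
    | add x y _ _ hx hy => rw [map_add, hx, hy, add_zero]
    | smul c x _ hx => rw [map_smul, hx, smul_zero]
    | mem v hv =>
      obtain ⟨l, -, -, y, hy, rfl⟩ := hv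
      cases l with
      | cons f l => rw [word_cons, mul_smul, kacProj_negι_smul]
      | nil =>
        rw [word_nil, one_smul]
        induction hy using Submodule.span_induction with
        | zero => rw [map_zero]
        | add x y _ _ hx hy => rw [map_add, hx, hy, add_zero]
        | smul c x _ hx => rw [map_smul, hx, smul_zero]
        | mem v hv =>
          obtain ⟨a, ha, f, m, rfl⟩ := hv
          rw [kacProj_negι_smul]
  intro s
  exact hproj _ (D.smul_mem_wordSpan A heven hpos s
    (D.le_wordSpan A (Submodule.subset_span ⟨a, ha, f, m, rfl⟩)))

/-- Induction on the letters of v: moving a ⊗ x past b ⊗ f leaves a bracket whose coefficient ab is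
again in I. The inductive statement therefore ranges over all a ∈ I and all x. -/
theorem smul_mem_kacRadical {I : Ideal A}
    (hI : ∀ a ∈ I, ∀ (x : (part 0 : Submodule k L)) (m : M),
      ⁅(a ⊗ₜ[k] x : A ⊗[k] (part 0 : Submodule k L)), m⁆ = 0)
    (v : D.KacModule A M) {a : A} (ha : a ∈ I) (x : L) :
    Enveloping.ι k (A ⊗[k] L) (a ⊗ₜ x) • v ∈ D.kacRadical A M := by
  refine D.kac_induction A M (p := fun v => ∀ a ∈ I, ∀ x : L,
    Enveloping.ι k (A ⊗[k] L) (a ⊗ₜ x) • v ∈ D.kacRadical A M) (fun m a ha x => ?_)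
    (fun v w hv hw a ha x => ?_) (fun f v hv a ha x => ?_) v a ha x
  · refine D.piece_induction (p := fun x => Enveloping.ι k (A ⊗[k] L) (a ⊗ₜ x) • D.kacMk A M m ∈
      D.kacRadical A M) (fun x y hx hy => ?_) (fun f hf => ?_) (fun x hx => ?_) (fun e he => ?_) x
    · rw [TensorProduct.tmul_add, map_add, add_smul]
      exact Submodule.add_mem _ hx hy
    · exact D.kacProj_smul_negι_kacMk A M hI ha ⟨f, hf⟩ m
    · rw [D.ι_even_smul_kacMk A M a ⟨x, hx⟩, hI a ha, map_zero]
      exact Submodule.zero_mem _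
    · rw [D.ι_pos_smul_kacMk A M a he]
      exact Submodule.zero_mem _
  · rw [smul_add]
    exact Submodule.add_mem _ (hv a ha x) (hw a ha x)
  · induction f using TensorProduct.induction_on with
    | zero =>
      rw [map_zero, zero_smul, smul_zero]
      exact Submodule.zero_mem _
    | add f g hf hg =>
      rw [map_add, add_smul, smul_add]
      exact Submodule.add_mem _ hf hg
    | tmul b f =>
      refine D.piece_induction (p := fun x => Enveloping.ι k (A ⊗[k] L) (a ⊗ₜ x) •
        D.negι A (b ⊗ₜ f) • v ∈ D.kacRadical A M)
        (fun x y hx hy => ?_) (fun f' hf' => ?_) (fun x hx => ?_) (fun e he => ?_) x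
      · rw [TensorProduct.tmul_add, map_add, add_smul]
        exact Submodule.add_mem _ hx hy
      · have h := D.negι_mul_negι A (a ⊗ₜ ⟨f', hf'⟩) (b ⊗ₜ f)
        rw [D.negι_tmul A a] at h
        rw [← mul_smul, h, neg_smul, mul_smul]
        exact Submodule.neg_mem _ (Submodule.smul_mem _ _ (hv a ha f'))
      · rw [← mul_smul, D.even_mul_negι A a b hx, add_smul, mul_smul]
        exact Submodule.add_mem _ (Submodule.smul_mem _ _ (hv a ha x))
          (hv _ (I.mul_mem_right b ha) _)
      · rw [← mul_smul, D.pos_mul_negι A a b he, add_smul, neg_smul, mul_smul]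
        exact Submodule.add_mem _ (Submodule.neg_mem _ (Submodule.smul_mem _ _ (hv a ha e)))
          (hv _ (I.mul_mem_right b ha) _)

variable [LieModule.IsIrreducible k (A ⊗[k] (part 0 : Submodule k L)) M] [FiniteDimensional k M]

theorem smul_mk_eq_zero_iff (s : Enveloping k (A ⊗[k] L)) (v : D.KacModule A M) :
    s • (Submodule.Quotient.mk v : D.KacQuotient A M) = 0 ↔ s • v ∈ D.kacRadical A M := by
  rw [← Submodule.Quotient.mk_smul, Submodule.Quotient.mk_eq_zero, maxSubmodule_eq_kacRadical]

theorem annihilates_kacQuotient {I : Ideal A}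
    (hI : ∀ a ∈ I, ∀ (x : (part 0 : Submodule k L)) (m : M),
      ⁅(a ⊗ₜ[k] x : A ⊗[k] (part 0 : Submodule k L)), m⁆ = 0) :
    ∀ a ∈ I, ∀ (x : L) (v : D.KacQuotient A M),
      Enveloping.ι k (A ⊗[k] L) (a ⊗ₜ x) • v = 0 := by
  intro a ha x v
  obtain ⟨v, rfl⟩ := Submodule.Quotient.mk_surjective _ v
  rw [smul_mk_eq_zero_iff]
  exact D.smul_mem_kacRadical A M hI v ha x

/-- The projection commutes with A ⊗ L₀ and kills N(M), so vanishing on V(M) can be read off in M.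
-/
theorem lie_eq_zero_of_annihilates {a : A} {x : (part 0 : Submodule k L)}
    (h : ∀ v : D.KacQuotient A M, Enveloping.ι k (A ⊗[k] L) (a ⊗ₜ (x : L)) • v = 0) (m : M) :
    ⁅(a ⊗ₜ[k] x : A ⊗[k] (part 0 : Submodule k L)), m⁆ = 0 := by
  have h1 := h (Submodule.Quotient.mk (D.kacMk A M m))
  rw [smul_mk_eq_zero_iff] at h1
  have h2 := D.kacProj_eq_zero_of_mem A M h1
  rwa [kacProj_even_smul, kacProj_kacMk] at h2

/-- The two suprema range over the same set of ideals, so it does not matter here whether they are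
attained. -/
theorem annMapModule_eq_annKacQuotient :
    annMapModule k A (part 0 : Submodule k L) M = D.annKacQuotient A M := by
  unfold annMapModule annKacQuotient
  congr 1
  ext I
  exact ⟨fun h => D.annihilates_kacQuotient A M h,
    fun h a ha x m => D.lie_eq_zero_of_annihilates A M (h a ha x) m⟩

theorem finiteDimensional_kacQuotient [FiniteDimensional k L] {I : Ideal A}
    [FiniteDimensional k (A ⧸ I)]
    (hI : ∀ a ∈ I, ∀ (x : (part 0 : Submodule k L)) (m : M),
      ⁅(a ⊗ₜ[k] x : A ⊗[k] (part 0 : Submodule k L)), m⁆ = 0) :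
    FiniteDimensional k (D.KacQuotient A M) := by
  let q : D.KacModule A M →ₗ[k] D.KacQuotient A M := (D.maxSubmodule A M).mkQ.restrictScalars k
  let Y : Submodule k (D.KacQuotient A M) := LinearMap.range (q ∘ₗ D.kacMk A M)
  refine D.finiteDimensional_of_annihilates A (D.annihilates_kacQuotient A M hI) Y ?_
  rw [eq_top_iff]
  rintro v -
  obtain ⟨v, rfl⟩ := Submodule.Quotient.mk_surjective _ v
  refine D.kac_induction A M (p := fun v => q v ∈ D.wordSpan A ⊤ 0 Y) (fun m => ?_)
    (fun v w hv hw => ?_) (fun f v hv => ?_) v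
  · exact D.le_wordSpan A ⟨m, rfl⟩
  · rw [map_add]
    exact Submodule.add_mem _ hv hw
  · exact D.wordSpan_anti A (Nat.zero_le _) (D.negι_smul_mem_wordSpan A f hv)

/-- The right-hand side speaks of M alone; it is also the criterion for generalized evaluation
modules, which is where the two conditions meet. -/
theorem finiteDimensional_kacQuotient_iff [FiniteDimensional k L]
    (hL : (part 0 : Submodule k L) ≤
      Submodule.span k {z | ∃ x y : L, z = bracket (k := k) x y}) :
    FiniteDimensional k (D.KacQuotient A M) ↔ ∃ I : Ideal A, FiniteDimensional k (A ⧸ I) ∧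
      ∀ a ∈ I, ∀ (x : (part 0 : Submodule k L)) (m : M),
        ⁅(a ⊗ₜ[k] x : A ⊗[k] (part 0 : Submodule k L)), m⁆ = 0 := by
  constructor
  · intro h
    obtain ⟨I, hfin, hI⟩ := exists_ideal_of_finiteDimensional A (V := D.KacQuotient A M) hL
    exact ⟨I, hfin, fun a ha x m =>
      D.lie_eq_zero_of_annihilates A M (hI a ha x x.2) m⟩
  · rintro ⟨I, hfin, hI⟩
    exact D.finiteDimensional_kacQuotient A M hI

end Annihilator

end DistinguishedGrading

end LieSuperalgebra

/-! ### Irreducible modules over commuting algebras -/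

section Density

variable {k R V M : Type*} [Field k] [Ring R] [Algebra k R]
  [AddCommGroup V] [Module k V] [Module R V] [IsScalarTower k R V]
  [AddCommGroup M] [Module k M] [Module R M] [IsScalarTower k R M]

/-- By Schur's lemma the R-endomorphisms of V are scalars, so every k-linear T commutes with them
and Jacobson density applies. -/
theorem exists_smul_eq_of_isSimpleModule [IsAlgClosed k] [IsSimpleModule R V]
    [FiniteDimensional k V] (T : Module.End k V) (s : Finset V) : ∃ r : R, ∀ v ∈ s, T v = r • v := by
  let f : Module.End (Module.End R V) V :=
    { toFun := T
      map_add' := map_add T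
      map_smul' := fun g v => by
        obtain ⟨c, rfl⟩ := (IsSimpleModule.algebraMap_end_bijective_of_isAlgClosed (A := R) (V := V)
          k).2 g
        simp }
  exact jacobson_density f s

/-- The evaluation map on `V ⊗ Hom_R(V, M)`. -/
def homEval (k R V M : Type*) [Field k] [Ring R] [Algebra k R]
    [AddCommGroup V] [Module k V] [Module R V] [IsScalarTower k R V]
    [AddCommGroup M] [Module k M] [Module R M] [IsScalarTower k R M] :
    V ⊗[k] (V →ₗ[R] M) →ₗ[k] M :=
  TensorProduct.lift (LinearMap.restrictScalarsₗ k R V M k).flip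

@[simp] theorem homEval_tmul (v : V) (φ : V →ₗ[R] M) : homEval k R V M (v ⊗ₜ φ) = φ v := rfl

/-- Density provides r acting on V as the rank one map that sends the i-th basis vector to v and the
others to 0. Applied to a relation ∑ φⱼ(bⱼ) = 0, it leaves φᵢ(v) = 0. -/
theorem homEval_injective [IsAlgClosed k] [IsSimpleModule R V] [FiniteDimensional k V] :
    Function.Injective (homEval k R V M) := by
  classical
  rw [injective_iff_map_eq_zero]
  intro t ht
  let b := Module.finBasis k V
  have hsum : t = ∑ i, b i ⊗ₜ TensorProduct.equivFinsuppOfBasisLeft b t i := by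
    conv_lhs => rw [← (TensorProduct.equivFinsuppOfBasisLeft b).symm_apply_apply t,
      TensorProduct.equivFinsuppOfBasisLeft_symm_apply, Finsupp.sum_fintype _ _ (by simp)]
  set φ := TensorProduct.equivFinsuppOfBasisLeft b t
  suffices h : φ = 0 by simpa [h] using hsum
  ext i v
  obtain ⟨r, hr⟩ := exists_smul_eq_of_isSimpleModule (R := R) ((b.coord i).smulRight v)
    (Finset.univ.image b)
  have hr' : ∀ j, r • b j = if j = i then v else 0 := fun j => by
    rw [← hr (b j) (Finset.mem_image_of_mem b (Finset.mem_univ j))]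
    simp [Finsupp.single_apply]
  rw [hsum, map_sum] at ht
  have h0 := congr(r • $ht)
  rw [smul_zero, Finset.smul_sum] at h0
  simp only [homEval_tmul, ← map_smul, hr'] at h0
  rw [Finset.sum_eq_single i (fun j _ hj => by simp [hj]) (by simp)] at h0
  simpa using h0

/-- Set against the lower bound from `homEval_injective`, this turns irreducibility of Hom(V, M)
into a dimension count. -/
theorem finrank_le_mul_of_span_eq_top [FiniteDimensional k V] (W : Submodule k (V →ₗ[R] M))
    [FiniteDimensional k W] (h : Submodule.span k {m | ∃ φ ∈ W, ∃ v, m = φ v} = ⊤) :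
    Module.finrank k M ≤ Module.finrank k V * Module.finrank k W := by
  let e : V ⊗[k] W →ₗ[k] M := homEval k R V M ∘ₗ LinearMap.lTensor V W.subtype
  rw [← Module.finrank_tensorProduct]
  refine LinearMap.finrank_le_finrank_of_surjective (f := e) ?_
  rw [← LinearMap.range_eq_top, eq_top_iff, ← h]
  refine Submodule.span_le.mpr ?_
  rintro _ ⟨φ, hφ, v, rfl⟩
  exact ⟨v ⊗ₜ ⟨φ, hφ⟩, rfl⟩

theorem finiteDimensional_hom [FiniteDimensional k V] [FiniteDimensional k M] :
    FiniteDimensional k (V →ₗ[R] M) :=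
  Module.Finite.of_injective (LinearMap.restrictScalarsₗ k R V M k)
    (LinearMap.restrictScalars_injective _)

/-- An endomorphism commuting with the action of `R`, acting on `Hom_R(V, M)`. -/
def homPostcomp (k : Type*) {R R' V M : Type*} [Field k] [Ring R] [Algebra k R]
    [Ring R'] [Algebra k R']
    [AddCommGroup V] [Module k V] [Module R V] [IsScalarTower k R V]
    [AddCommGroup M] [Module k M] [Module R M] [IsScalarTower k R M]
    (ρ : R' →ₐ[k] Module.End k M) (h : ∀ (x : R') (r : R) (m : M), ρ x (r • m) = r • ρ x m) :
    R' →ₐ[k] Module.End k (V →ₗ[R] M) :=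
  AlgHom.ofLinearMap
    (LinearMap.mk₂ k (fun x φ => ({ ρ x with map_smul' := h x } : M →ₗ[R] M) ∘ₗ φ)
      (fun x y φ => by ext v; simp) (fun c x φ => by ext v; simp)
      (fun x φ ψ => by ext v; simp) (fun c x φ => by ext v; simp))
    (by ext φ v; simp) (fun x y => by ext φ v; simp)


end Density

/-- Splits off one algebra at a time: for a simple R₀-submodule V of M, evaluation V ⊗ Hom(V, M) → M
is bijective, and the remaining algebras act irreducibly on Hom(V, M). An equivariant multilinear
map with a dimension equality extends by one variable through currying, and it determines the
isomorphism later. Coordinate spaces are used as factors so that these lie in the universe of k. -/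
theorem exists_multilinear_of_irreducible (k : Type u) [Field k] [IsAlgClosed k] :
    ∀ (l : ℕ) (R : Fin l → Type v) [∀ i, Ring (R i)] [∀ i, Algebra k (R i)] (M : Type z)
      [AddCommGroup M] [Module k M] [FiniteDimensional k M] [Nontrivial M]
      (ρ : ∀ i, R i →ₐ[k] Module.End k M)
      (_ : ∀ i j, i ≠ j → ∀ x y, ρ i x * ρ j y = ρ j y * ρ i x)
      (_ : ∀ W : Submodule k M, (∀ i x, ∀ w ∈ W, ρ i x w ∈ W) → W = ⊥ ∨ W = ⊤),
      ∃ (d : Fin l → ℕ) (σ : ∀ i, R i →ₐ[k] Module.End k (Fin (d i) → k))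
        (μ : MultilinearMap k (fun i => Fin (d i) → k) M),
        ∏ i, d i = Module.finrank k M ∧ μ ≠ 0 ∧
        ∀ i x v, μ (Function.update v i (σ i x (v i))) = ρ i x (μ v) := by
  intro l
  induction l with
  | zero =>
    intro R _ _ M _ _ _ _ ρ _ hirr
    obtain ⟨m, hm⟩ := exists_ne (0 : M)
    refine ⟨fun _ => 0, fun i => i.elim0, MultilinearMap.constOfIsEmpty k _ m, ?_, ?_,
      fun i => i.elim0⟩
    -- Without operators every subspace is invariant, so M has dimension 1, the value of the empty
    -- product.
    · have h : Submodule.span k {m} = ⊤ := (hirr _ fun i => i.elim0).resolve_left fun h =>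
        hm ((Submodule.span_singleton_eq_bot).mp h)
      rw [Finset.univ_eq_empty, Finset.prod_empty, ← finrank_top k M, ← h, finrank_span_singleton hm]
    · intro h
      exact hm congr($h 0)
  | succ l ih =>
    intro R _ _ M _ _ _ _ ρ hcomm hirr
    let _ : Module (R 0) M := Module.compHom M (ρ 0).toRingHom
    have hsmul : ∀ (r : R 0) (m : M), r • m = ρ 0 r m := fun _ _ => rfl
    have : IsScalarTower k (R 0) M := ⟨fun c r m => by rw [hsmul, hsmul, map_smul]; rfl⟩
    have : IsArtinian (R 0) M := isArtinian_of_tower k inferInstance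
    obtain ⟨V, hV⟩ := IsAtomic.exists_atom (Submodule (R 0) M)
    have : IsSimpleModule (R 0) V := isSimpleModule_iff_isAtom.mpr hV
    have : FiniteDimensional k V := inferInstanceAs (FiniteDimensional k (V.restrictScalars k))
    have hcomm' : ∀ (j : Fin l) (x : R j.succ) (r : R 0) (m : M),
        ρ j.succ x (r • m) = r • ρ j.succ x m := fun j x r m =>
      congr($(hcomm j.succ 0 (Fin.succ_ne_zero j) x r) m)
    have : FiniteDimensional k (V →ₗ[R 0] M) := finiteDimensional_hom
    have hne : V.subtype ≠ 0 := by
      intro h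
      obtain ⟨v, hv, hv0⟩ := V.exists_mem_ne_zero_of_ne_bot hV.1
      exact hv0 congr($h ⟨v, hv⟩)
    have : Nontrivial (V →ₗ[R 0] M) := ⟨V.subtype, 0, hne⟩
    -- For W stable under the other algebras, the span of the images of its elements is stable under
    -- all the algebras, including R₀ because the φ are R₀-linear.
    have hspan : ∀ W : Submodule k (V →ₗ[R 0] M), (∀ (j : Fin l) (x : R j.succ), ∀ φ ∈ W,
        homPostcomp k (ρ j.succ) (hcomm' j) x φ ∈ W) → W ≠ ⊥ →
        Submodule.span k {m | ∃ φ ∈ W, ∃ v, m = φ v} = ⊤ := by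
      intro W hW hbot
      refine (hirr _ fun i x w hw => ?_).resolve_left fun h => ?_
      · induction hw using Submodule.span_induction with
        | zero => rw [map_zero]; exact Submodule.zero_mem _
        | add a b _ _ ha hb => rw [map_add]; exact Submodule.add_mem _ ha hb
        | smul c a _ ha => rw [map_smul]; exact Submodule.smul_mem _ _ ha
        | mem m hm =>
          obtain ⟨φ, hφ, v, rfl⟩ := hm
          refine Submodule.subset_span ?_
          induction i using Fin.cases with
          | zero => exact ⟨φ, hφ, x • v, by rw [map_smul, hsmul]⟩
          | succ j => exact ⟨_, hW j x φ hφ, v, rfl⟩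
      · obtain ⟨φ, hφ, hφ0⟩ := W.exists_mem_ne_zero_of_ne_bot hbot
        refine hφ0 (LinearMap.ext fun v => ?_)
        have : φ v ∈ Submodule.span k {m | ∃ φ ∈ W, ∃ v, m = φ v} :=
          Submodule.subset_span ⟨φ, hφ, v, rfl⟩
        rw [h] at this
        exact this
    have hle : Module.finrank k V * Module.finrank k (V →ₗ[R 0] M) ≤ Module.finrank k M := by
      rw [← Module.finrank_tensorProduct]
      exact LinearMap.finrank_le_finrank_of_injective (homEval_injective (k := k) (R := R 0))
    have hpos : 0 < Module.finrank k V := by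
      have := IsSimpleModule.nontrivial (R 0) V
      exact Module.finrank_pos
    obtain ⟨d, σ, μ, hd, hμ, hσ⟩ := ih (fun j => R j.succ) (V →ₗ[R 0] M)
      (fun j => homPostcomp k (ρ j.succ) (hcomm' j))
      (fun i j hij x y => by
        ext φ v
        exact congr($(hcomm i.succ j.succ (fun h => hij (Fin.succ_injective _ h)) x y) (φ v)))
      (fun W hW => by
        -- For a nonzero stable W, dim V · dim Hom(V, M) ≤ dim M ≤ dim V · dim W, so W is
        -- everything.
        refine or_iff_not_imp_left.mpr fun hbot => Submodule.eq_top_of_finrank_eq ?_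
        refine le_antisymm (Submodule.finrank_le W) ?_
        exact Nat.le_of_mul_le_mul_left
          (hle.trans (finrank_le_mul_of_span_eq_top W (hspan W hW hbot))) hpos)
    have hdim : Module.finrank k M = Module.finrank k V * Module.finrank k (V →ₗ[R 0] M) := by
      refine le_antisymm ?_ hle
      have h := finrank_le_mul_of_span_eq_top (⊤ : Submodule k (V →ₗ[R 0] M))
        (hspan ⊤ (fun _ _ _ _ => trivial) top_ne_bot)
      rwa [finrank_top] at h
    let ψ : (Fin (Module.finrank k V) → k) ≃ₗ[k] V := (Module.finBasis k V).equivFun.symm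
    let d' : Fin (l + 1) → ℕ := Fin.cons (Module.finrank k V) d
    let σ₀ : R 0 →ₐ[k] Module.End k (Fin (d' 0) → k) :=
      (LinearEquiv.conjAlgEquiv k ψ.symm).toAlgHom.comp (Algebra.lsmul k k V)
    let f₀ : V →ₗ[k] MultilinearMap k (fun i : Fin l => Fin (d i) → k) M :=
      { toFun := fun v => ((LinearMap.restrictScalarsₗ k (R 0) V M k).flip v).compMultilinearMap μ
        map_add' := fun v w => MultilinearMap.ext fun x => map_add (μ x) v w
        map_smul' := fun c v => MultilinearMap.ext fun x =>
          map_smul ((μ x).restrictScalars k) c v }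
    let f : (Fin (d' 0) → k) →ₗ[k] MultilinearMap k (fun i : Fin l => Fin (d' i.succ) → k) M :=
      f₀ ∘ₗ ψ.toLinearMap
    let g : MultilinearMap k (fun i : Fin (l + 1) => Fin (d' i) → k) M :=
      LinearMap.uncurryLeft (M := fun i : Fin (l + 1) => Fin (d' i) → k) f
    have hf : ∀ m : ∀ i, Fin (d' i) → k, g m = μ (Fin.tail m) (ψ (m 0)) := fun _ => rfl
    refine ⟨d', Fin.cases σ₀ σ, g, ?_, ?_, ?_⟩
    · rw [Fin.prod_univ_succ, hdim, ← hd]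
      rfl
    · intro h
      refine hμ (MultilinearMap.ext fun x => LinearMap.ext fun v => ?_)
      let m : ∀ i, Fin (d' i) → k := Fin.cases (ψ.symm v) x
      have h1 := hf m
      rw [h] at h1
      change 0 = μ x (ψ (ψ.symm v)) at h1
      rw [ψ.apply_symm_apply] at h1
      exact h1.symm
    · intro i x v
      induction i using Fin.cases with
      | zero =>
        rw [hf, hf, Fin.tail_update_zero, Function.update_self]
        have h1 : ψ (σ₀ x (v 0)) = x • ψ (v 0) :=
          ψ.apply_symm_apply (x • ψ (v 0))
        change μ (Fin.tail v) (ψ (σ₀ x (v 0))) = _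
        rw [h1, map_smul, hsmul]
      | succ j =>
        rw [hf, hf, Fin.tail_update_succ]
        have h1 := hσ j x (Fin.tail v)
        exact congr($h1 (ψ (v 0)))

/-- The Lie algebras are replaced by the associative algebras they generate in End M, which still
commute with one another. The resulting map from the tensor product to M has nonzero invariant
image, so it is onto, and the dimensions agree. -/
theorem exists_piTensorProduct_equiv {k : Type u} [Field k] [IsAlgClosed k] {l : ℕ}
    (H : Fin l → Type v) [∀ i, LieRing (H i)] [∀ i, LieAlgebra k (H i)] (M : Type z)
    [AddCommGroup M] [Module k M] [FiniteDimensional k M] [Nontrivial M]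
    (ρ : ∀ i, H i →ₗ[k] Module.End k M)
    (hρ : ∀ i x y, ρ i ⁅x, y⁆ = ρ i x * ρ i y - ρ i y * ρ i x)
    (hcomm : ∀ i j, i ≠ j → ∀ x y, ρ i x * ρ j y = ρ j y * ρ i x)
    (hirr : ∀ W : Submodule k M, (∀ i x, ∀ w ∈ W, ρ i x w ∈ W) → W = ⊥ ∨ W = ⊤) :
    ∃ (d : Fin l → ℕ) (σ : ∀ i, H i →ₗ[k] Module.End k (Fin (d i) → k))
      (e : M ≃ₗ[k] ⨂[k] i, (Fin (d i) → k)),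
      (∀ i x y, σ i ⁅x, y⁆ = σ i x * σ i y - σ i y * σ i x) ∧ ∀ i x m, e (ρ i x m) =
        PiTensorProduct.map (Function.update (fun j => (LinearMap.id : (Fin (d j) → k) →ₗ[k] _)) i
          (σ i x)) (e m) := by
  let R : Fin l → Subalgebra k (Module.End k M) := fun i => Algebra.adjoin k (Set.range (ρ i))
  have hmem : ∀ i x, ρ i x ∈ R i := fun i x => Algebra.subset_adjoin ⟨x, rfl⟩
  obtain ⟨d, σ, μ, hd, hμ, hσ⟩ := exists_multilinear_of_irreducible k l (fun i => R i) M
    (fun i => (R i).val)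
    (fun i j hij x y => by
      refine Algebra.commute_of_mem_adjoin_of_forall_mem_commute y.2 ?_
      rintro _ ⟨y', rfl⟩
      refine (Algebra.commute_of_mem_adjoin_of_forall_mem_commute x.2 ?_).symm
      rintro _ ⟨x', rfl⟩
      exact (hcomm i j hij x' y').symm)
    (fun W hW => hirr W fun i x => hW i ⟨ρ i x, hmem i x⟩)
  let τ : ∀ i, H i →ₗ[k] Module.End k (Fin (d i) → k) := fun i =>
    { toFun := fun x => σ i ⟨ρ i x, hmem i x⟩
      map_add' := fun x y => by
        rw [← map_add]
        congr 1
        exact Subtype.ext (map_add (ρ i) x y)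
      map_smul' := fun c x => by
        rw [RingHom.id_apply, ← map_smul]
        congr 1
        exact Subtype.ext (map_smul (ρ i) c x) }
  have hτ_lie : ∀ i x y, τ i ⁅x, y⁆ = τ i x * τ i y - τ i y * τ i x := fun i x y => by
    change σ i _ = σ i _ * σ i _ - σ i _ * σ i _
    rw [← map_mul, ← map_mul, ← map_sub]
    congr 1
    exact Subtype.ext (hρ i x y)
  have hτ : ∀ i x v, μ (Function.update v i (τ i x (v i))) = ρ i x (μ v) := fun i x v =>
    hσ i ⟨ρ i x, hmem i x⟩ v
  let E : (⨂[k] i, (Fin (d i) → k)) →ₗ[k] M := PiTensorProduct.lift μ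
  have hE : ∀ i x t, E (PiTensorProduct.map (Function.update
      (fun j => (LinearMap.id : (Fin (d j) → k) →ₗ[k] _)) i (τ i x)) t) = ρ i x (E t) := by
    intro i x t
    induction t using PiTensorProduct.induction_on with
    | smul_tprod c v =>
      rw [map_smul, map_smul, map_smul, map_smul, PiTensorProduct.map_tprod,
        PiTensorProduct.lift.tprod, PiTensorProduct.lift.tprod, ← hτ]
      congr 2
      funext j
      rcases eq_or_ne j i with rfl | h
      · simp
      · simp [h]
    | add a b ha hb => rw [map_add, map_add, map_add, map_add, ha, hb]
  have hsurj : Function.Surjective E := by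
    rw [← LinearMap.range_eq_top]
    refine (hirr _ ?_).resolve_left fun h => hμ ?_
    · rintro i x _ ⟨t, rfl⟩
      exact ⟨_, hE i x t⟩
    · refine MultilinearMap.ext fun v => ?_
      have h1 : E (PiTensorProduct.tprod k v) ∈ LinearMap.range E := ⟨_, rfl⟩
      rw [h, Submodule.mem_bot, PiTensorProduct.lift.tprod] at h1
      exact h1
  have hrank : Module.finrank k (⨂[k] i, (Fin (d i) → k)) = Module.finrank k M := by
    rw [Module.finrank_eq_card_basis (Basis.piTensorProduct fun i => Pi.basisFun k (Fin (d i))),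
      Fintype.card_pi, ← hd]
    simp
  have hinj : Function.Injective E :=
    (LinearMap.injective_iff_surjective_of_finrank_eq_finrank hrank).mpr hsurj
  let e := (LinearEquiv.ofBijective E ⟨hinj, hsurj⟩).symm
  refine ⟨d, τ, e, hτ_lie, fun i x m => ?_⟩
  apply e.symm.injective
  rw [e.symm_apply_apply]
  have h := hE i x (e m)
  have h2 : E (e m) = m := e.symm_apply_apply m
  rw [h2] at h
  exact h.symm

/-! ### Generalized evaluation modules and ideals of finite codimension -/

section Codimension

variable {k A : Type*} [Field k] [CommRing A] [Algebra k A] [Algebra.FiniteType k A]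

/-- Any prime containing 𝔪ⁿ is 𝔪, so the quotient is Noetherian of dimension zero, hence Artinian,
and an Artinian algebra of finite type is finite dimensional. -/
theorem Ideal.finiteDimensional_quotient_pow (𝔪 : MaximalSpectrum A) (n : ℕ) :
    FiniteDimensional k (A ⧸ 𝔪.asIdeal ^ n) := by
  have : IsNoetherianRing A := Algebra.FiniteType.isNoetherianRing k A
  have h0 : Ring.KrullDimLE 0 (A ⧸ 𝔪.asIdeal ^ n) := by
    rw [Ideal.krullDimLE_zero_quotient_iff_forall_minimalPrimes_isMaximal]
    rintro J ⟨⟨hJ, hle⟩, -⟩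
    rw [← 𝔪.isMaximal.eq_of_le hJ.ne_top (hJ.le_of_pow_le hle)]
    exact 𝔪.isMaximal
  have : IsArtinianRing (A ⧸ 𝔪.asIdeal ^ n) :=
    isArtinianRing_iff_isNoetherianRing_krullDimLE_zero.mpr ⟨inferInstance, h0⟩
  exact Module.finite_of_isArtinianRing k _

theorem Ideal.finiteDimensional_quotient_iInf {k A ι : Type*} [Field k] [CommRing A]
    [Algebra k A] [Finite ι] (J : ι → Ideal A)
    (hJ : ∀ i, FiniteDimensional k (A ⧸ J i)) : FiniteDimensional k (A ⧸ ⨅ i, J i) := by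
  let f : (A ⧸ ⨅ i, J i) →ₗ[k] ∀ i, A ⧸ J i :=
    (Ideal.Quotient.liftₐ (⨅ i, J i) (AlgHom.pi fun i => Ideal.Quotient.mkₐ k (J i))
      fun a ha => funext fun i => Ideal.Quotient.eq_zero_iff_mem.mpr
        (Ideal.mem_iInf.mp ha i)).toLinearMap
  refine FiniteDimensional.of_injective f ?_
  rw [← LinearMap.ker_eq_bot, LinearMap.ker_eq_bot']
  intro x hx
  obtain ⟨a, rfl⟩ := Ideal.Quotient.mk_surjective x
  refine Ideal.Quotient.eq_zero_iff_mem.mpr (Ideal.mem_iInf.mpr fun i => ?_)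
  exact Ideal.Quotient.eq_zero_iff_mem.mp (congrFun hx i)

/-- A / I is Artinian, so the minimal primes of I are maximal and finite in number; they intersect
in the radical, a power of which lies in I. Powers of distinct maximal ideals are coprime, which
makes the intersection a product. The exponent n + 1 ensures positivity, which evaluation modules
require. -/
theorem Ideal.exists_iInf_pow_le_of_finiteDimensional (I : Ideal A)
    (hI : FiniteDimensional k (A ⧸ I)) :
    ∃ (l : ℕ) (𝔪 : Fin l → MaximalSpectrum A) (n : ℕ), Function.Injective 𝔪 ∧
      ⨅ i, (𝔪 i).asIdeal ^ (n + 1) ≤ I := by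
  have : IsNoetherianRing A := Algebra.FiniteType.isNoetherianRing k A
  have : IsArtinianRing (A ⧸ I) := IsArtinianRing.of_finite k (A ⧸ I)
  have h0 : Ring.KrullDimLE 0 (A ⧸ I) :=
    (isArtinianRing_iff_isNoetherianRing_krullDimLE_zero.mp this).2
  rw [Ideal.krullDimLE_zero_quotient_iff_forall_minimalPrimes_isMaximal] at h0
  have hfin := I.finite_minimalPrimes_of_isNoetherianRing A
  have : Finite I.minimalPrimes := hfin
  let ε := (Finite.equivFin I.minimalPrimes).symm
  obtain ⟨n, hn⟩ := I.exists_radical_pow_le_of_fg (IsNoetherian.noetherian _)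
  have hinj : Function.Injective fun i => (⟨(ε i).1, h0 _ (ε i).2⟩ : MaximalSpectrum A) :=
    fun i j h => ε.injective (Subtype.ext (congrArg MaximalSpectrum.asIdeal h))
  refine ⟨_, fun i => ⟨(ε i).1, h0 _ (ε i).2⟩, n, hinj, ?_⟩
  have hmax : ∀ i, (ε i).1.IsMaximal := fun i => h0 _ (ε i).2
  have hcop : ∀ i j, i ≠ j → IsCoprime ((ε i).1 ^ (n + 1)) ((ε j).1 ^ (n + 1)) := fun i j hij =>
    (Ideal.isCoprime_of_isMaximal (I := (ε i).1) (J := (ε j).1)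
      fun h => hij (ε.injective (Subtype.ext h))).pow
  have h1 := Ideal.prod_eq_iInf_of_pairwise_isCoprime (s := Finset.univ)
    (J := fun i => (ε i).1 ^ (n + 1)) (fun i _ j _ hij => hcop i j hij)
  simp only [Finset.mem_univ, iInf_pos] at h1
  change ⨅ i, (ε i).1 ^ (n + 1) ≤ I
  rw [← h1, Finset.prod_pow]
  refine ((Ideal.pow_right_mono ?_ _).trans (Ideal.pow_le_pow_right n.le_succ)).trans hn
  rw [← I.sInf_minimalPrimes]
  refine Ideal.prod_le_inf.trans (le_sInf fun J hJ => ?_)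
  refine (Finset.inf_le (Finset.mem_univ (ε.symm ⟨J, hJ⟩))).trans ?_
  rw [ε.apply_symm_apply]

/-- Linear maps `A / Jᵢ → A` that lift the components of `A / ⨅ J ≃ ∏ A / Jᵢ`. -/
theorem Ideal.exists_linear_lifts {k A : Type*} [Field k] [CommRing A] [Algebra k A]
    {l : ℕ} (J : Fin l → Ideal A)
    (hJ : Pairwise (Function.onFun IsCoprime J)) :
    ∃ f : ∀ i, (A ⧸ J i) →ₗ[k] A,
      (∀ i c d, f i (c * d) - f i c * f i d ∈ ⨅ i, J i) ∧
      (∀ i j, i ≠ j → ∀ c d, f i c * f j d ∈ ⨅ i, J i) ∧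
      ∀ a, a - ∑ i, f i (Ideal.Quotient.mkₐ k (J i) a) ∈ ⨅ i, J i := by
  classical
  -- Chinese remainder theorem: aᵢ is 1 modulo Jᵢ and 0 modulo every other Jⱼ. Multiplying a linear
  -- section of A → A / Jᵢ by aᵢ removes its other components.
  choose a ha using fun i : Fin l => Ideal.exists_forall_sub_mem_ideal hJ (Pi.single i (1 : A))
  have hs : ∀ i, ∃ s : (A ⧸ J i) →ₗ[k] A, ∀ c, Ideal.Quotient.mk (J i) (s c) = c := fun i => by
    obtain ⟨s, hs⟩ := (Ideal.Quotient.mkₐ k (J i)).toLinearMap.exists_rightInverse_of_surjective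
      (LinearMap.range_eq_top.mpr (Ideal.Quotient.mkₐ_surjective k (J i)))
    exact ⟨s, fun c => LinearMap.congr_fun hs c⟩
  choose s hs using hs
  let f : ∀ i, (A ⧸ J i) →ₗ[k] A := fun i => LinearMap.mulLeft k (a i) ∘ₗ s i
  have hii : ∀ i c, Ideal.Quotient.mk (J i) (f i c) = c := fun i c => by
    have h := Ideal.Quotient.eq_zero_iff_mem.mpr (ha i i)
    rw [Pi.single_eq_same, map_sub, map_one, sub_eq_zero] at h
    change Ideal.Quotient.mk (J i) (a i * s i c) = c
    rw [map_mul, h, one_mul, hs]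
  have hij : ∀ i j, j ≠ i → ∀ c, Ideal.Quotient.mk (J j) (f i c) = 0 := fun i j h c => by
    have h := Ideal.Quotient.eq_zero_iff_mem.mpr (ha i j)
    rw [Pi.single_eq_of_ne ‹_›, sub_zero] at h
    change Ideal.Quotient.mk (J j) (a i * s i c) = 0
    rw [map_mul, h, zero_mul]
  refine ⟨f, fun i c d => Ideal.mem_iInf.mpr fun j => ?_, fun i i' h c d =>
    Ideal.mem_iInf.mpr fun j => ?_, fun b => Ideal.mem_iInf.mpr fun j => ?_⟩ <;>
    rw [← Ideal.Quotient.eq_zero_iff_mem]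
  · rcases eq_or_ne j i with rfl | hne
    · rw [map_sub, map_mul (Ideal.Quotient.mk _), hii, hii, hii, sub_self]
    · rw [map_sub, map_mul (Ideal.Quotient.mk _), hij i j hne, hij i j hne, zero_mul, sub_zero]
  · rcases eq_or_ne j i with rfl | hne
    · rw [map_mul, hij i' j h, mul_zero]
    · rw [map_mul, hij i j hne, zero_mul]
  · rw [map_sub, map_sum, Finset.sum_eq_single j (fun i _ h => hij i j h.symm _) (by simp), hii,
      Ideal.Quotient.mkₐ_eq_mk, sub_self]

end Codimension

/-! ### Splitting an irreducible module along powers of maximal ideals. -/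

section Evaluation

variable {k : Type u} [Field k] {A : Type w} [CommRing A] [Algebra k A] [Algebra.FiniteType k A]
  {G : Type v} [LieRing G] [LieAlgebra k G] {M : Type z} [AddCommGroup M] [Module k M]
  [LieRingModule (A ⊗[k] G) M]

theorem IsGeneralizedEvaluation.exists_ideal (h : IsGeneralizedEvaluation k A G M) :
    ∃ I : Ideal A, FiniteDimensional k (A ⧸ I) ∧
      ∀ a ∈ I, ∀ (x : G) (m : M), ⁅(a ⊗ₜ[k] x : A ⊗[k] G), m⁆ = 0 := by
  obtain ⟨l, 𝔪, n, V, i₁, i₂, i₃, i₄, e, -, -, -, he⟩ := h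
  refine ⟨⨅ i, (𝔪 i).asIdeal ^ n i, Ideal.finiteDimensional_quotient_iInf _ fun i =>
    Ideal.finiteDimensional_quotient_pow (𝔪 i) (n i), fun a ha x m => e.injective ?_⟩
  rw [he, map_zero]
  refine Finset.sum_eq_zero fun i _ => ?_
  have h0 : Ideal.Quotient.mk ((𝔪 i).asIdeal ^ n i) a = 0 :=
    Ideal.Quotient.eq_zero_iff_mem.mpr (Ideal.mem_iInf.mp ha i)
  rw [LinearMap.rTensor_tmul, AlgHom.toLinearMap_apply, Ideal.Quotient.mkₐ_eq_mk, h0,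
    TensorProduct.zero_tmul, map_zero (LieModule.toEnd k _ (V i))]
  have h1 := (PiTensorProduct.mapMultilinear k V V).map_coord_zero (m := Function.update
    (fun j => (LinearMap.id : V j →ₗ[k] V j)) i 0) i (Function.update_self _ _ _)
  exact LinearMap.congr_fun h1 (e m)

variable [LieModule k (A ⊗[k] G) M]

/-- The linear lifts fᵢ are multiplicative and mutually orthogonal only modulo ⨅ 𝔪ᵢ^(n+1). That
ideal lies in I and acts by zero, so on M they give honest Lie algebra representations of A /
𝔪ᵢ^(n+1) ⊗ G that commute with one another and add up to the given action. -/
theorem isGeneralizedEvaluation_of_ideal [IsAlgClosed k] [FiniteDimensional k M]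
    [LieModule.IsIrreducible k (A ⊗[k] G) M] (I : Ideal A) (hI : FiniteDimensional k (A ⧸ I))
    (hM : ∀ a ∈ I, ∀ (x : G) (m : M), ⁅(a ⊗ₜ[k] x : A ⊗[k] G), m⁆ = 0) :
    IsGeneralizedEvaluation k A G M := by
  obtain ⟨l, 𝔪, n, hinj, hle⟩ := I.exists_iInf_pow_le_of_finiteDimensional hI
  obtain ⟨f, hf1, hf2, hf3⟩ := Ideal.exists_linear_lifts (k := k)
    (fun i => (𝔪 i).asIdeal ^ (n + 1)) fun i j hij =>
      (Ideal.isCoprime_of_isMaximal (I := (𝔪 i).asIdeal) (J := (𝔪 j).asIdeal)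
        fun h => hij (hinj (MaximalSpectrum.ext h))).pow
  have hM' : ∀ a b : A, a - b ∈ ⨅ i, (𝔪 i).asIdeal ^ (n + 1) → ∀ (x : G) (m : M),
      ⁅(a ⊗ₜ[k] x : A ⊗[k] G), m⁆ = ⁅(b ⊗ₜ[k] x : A ⊗[k] G), m⁆ := fun a b h x m => by
    have := hM _ (hle h) x m
    rwa [TensorProduct.sub_tmul, sub_lie, sub_eq_zero] at this
  let ρ : ∀ i, ((A ⧸ (𝔪 i).asIdeal ^ (n + 1)) ⊗[k] G) →ₗ[k] Module.End k M := fun i =>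
    (LieModule.toEnd k (A ⊗[k] G) M : _ →ₗ[k] Module.End k M) ∘ₗ LinearMap.rTensor G (f i)
  have hρt : ∀ i c x m, ρ i (c ⊗ₜ x) m = ⁅(f i c ⊗ₜ[k] x : A ⊗[k] G), m⁆ := fun i c x m => rfl
  have hsum : ∀ (y : A ⊗[k] G) (m : M), ⁅y, m⁆ = ∑ i, ρ i (LinearMap.rTensor G
      (Ideal.Quotient.mkₐ k ((𝔪 i).asIdeal ^ (n + 1))).toLinearMap y) m := by
    intro y m
    induction y using TensorProduct.induction_on with
    | zero => simp
    | add y y' h h' =>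
      simp only [add_lie, h, h', map_add, LinearMap.add_apply, Finset.sum_add_distrib]
    | tmul a x =>
      rw [hM' _ _ (hf3 a), TensorProduct.sum_tmul, sum_lie]
      rfl
  have hlie : ∀ i x y, ρ i ⁅x, y⁆ = ρ i x * ρ i y - ρ i y * ρ i x := by
    intro i x y
    induction x using TensorProduct.induction_on with
    | zero => rw [show ⁅(0 : (A ⧸ (𝔪 i).asIdeal ^ (n + 1)) ⊗[k] G), y⁆ = 0 from zero_lie y]; simp
    | add x x' h h' =>
      rw [show ⁅x + x', y⁆ = ⁅x, y⁆ + ⁅x', y⁆ from add_lie x x' y]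
      simp only [map_add, h, h', add_mul, mul_add]; abel
    | tmul c x =>
      induction y using TensorProduct.induction_on with
      | zero => rw [show ⁅c ⊗ₜ[k] x, (0 : (A ⧸ (𝔪 i).asIdeal ^ (n + 1)) ⊗[k] G)⁆ = 0 from lie_zero (c ⊗ₜ[k] x)]; simp
      | add y y' h h' =>
        rw [show ⁅c ⊗ₜ[k] x, y + y'⁆ = ⁅c ⊗ₜ[k] x, y⁆ + ⁅c ⊗ₜ[k] x, y'⁆ from
          lie_add (c ⊗ₜ[k] x) y y']
        simp only [map_add, h, h', add_mul, mul_add]; abel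
      | tmul d y =>
        ext m
        rw [LieAlgebra.ExtendScalars.bracket_tmul, hρt, hM' _ _ (hf1 i c d),
          ← LieAlgebra.ExtendScalars.bracket_tmul, lie_lie]
        rfl
  have hcomm : ∀ i j, i ≠ j → ∀ x y, ρ i x * ρ j y = ρ j y * ρ i x := by
    intro i j hij x y
    induction x using TensorProduct.induction_on with
    | zero => simp
    | add x x' h h' => simp only [map_add, h, h', add_mul, mul_add]
    | tmul c x =>
      induction y using TensorProduct.induction_on with
      | zero => simp
      | add y y' h h' => simp only [map_add, h, h', add_mul, mul_add]
      | tmul d y =>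
        ext m
        have h := lie_lie (f i c ⊗ₜ[k] x : A ⊗[k] G) (f j d ⊗ₜ[k] y : A ⊗[k] G) m
        rw [LieAlgebra.ExtendScalars.bracket_tmul, hM _ (hle (hf2 i j hij c d))] at h
        exact sub_eq_zero.mp h.symm
  have : Nontrivial M := LieModule.nontrivial_of_isIrreducible k (A ⊗[k] G) M
  obtain ⟨d, σ, e, hσ, he⟩ := exists_piTensorProduct_equiv _ M ρ hlie hcomm fun W hW => by
    let N : LieSubmodule k (A ⊗[k] G) M := { W with
      lie_mem := fun {y m} hm => by
        rw [hsum]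
        exact W.sum_mem fun i _ => hW _ _ _ hm }
    rcases eq_bot_or_eq_top N with h | h
    · exact Or.inl (congrArg LieSubmodule.toSubmodule h)
    · exact Or.inr (congrArg LieSubmodule.toSubmodule h)
  let i₃ : ∀ i, LieRingModule ((A ⧸ (𝔪 i).asIdeal ^ (n + 1)) ⊗[k] G) (Fin (d i) → k) := fun i =>
    { bracket := fun x v => σ i x v
      add_lie := fun x y v => by simp
      lie_add := fun x v v' => by simp
      leibniz_lie := fun x y v => by
        rw [hσ]; simp }
  let i₄ : ∀ i, LieModule k ((A ⧸ (𝔪 i).asIdeal ^ (n + 1)) ⊗[k] G) (Fin (d i) → k) := fun i =>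
    { smul_lie := fun t x v => by
        change σ i (t • x) v = t • σ i x v
        simp
      lie_smul := fun t x v => by
        change σ i x (t • v) = t • σ i x v
        simp }
  refine ⟨l, 𝔪, fun _ => n + 1, fun i => Fin (d i) → k, fun i => inferInstance,
    fun i => inferInstance, i₃, i₄, e, hinj, fun _ => n.succ_pos, fun i => inferInstance,
    fun y m => ?_⟩
  rw [hsum, map_sum]
  exact Finset.sum_congr rfl fun i _ => he _ _ _

theorem isGeneralizedEvaluation_iff [IsAlgClosed k] [FiniteDimensional k M]
    [LieModule.IsIrreducible k (A ⊗[k] G) M] :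
    IsGeneralizedEvaluation k A G M ↔ ∃ I : Ideal A, FiniteDimensional k (A ⧸ I) ∧
      ∀ a ∈ I, ∀ (x : G) (m : M), ⁅(a ⊗ₜ[k] x : A ⊗[k] G), m⁆ = 0 :=
  ⟨fun h => h.exists_ideal, fun ⟨I, hI, hM⟩ => isGeneralizedEvaluation_of_ideal I hI hM⟩

end Evaluation

/-! ### Distinguished gradings from a splitting of the odd part -/

namespace LieSuperalgebra

open DistinguishedGrading

variable {k L : Type*} [Field k] [AddCommGroup L] [Module k L] [LieSuperalgebra k L]

theorem exists_even_add_odd (x : L) : ∃ y ∈ (part 0 : Submodule k L),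
    ∃ z ∈ (part 1 : Submodule k L), y + z = x :=
  Submodule.mem_sup.mp ((isCompl (k := k) (L := L)).sup_eq_top ▸ Submodule.mem_top)

theorem skew_even' {x y : L} {j : ZMod 2} (hx : x ∈ (part j : Submodule k L))
    (hy : y ∈ (part 0 : Submodule k L)) :
    bracket (k := k) x y = -bracket (k := k) y x := by
  rw [skew_even hy hx, neg_neg]

/-- A decomposition of the odd part into two abelian submodules over the even part. -/
structure OddSplitting (S T : Submodule k L) : Prop where
  sup_eq : S ⊔ T = part 1
  disjoint : Disjoint S T
  left_mem : ∀ x ∈ (part 0 : Submodule k L), ∀ y ∈ S, bracket (k := k) x y ∈ S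
  right_mem : ∀ x ∈ (part 0 : Submodule k L), ∀ y ∈ T, bracket (k := k) x y ∈ T
  left_abelian : ∀ x ∈ S, ∀ y ∈ S, bracket (k := k) x y = 0
  right_abelian : ∀ x ∈ T, ∀ y ∈ T, bracket (k := k) x y = 0

/-- The components of the grading given by a splitting of the odd part. -/
def splittingPiece (S T : Submodule k L) (i : ℤ) : Submodule k L :=
  if i = 0 then part 0 else if i = -1 then S else if i = 1 then T else ⊥

section Splitting

variable (S T : Submodule k L)

theorem splittingPiece_neg_one : splittingPiece S T (-1) = S := rfl

theorem splittingPiece_one : splittingPiece S T 1 = T := rfl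

variable {S T}

theorem splittingPiece_of_ne {i : ℤ} (h0 : i ≠ 0) (h1 : i ≠ -1) (h2 : i ≠ 1) :
    splittingPiece S T i = ⊥ := by
  rw [splittingPiece, if_neg h0, if_neg h1, if_neg h2]

theorem splittingPiece_induction {p : ℤ → Prop} (h0 : p 0) (h1 : p (-1)) (h2 : p 1)
    (h : ∀ i, splittingPiece S T i = ⊥ → p i) (i : ℤ) : p i := by
  by_cases hi0 : i = 0
  · exact hi0 ▸ h0
  by_cases hi1 : i = -1
  · exact hi1 ▸ h1
  by_cases hi2 : i = 1
  · exact hi2 ▸ h2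
  exact h i (splittingPiece_of_ne hi0 hi1 hi2)

theorem isInternal_splittingPiece (hsup : S ⊔ T = part 1) (hdisj : Disjoint S T) :
    DirectSum.IsInternal (splittingPiece S T) := by
  have hS : S ≤ part 1 := hsup ▸ le_sup_left
  have hT : T ≤ part 1 := hsup ▸ le_sup_right
  have h01 := (isCompl (k := k) (L := L)).disjoint
  rw [DirectSum.isInternal_submodule_iff_iSupIndep_and_iSup_eq_top]
  constructor
  -- Independence in degree i reduces to disjointness from any U that contains the other two
  -- nontrivial pieces.
  · have hle : ∀ (i : ℤ) (U : Submodule k L), (0 ≠ i → part 0 ≤ U) → (-1 ≠ i → S ≤ U) →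
        (1 ≠ i → T ≤ U) → ⨆ (j : ℤ) (_ : j ≠ i), splittingPiece S T j ≤ U :=
      fun i U h0 h1 h2 => iSup₂_le fun j => splittingPiece_induction (S := S) (T := T)
        (p := fun j => j ≠ i → splittingPiece S T j ≤ U) h0 h1 h2
        (fun j hj _ => hj.le.trans bot_le) j
    rw [iSupIndep_def]
    intro i
    refine splittingPiece_induction (S := S) (T := T) (p := fun i => Disjoint
      (splittingPiece S T i) (⨆ (j : ℤ) (_ : j ≠ i), splittingPiece S T j)) ?_ ?_ ?_
      (fun i hi => by rw [hi]; exact disjoint_bot_left) i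
    · exact h01.mono_right (hle 0 (part 1) (fun h => absurd rfl h) (fun _ => hS) fun _ => hT)
    · refine Disjoint.mono_right (hle (-1) (T ⊔ part 0) (fun _ => le_sup_right)
        (fun h => absurd rfl h) fun _ => le_sup_left) ?_
      rw [splittingPiece_neg_one]
      exact hdisj.disjoint_sup_right_of_disjoint_sup_left (hsup ▸ h01.symm)
    · refine Disjoint.mono_right (hle 1 (S ⊔ part 0) (fun _ => le_sup_right)
        (fun _ => le_sup_left) fun h => absurd rfl h) ?_
      rw [splittingPiece_one]
      refine hdisj.symm.disjoint_sup_right_of_disjoint_sup_left ?_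
      rw [sup_comm, hsup]
      exact h01.symm
  · rw [eq_top_iff, ← (isCompl (k := k) (L := L)).sup_eq_top, ← hsup]
    exact sup_le (le_iSup (splittingPiece S T) 0)
      (sup_le ((splittingPiece_neg_one S T).ge.trans (le_iSup (splittingPiece S T) (-1)))
        ((splittingPiece_one S T).ge.trans (le_iSup (splittingPiece S T) 1)))

/-- The distinguished grading given by a splitting of the odd part. -/
def OddSplitting.grading (h : OddSplitting S T) : DistinguishedGrading k L where
  piece := splittingPiece S T
  isInternal := isInternal_splittingPiece h.sup_eq h.disjoint
  bracket_mem {i j x y} hx hy := by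
    have hS : S ≤ part 1 := h.sup_eq ▸ le_sup_left
    have hT : T ≤ part 1 := h.sup_eq ▸ le_sup_right
    have key : ∀ i, (∀ x ∈ splittingPiece S T i, ∀ j, ∀ y ∈ splittingPiece S T j,
        bracket (k := k) x y ∈ splittingPiece S T (i + j)) := by
      have hbot : ∀ i j, splittingPiece S T j = ⊥ → ∀ x, ∀ y ∈ splittingPiece S T j,
          bracket (k := k) x y ∈ splittingPiece S T (i + j) := fun i j hj x y hy => by
        rw [hj, Submodule.mem_bot] at hy
        rw [hy, map_zero]
        exact Submodule.zero_mem _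
      have hodd : ∀ {x y : L}, x ∈ (part 1 : Submodule k L) → y ∈ (part 1 : Submodule k L) →
          bracket (k := k) x y ∈ (part 0 : Submodule k L) := fun hx hy =>
        LieSuperalgebra.bracket_mem hx hy
      refine splittingPiece_induction (S := S) (T := T) (fun x hx => ?_) (fun x hx => ?_)
        (fun x hx => ?_) (fun i hi x hx j y hy => ?_)
      · exact splittingPiece_induction (S := S) (T := T) (fun y hy => bracket_even_mem hx hy)
          (h.left_mem x hx) (h.right_mem x hx) (fun j hj => hbot 0 j hj x)
      · refine splittingPiece_induction (S := S) (T := T) (fun y hy => ?_) (fun y hy => ?_)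
          (fun y hy => hodd (hS hx) (hT hy)) (fun j hj => hbot _ j hj x)
        · have := Submodule.neg_mem _ (h.left_mem y hy x hx)
          rwa [← skew_even' (hS hx) hy] at this
        · rw [h.left_abelian x hx y hy]
          exact Submodule.zero_mem _
      · refine splittingPiece_induction (S := S) (T := T) (fun y hy => ?_)
          (fun y hy => hodd (hT hx) (hS hy)) (fun y hy => ?_) (fun j hj => hbot _ j hj x)
        · have := Submodule.neg_mem _ (h.right_mem y hy x hx)
          rwa [← skew_even' (hT hx) hy] at this
        · rw [h.right_abelian x hx y hy]
          exact Submodule.zero_mem _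
      · rw [hi, Submodule.mem_bot] at hx
        rw [hx, map_zero]
        exact Submodule.zero_mem _
    exact key i x hx j y hy
  piece_eq_bot i hi := splittingPiece_of_ne (by rintro rfl; simp at hi) (by rintro rfl; simp at hi)
    (by rintro rfl; simp at hi)
  piece_zero := rfl
  piece_odd := h.sup_eq

end Splitting

/-! ### Simple Lie superalgebras with reducible odd part -/

section Simple

variable {S T : Submodule k L}

/-- If the odd part of a simple Lie superalgebra is the sum of an irreducible submodule `S` over
the even part and a nonzero submodule `T`, then `[S, S] = 0`. -/
theorem IsSimple.bracket_eq_zero_of_irreducible (hL : IsSimple k L) (hsup : S ⊔ T = part 1)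
    (hdisj : Disjoint S T) (hS0 : S ≠ ⊥) (hT0 : T ≠ ⊥)
    (hS : ∀ x ∈ (part 0 : Submodule k L), ∀ y ∈ S, bracket (k := k) x y ∈ S)
    (hT : ∀ x ∈ (part 0 : Submodule k L), ∀ y ∈ T, bracket (k := k) x y ∈ T)
    (hirr : ∀ N ≤ S, (∀ x ∈ (part 0 : Submodule k L), ∀ y ∈ N, bracket (k := k) x y ∈ N) →
      N = ⊥ ∨ N = S) {x y : L} (hx : x ∈ S) (hy : y ∈ S) : bracket (k := k) x y = 0 := by
  have hS1 : S ≤ part 1 := hsup ▸ le_sup_left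
  have hT1 : T ≤ part 1 := hsup ▸ le_sup_right
  have h01 := (isCompl (k := k) (L := L)).disjoint
  have hodd : ∀ {x y : L}, x ∈ (part 1 : Submodule k L) → y ∈ (part 1 : Submodule k L) →
    bracket (k := k) x y ∈ (part 0 : Submodule k L) := fun hx hy => LieSuperalgebra.bracket_mem hx hy
  -- Q is [S, S], an ideal of the even part; the aim is Q = 0.
  let Q := Submodule.span k {z | ∃ s ∈ S, ∃ s' ∈ S, z = bracket (k := k) s s'}
  have hQmem : ∀ {s s'}, s ∈ S → s' ∈ S → bracket (k := k) s s' ∈ Q := fun hs hs' =>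
    Submodule.subset_span ⟨_, hs, _, hs', rfl⟩
  have hQ0 : Q ≤ part 0 := Submodule.span_le.mpr (by
    rintro _ ⟨s, hs, s', hs', rfl⟩
    exact hodd (hS1 hs) (hS1 hs'))
  have hQ : ∀ x ∈ (part 0 : Submodule k L), ∀ z ∈ Q, bracket (k := k) x z ∈ Q := by
    intro x hx z hz
    induction hz using Submodule.span_induction with
    | zero => rw [map_zero]; exact Q.zero_mem
    | add z z' _ _ h h' => rw [map_add]; exact Q.add_mem h h'
    | smul c z _ h => rw [map_smul]; exact Q.smul_mem c h
    | mem z hz =>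
      obtain ⟨s, hs, s', hs', rfl⟩ := hz
      rw [jacobi s' hx (hS1 hs), superSign, if_neg (by simp), one_smul]
      exact Q.add_mem (hQmem (hS x hx s hs) hs') (hQmem hs (hS x hx s' hs'))
  -- [Q, T] lies in T because Q is even, and in S by expanding [[s, s'], t], since [s', t] and [s,
  -- t] are even and S is stable. The two meet in 0.
  have hQT : ∀ z ∈ Q, ∀ t ∈ T, bracket (k := k) z t = 0 := by
    intro z hz t ht
    refine Submodule.disjoint_def.mp hdisj _ ?_ (hT z (hQ0 hz) t ht)
    induction hz using Submodule.span_induction with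
    | zero => rw [map_zero]; exact S.zero_mem
    | add z z' _ _ h h' => rw [map_add]; exact S.add_mem h h'
    | smul c z _ h => rw [map_smul]; exact S.smul_mem c h
    | mem z hz =>
      obtain ⟨s, hs, s', hs', rfl⟩ := hz
      have hmem : ∀ {s s'}, s ∈ S → s' ∈ S →
          bracket (k := k) s (bracket (k := k) s' t) ∈ S := fun {s s'} hs hs' => by
        rw [skew_even' (hS1 hs) (hodd (hS1 hs') (hT1 ht))]
        exact S.neg_mem (hS _ (hodd (hS1 hs') (hT1 ht)) _ hs)
      rw [bracket_bracket_odd t (hS1 hs) (hS1 hs')]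
      exact S.add_mem (hmem hs hs') (hmem hs' hs)
  have hdec : ∀ x : L, ∃ x₀ ∈ (part 0 : Submodule k L), ∃ s ∈ S, ∃ t ∈ T, x₀ + (s + t) = x := by
    intro x
    obtain ⟨x₀, h₀, x₁, h₁, rfl⟩ := exists_even_add_odd (k := k) x
    obtain ⟨s, hs, t, ht, rfl⟩ := Submodule.mem_sup.mp (hsup ▸ h₁)
    exact ⟨x₀, h₀, s, hs, t, ht, rfl⟩
  have hTQ : ∀ t ∈ T, ∀ z ∈ Q, bracket (k := k) t z = 0 := fun t ht z hz => by
    rw [skew_even' (hT1 ht) (hQ0 hz), hQT z hz t ht, neg_zero]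
  suffices h : Q = ⊥ by
    have := hQmem hx hy
    rwa [h, Submodule.mem_bot] at this
  -- N is [Q, S], a submodule of S over the even part, so irreducibility leaves only N = 0 and N =
  -- S.
  let N := Submodule.span k {w | ∃ z ∈ Q, ∃ s ∈ S, w = bracket (k := k) z s}
  have hNmem : ∀ {z s}, z ∈ Q → s ∈ S → bracket (k := k) z s ∈ N := fun hz hs =>
    Submodule.subset_span ⟨_, hz, _, hs, rfl⟩
  have hNS : N ≤ S := Submodule.span_le.mpr (by
    rintro _ ⟨z, hz, s, hs, rfl⟩
    exact hS z (hQ0 hz) s hs)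
  have hN : ∀ x ∈ (part 0 : Submodule k L), ∀ w ∈ N, bracket (k := k) x w ∈ N := by
    intro x hx w hw
    induction hw using Submodule.span_induction with
    | zero => rw [map_zero]; exact N.zero_mem
    | add z z' _ _ h h' => rw [map_add]; exact N.add_mem h h'
    | smul c z _ h => rw [map_smul]; exact N.smul_mem c h
    | mem w hw =>
      obtain ⟨z, hz, s, hs, rfl⟩ := hw
      rw [jacobi s hx (hQ0 hz), superSign, if_neg (by simp), one_smul]
      exact N.add_mem (hNmem (hQ x hx z hz) hs) (hNmem hz (hS x hx s hs))
  rcases hirr N hNS hN with h | h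
  -- If [Q, S] = 0, then Q is a graded ideal of L contained in the even part; it is not L because T
  -- ≠ 0, so it is 0.
  · refine (hL.2 Q (fun x hx => ⟨x, hx, 0, Q.zero_mem, hQ0 hx, Submodule.zero_mem _,
      (add_zero x).symm⟩) fun x z hz => ?_).resolve_right fun htop => hT0 ?_
    · obtain ⟨x₀, h₀, s, hs, t, ht, rfl⟩ := hdec x
      have h1 : bracket (k := k) z s = 0 := by
        have := hNmem hz hs
        rwa [h, Submodule.mem_bot] at this
      simp only [map_add, LinearMap.add_apply]
      rw [hTQ t ht z hz, skew_even' (hS1 hs) (hQ0 hz), h1, neg_zero, add_zero, add_zero]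
      exact hQ x₀ h₀ z hz
    · exact eq_bot_iff.mpr fun t ht => (Submodule.mem_bot k).mpr
        (Submodule.disjoint_def.mp h01 t (hQ0 (htop ▸ Submodule.mem_top)) (hT1 ht))
  -- If [Q, S] = S, then [T, S] = [T, [Q, S]] ⊆ [Q, [T, S]] ⊆ Q because [Q, T] = 0. Hence Q + S is a
  -- graded ideal; it contains S ≠ 0 and misses T ≠ 0, which contradicts simplicity.
  · have hC : ∀ s ∈ S, ∀ t ∈ T, bracket (k := k) t s ∈ Q := by
      intro s hs t ht
      rw [← h] at hs
      induction hs using Submodule.span_induction with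
      | zero => rw [map_zero]; exact Q.zero_mem
      | add z z' _ _ h h' => rw [map_add]; exact Q.add_mem h h'
      | smul c z _ h => rw [map_smul]; exact Q.smul_mem c h
      | mem w hw =>
        obtain ⟨z, hz, s, hs, rfl⟩ := hw
        have h1 := jacobi s (hQ0 hz) (hT1 ht)
        rw [hQT z hz t ht, map_zero, LinearMap.zero_apply, zero_add, superSign,
          if_neg (by simp), one_smul] at h1
        rw [← h1, skew_even (hQ0 hz) (hodd (hT1 ht) (hS1 hs))]
        exact Q.neg_mem (hQ _ (hodd (hT1 ht) (hS1 hs)) z hz)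
    exfalso
    have hI := hL.2 (Q ⊔ S) (fun x hx => by
      obtain ⟨z, hz, s, hs, rfl⟩ := Submodule.mem_sup.mp hx
      exact ⟨z, Submodule.mem_sup_left hz, s, Submodule.mem_sup_right hs, hQ0 hz, hS1 hs, rfl⟩)
      fun x y hy => by
        obtain ⟨x₀, h₀, s', hs', t, ht, rfl⟩ := hdec x
        obtain ⟨z, hz, s, hs, rfl⟩ := Submodule.mem_sup.mp hy
        simp only [map_add, LinearMap.add_apply]
        rw [hTQ t ht z hz, skew_even' (hS1 hs') (hQ0 hz)]
        refine Submodule.add_mem _ (Submodule.add_mem _ (Submodule.mem_sup_left (hQ x₀ h₀ z hz))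
          (Submodule.add_mem _ (Submodule.mem_sup_right (S.neg_mem (hS z (hQ0 hz) s' hs')))
            (Submodule.zero_mem _))) (Submodule.add_mem _ (Submodule.mem_sup_right (hS x₀ h₀ s hs))
          (Submodule.add_mem _ (Submodule.mem_sup_left (hQmem hs' hs))
            (Submodule.mem_sup_left (hC s hs t ht))))
    rcases hI with hI | hI
    · exact hS0 (eq_bot_iff.mpr (hI ▸ le_sup_right))
    · refine hT0 (eq_bot_iff.mpr fun t ht => (Submodule.mem_bot k).mpr ?_)
      obtain ⟨z, hz, s, hs, rfl⟩ := Submodule.mem_sup.mp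
        (hI ▸ Submodule.mem_top : t ∈ Q ⊔ S)
      have hz0 : z = 0 := by
        refine Submodule.disjoint_def.mp h01 z (hQ0 hz) ?_
        have := Submodule.sub_mem _ (hT1 ht) (hS1 hs)
        rwa [add_sub_cancel_right] at this
      rw [hz0, zero_add] at ht ⊢
      exact Submodule.disjoint_def.mp hdisj s hs ht

/-- The derived algebra is an ideal, graded because the bracket is, and nonzero by the definition of
simplicity. -/
theorem IsSimple.span_bracket_eq_top (hL : IsSimple k L) :
    Submodule.span k {z : L | ∃ x y : L, z = bracket (k := k) x y} = ⊤ := by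
  obtain ⟨⟨x, y, hxy⟩, hI⟩ := hL
  have hmem : ∀ x y : L, bracket (k := k) x y ∈
      Submodule.span k {z : L | ∃ x y : L, z = bracket (k := k) x y} := fun x y =>
    Submodule.subset_span ⟨x, y, rfl⟩
  refine (hI _ (fun z hz => ?_) fun x y _ => hmem x y).resolve_left fun h => hxy ?_
  · induction hz using Submodule.span_induction with
    | zero => exact ⟨0, Submodule.zero_mem _, 0, Submodule.zero_mem _, Submodule.zero_mem _,
        Submodule.zero_mem _, (add_zero 0).symm⟩
    | add z z' _ _ h h' =>
      obtain ⟨a, ha, b, hb, ha0, hb1, rfl⟩ := h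
      obtain ⟨a', ha', b', hb', ha0', hb1', rfl⟩ := h'
      exact ⟨a + a', Submodule.add_mem _ ha ha', b + b', Submodule.add_mem _ hb hb',
        Submodule.add_mem _ ha0 ha0', Submodule.add_mem _ hb1 hb1', add_add_add_comm _ _ _ _⟩
    | smul c z _ h =>
      obtain ⟨a, ha, b, hb, ha0, hb1, rfl⟩ := h
      exact ⟨c • a, Submodule.smul_mem _ c ha, c • b, Submodule.smul_mem _ c hb,
        Submodule.smul_mem _ c ha0, Submodule.smul_mem _ c hb1, smul_add _ _ _⟩
    | mem z hz =>
      obtain ⟨x, y, rfl⟩ := hz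
      obtain ⟨x₀, hx₀, x₁, hx₁, rfl⟩ := exists_even_add_odd (k := k) x
      obtain ⟨y₀, hy₀, y₁, hy₁, rfl⟩ := exists_even_add_odd (k := k) y
      refine ⟨bracket (k := k) x₀ y₀ + bracket (k := k) x₁ y₁,
        Submodule.add_mem _ (hmem _ _) (hmem _ _),
        bracket (k := k) x₀ y₁ + bracket (k := k) x₁ y₀,
        Submodule.add_mem _ (hmem _ _) (hmem _ _),
        Submodule.add_mem _ (bracket_even_mem hx₀ hy₀) (LieSuperalgebra.bracket_mem hx₁ hy₁),
        Submodule.add_mem _ (bracket_even_mem hx₀ hy₁) ?_, ?_⟩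
      · have := LieSuperalgebra.bracket_mem hx₁ hy₀
        rwa [add_zero] at this
      · simp only [map_add, LinearMap.add_apply]
        abel
  · have := hmem x y
    rwa [h, Submodule.mem_bot] at this

variable [CharZero k]

/-- `IsSimple.bracket_eq_zero_of_irreducible` applies twice, with the roles of the two irreducible
summands exchanged. -/
theorem IsSimple.exists_oddSplitting (hL : IsSimple k L) (h : IsTypeI k L) :
    ∃ S T : Submodule k L, OddSplitting S T := by
  obtain ⟨W₁, W₂, hW, h₁, h₂⟩ := h
  let φ := fun W : LieSubmodule k (part 0 : Submodule k L) (part 1 : Submodule k L) =>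
    W.toSubmodule.map (part 1 : Submodule k L).subtype
  have hinj : Function.Injective (part 1 : Submodule k L).subtype := Subtype.val_injective
  have hstab : ∀ W, ∀ x ∈ (part 0 : Submodule k L), ∀ y ∈ φ W, bracket (k := k) x y ∈ φ W := by
    rintro W x hx _ ⟨y, hy, rfl⟩
    exact ⟨⁅(⟨x, hx⟩ : (part 0 : Submodule k L)), y⁆, W.lie_mem hy, rfl⟩
  have hne : ∀ W : LieSubmodule k (part 0 : Submodule k L) (part 1 : Submodule k L),
      LieModule.IsIrreducible k (part 0 : Submodule k L) W → φ W ≠ ⊥ := by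
    intro W hW h0
    have : Nontrivial W := LieModule.nontrivial_of_isIrreducible k (part 0 : Submodule k L) W
    obtain ⟨w, hw⟩ := exists_ne (0 : W)
    refine hw (Subtype.ext (Subtype.ext ?_))
    have : ((w : (part 1 : Submodule k L)) : L) ∈ φ W := ⟨w, w.2, rfl⟩
    rwa [h0, Submodule.mem_bot] at this
  have hirr : ∀ W : LieSubmodule k (part 0 : Submodule k L) (part 1 : Submodule k L),
      LieModule.IsIrreducible k (part 0 : Submodule k L) W → ∀ N ≤ φ W,
      (∀ x ∈ (part 0 : Submodule k L), ∀ y ∈ N, bracket (k := k) x y ∈ N) →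
        N = ⊥ ∨ N = φ W := by
    intro W hW N hN hstab
    let N' : LieSubmodule k (part 0 : Submodule k L) W :=
      { N.comap ((part 1 : Submodule k L).subtype ∘ₗ W.toSubmodule.subtype) with
        lie_mem := fun {x m} hm => hstab x x.2 _ hm }
    have hN' : ∀ w : W, w ∈ N' ↔ ((w : (part 1 : Submodule k L)) : L) ∈ N := fun w => Iff.rfl
    rcases eq_bot_or_eq_top N' with h | h
    · refine Or.inl (eq_bot_iff.mpr fun x hx => ?_)
      obtain ⟨w, hw, rfl⟩ := hN hx
      have := (hN' ⟨w, hw⟩).mpr hx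
      rw [h, LieSubmodule.mem_bot] at this
      rw [Submodule.mem_bot, show w = 0 from congrArg Subtype.val this]
      rfl
    · refine Or.inr (le_antisymm hN ?_)
      rintro _ ⟨w, hw, rfl⟩
      exact (hN' ⟨w, hw⟩).mp (h ▸ LieSubmodule.mem_top _)
  have hsup : φ W₁ ⊔ φ W₂ = part 1 := by
    rw [← Submodule.map_sup, ← LieSubmodule.sup_toSubmodule, hW.sup_eq_top,
      LieSubmodule.top_toSubmodule, Submodule.map_top, Submodule.range_subtype]
  have hdisj : Disjoint (φ W₁) (φ W₂) := by
    rw [disjoint_iff, ← Submodule.map_inf _ hinj, ← LieSubmodule.inf_toSubmodule, hW.inf_eq_bot,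
      LieSubmodule.bot_toSubmodule, Submodule.map_bot]
  exact ⟨φ W₁, φ W₂, hsup, hdisj, hstab W₁, hstab W₂,
    fun x hx y hy => hL.bracket_eq_zero_of_irreducible hsup hdisj (hne _ h₁) (hne _ h₂)
      (hstab _) (hstab _) (hirr _ h₁) hx hy,
    fun x hx y hy => hL.bracket_eq_zero_of_irreducible (sup_comm (φ W₁) _ ▸ hsup) hdisj.symm
      (hne _ h₂) (hne _ h₁) (hstab _) (hstab _) (hirr _ h₂) hx hy⟩

end Simple

end LieSuperalgebra

/-! ### The grading of `sl(n,n)` -/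

namespace LieSuperalgebra

/-! ### Transport along isomorphisms of Lie superalgebras. -/

section Transport

variable {k L L' : Type*} [Field k] [AddCommGroup L] [Module k L] [LieSuperalgebra k L]
  [AddCommGroup L'] [Module k L'] [LieSuperalgebra k L']

theorem Iso.apply_bracket (φ : Iso k L L') (x y : L) :
    φ.toLinearEquiv (bracket (k := k) x y) =
      bracket (k := k) (φ.toLinearEquiv x) (φ.toLinearEquiv y) :=
  φ.map_bracket x y

/-- `Iso` only asks that each part be mapped into the corresponding part; the converse holds because
the parts are complementary. -/
theorem Iso.mem_part_iff (φ : Iso k L L') (i : ZMod 2) (x : L) :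
    φ.toLinearEquiv x ∈ (part i : Submodule k L') ↔ x ∈ (part i : Submodule k L) := by
  have h01 := Submodule.disjoint_def.mp (isCompl (k := k) (L := L')).disjoint
  refine ⟨fun h => ?_, φ.map_part i x⟩
  obtain ⟨y, hy, z, hz, rfl⟩ := exists_even_add_odd (k := k) x
  have hy' : φ.toLinearEquiv y ∈ (part 0 : Submodule k L') := φ.map_part 0 y hy
  have hz' : φ.toLinearEquiv z ∈ (part 1 : Submodule k L') := φ.map_part 1 z hz
  rw [map_add] at h
  rcases parity_cases i with rfl | rfl
  · have h0 := h01 _ ((Submodule.add_mem_iff_right _ hy').mp h) hz'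
    rw [φ.toLinearEquiv.map_eq_zero_iff.mp h0, add_zero]
    exact hy
  · have h0 := h01 _ hy' ((Submodule.add_mem_iff_left _ hz').mp h)
    rw [φ.toLinearEquiv.map_eq_zero_iff.mp h0, zero_add]
    exact hz

theorem OddSplitting.comap {S T : Submodule k L'} (h : OddSplitting S T) (φ : Iso k L L') :
    OddSplitting (S.comap φ.toLinearEquiv.toLinearMap)
      (T.comap φ.toLinearEquiv.toLinearMap) where
  sup_eq := by
    ext x
    rw [← φ.mem_part_iff, ← h.sup_eq, Submodule.mem_sup, Submodule.mem_sup]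
    constructor
    · rintro ⟨y, hy, z, hz, rfl⟩
      exact ⟨_, hy, _, hz, (map_add φ.toLinearEquiv y z).symm⟩
    · rintro ⟨y, hy, z, hz, h⟩
      refine ⟨φ.toLinearEquiv.symm y, by simpa using hy, φ.toLinearEquiv.symm z, by simpa using hz,
        ?_⟩
      rw [← map_add, h, LinearEquiv.symm_apply_apply]
  disjoint := Submodule.disjoint_def.mpr fun x hx hy =>
    φ.toLinearEquiv.map_eq_zero_iff.mp (Submodule.disjoint_def.mp h.disjoint _ hx hy)
  left_mem x hx y hy := by
    change φ.toLinearEquiv (bracket (k := k) x y) ∈ S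
    rw [φ.apply_bracket]
    exact h.left_mem _ ((φ.mem_part_iff 0 x).mpr hx) _ hy
  right_mem x hx y hy := by
    change φ.toLinearEquiv (bracket (k := k) x y) ∈ T
    rw [φ.apply_bracket]
    exact h.right_mem _ ((φ.mem_part_iff 0 x).mpr hx) _ hy
  left_abelian x hx y hy := by
    rw [← φ.toLinearEquiv.map_eq_zero_iff, φ.apply_bracket]
    exact h.left_abelian _ hx _ hy
  right_abelian x hx y hy := by
    rw [← φ.toLinearEquiv.map_eq_zero_iff, φ.apply_bracket]
    exact h.right_abelian _ hx _ hy

theorem Iso.part_zero_le_span_bracket (φ : Iso k L L')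
    (h : (part 0 : Submodule k L') ≤ Submodule.span k {z | ∃ x y : L', z = bracket (k := k) x y}) :
    (part 0 : Submodule k L) ≤ Submodule.span k {z | ∃ x y : L, z = bracket (k := k) x y} := by
  intro x hx
  have hle : Submodule.span k {z | ∃ x y : L', z = bracket (k := k) x y} ≤
      (Submodule.span k {z | ∃ x y : L, z = bracket (k := k) x y}).map
        φ.toLinearEquiv.toLinearMap := by
    rw [Submodule.span_le]
    rintro _ ⟨x, y, rfl⟩
    obtain ⟨x, rfl⟩ := φ.toLinearEquiv.surjective x
    obtain ⟨y, rfl⟩ := φ.toLinearEquiv.surjective y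
    exact ⟨_, Submodule.subset_span ⟨x, y, rfl⟩, φ.map_bracket x y⟩
  obtain ⟨y, hy, hxy⟩ := hle (h ((φ.mem_part_iff 0 x).mpr hx))
  rwa [← φ.toLinearEquiv.injective hxy]

end Transport

/-! ### Off-diagonal blocks and brackets in sl(n,n). -/

section Sl

variable (k : Type*) [Field k] (n : ℕ)

/-- The matrices in `sl(n,n)` supported on the off-diagonal block whose rows are indexed by the
left summand if `ε` is `true` and by the right summand if `ε` is `false`. -/
def slBlock (ε : Bool) : Submodule k (slSuper k n).carrier where
  carrier := {X | ∀ a b, ¬ (a.isLeft = ε ∧ b.isLeft = !ε) → (X : Gl k n) a b = 0}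
  add_mem' {X Y} hX hY a b h := by
    change (X : Gl k n) a b + (Y : Gl k n) a b = 0
    rw [hX a b h, hY a b h, add_zero]
  zero_mem' _ _ _ := rfl
  smul_mem' t X hX a b h := by
    change t * (X : Gl k n) a b = 0
    rw [hX a b h, mul_zero]

variable {k n}

theorem slBlock_le (ε : Bool) : slBlock k n ε ≤ part 1 := by
  intro X hX
  change (X : Gl k n) ∈ glPart k n 1
  intro a b h
  refine hX a b fun ⟨h1, h2⟩ => h ?_
  rw [h1, h2]
  cases ε <;> rfl

/-- Multiplication by a block diagonal matrix, on either side, preserves each off-diagonal block. -/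
theorem slBlock_bracket_mem {ε : Bool} {X Y : (slSuper k n).carrier}
    (hX : X ∈ (part 0 : Submodule k (slSuper k n).carrier)) (hY : Y ∈ slBlock k n ε) :
    bracket (k := k) X Y ∈ slBlock k n ε := by
  intro a b h
  have hY1 : (Y : Gl k n) ∈ glPart k n 1 := slBlock_le ε hY
  have h1 : glBracket k n (X : Gl k n) (Y : Gl k n) = _ :=
    glBracket_apply (i := 0) (j := 1) hX hY1
  rw [superSign, if_neg (by simp), one_smul] at h1
  refine (congrFun (congrFun h1 a) b).trans ?_
  change (∑ c, (X : Gl k n) a c * (Y : Gl k n) c b) - ∑ c, (Y : Gl k n) a c * (X : Gl k n) c b = 0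
  have hX' : ∀ a b : Fin n ⊕ Fin n, a.isLeft ≠ b.isLeft → (X : Gl k n) a b = 0 := fun a b h =>
    hX a b (by simp [h])
  rw [Finset.sum_eq_zero fun c _ => ?_, Finset.sum_eq_zero fun c _ => ?_, sub_zero]
  · by_cases hc : c.isLeft = b.isLeft
    · rw [hY a c (by rwa [hc]), zero_mul]
    · rw [hX' c b hc, mul_zero]
  · by_cases hc : a.isLeft = c.isLeft
    · rw [hY c b (by rwa [← hc]), mul_zero]
    · rw [hX' a c hc, zero_mul]

/-- Nonzero columns of X and nonzero rows of Y are indexed by opposite summands, so both products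
vanish. -/
theorem slBlock_abelian {ε : Bool} {X Y : (slSuper k n).carrier} (hX : X ∈ slBlock k n ε)
    (hY : Y ∈ slBlock k n ε) : bracket (k := k) X Y = 0 := by
  have key : ∀ {X Y : (slSuper k n).carrier}, X ∈ slBlock k n ε → Y ∈ slBlock k n ε →
      (X : Gl k n) * (Y : Gl k n) = 0 := by
    intro X Y hX hY
    funext a b
    change (∑ c, (X : Gl k n) a c * (Y : Gl k n) c b) = 0
    refine Finset.sum_eq_zero fun c _ => ?_
    by_cases hc : c.isLeft = ε
    · have : (X : Gl k n) a c = 0 := hX a c fun h => by simp [hc] at h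
      rw [this, zero_mul]
    · have : (Y : Gl k n) c b = 0 := hY c b fun h => hc h.1
      rw [this, mul_zero]
  have h1 : glBracket k n (X : Gl k n) (Y : Gl k n) = _ :=
    glBracket_apply (i := 1) (j := 1) (slBlock_le ε hX) (slBlock_le ε hY)
  rw [key hX hY, key hY hX, smul_zero, sub_zero] at h1
  exact Subtype.ext h1

theorem oddSplitting_slBlock : OddSplitting (slBlock k n false) (slBlock k n true) where
  sup_eq := by
    refine le_antisymm (sup_le (slBlock_le _) (slBlock_le _)) fun X hX => ?_
    have hX : ∀ a b : Fin n ⊕ Fin n, a.isLeft = b.isLeft → (X : Gl k n) a b = 0 := fun a b h =>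
      hX a b (by simp [h])
    let Y : Bool → Gl k n := fun ε a b => if a.isLeft = ε ∧ b.isLeft = !ε then (X : Gl k n) a b else 0
    have hY : ∀ ε, Y ε ∈ (slSuper k n).carrier := fun ε => LinearMap.mem_ker.mpr
      (supertrace_odd fun a b h => if_neg fun ⟨h1, h2⟩ => h (by rw [h1, h2]; cases ε <;> rfl))
    refine Submodule.mem_sup.mpr ⟨⟨Y false, hY _⟩, fun a b h => if_neg h, ⟨Y true, hY _⟩,
      fun a b h => if_neg h, Subtype.ext (funext fun a => funext fun b => ?_)⟩
    change (if _ then _ else _) + (if _ then _ else _) = (X : Gl k n) a b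
    have := hX a b
    cases ha : a.isLeft <;> cases hb : b.isLeft <;> simp_all
  disjoint := Submodule.disjoint_def.mpr fun X h0 h1 => Subtype.ext <| funext fun a =>
    funext fun b => by
      cases ha : a.isLeft
      · exact h1 a b fun h => by simp [ha] at h
      · exact h0 a b fun h => by simp [ha] at h
  left_mem _ hx _ hy := slBlock_bracket_mem hx hy
  right_mem _ hx _ hy := slBlock_bracket_mem hx hy
  left_abelian _ hx _ hy := slBlock_abelian hx hy
  right_abelian _ hx _ hy := slBlock_abelian hx hy

/-- The upper right block as a matrix in `sl(n,n)`. -/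
def slUpper (P : Matrix (Fin n) (Fin n) k) : (slSuper k n).carrier :=
  ⟨Matrix.fromBlocks 0 P 0 0, LinearMap.mem_ker.mpr (supertrace_odd (by
    rintro (a | a) (b | b) h <;> first | rfl | simp at h))⟩

/-- The lower left block as a matrix in `sl(n,n)`. -/
def slLower (P : Matrix (Fin n) (Fin n) k) : (slSuper k n).carrier :=
  ⟨Matrix.fromBlocks 0 0 P 0, LinearMap.mem_ker.mpr (supertrace_odd (by
    rintro (a | a) (b | b) h <;> first | rfl | simp at h))⟩

/-- The block diagonal matrix with given blocks. -/
def glDiag : Matrix (Fin n) (Fin n) k × Matrix (Fin n) (Fin n) k →ₗ[k] Gl k n where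
  toFun P := Matrix.fromBlocks P.1 0 0 P.2
  map_add' P Q := by
    have := Matrix.fromBlocks_add P.1 (0 : Matrix (Fin n) (Fin n) k)
      (0 : Matrix (Fin n) (Fin n) k) P.2 Q.1 0 0 Q.2
    simp only [add_zero] at this
    exact this.symm
  map_smul' t P := by
    have := Matrix.fromBlocks_smul t P.1 (0 : Matrix (Fin n) (Fin n) k)
      (0 : Matrix (Fin n) (Fin n) k) P.2
    simp only [smul_zero] at this
    exact this.symm

theorem coe_bracket_slUpper_slLower (P Q : Matrix (Fin n) (Fin n) k) :
    ((bracket (k := k) (slUpper P) (slLower Q) : (slSuper k n).carrier) : Gl k n) =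
      glDiag (P * Q, Q * P) := by
  change glBracket k n (slUpper P).1 (slLower Q).1 = _
  rw [glBracket_apply (i := 1) (j := 1) (by rintro (a | a) (b | b) h <;> first | rfl | simp at h)
    (by rintro (a | a) (b | b) h <;> first | rfl | simp at h), superSign, if_pos ⟨rfl, rfl⟩,
    neg_one_smul, sub_neg_eq_add]
  have h : (Matrix.fromBlocks 0 P 0 0 * Matrix.fromBlocks 0 0 Q 0 +
      Matrix.fromBlocks 0 0 Q 0 * Matrix.fromBlocks 0 P 0 0 :
        Matrix (Fin n ⊕ Fin n) (Fin n ⊕ Fin n) k) = Matrix.fromBlocks (P * Q) 0 0 (Q * P) := by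
    rw [Matrix.fromBlocks_multiply, Matrix.fromBlocks_multiply, Matrix.fromBlocks_add]
    simp
  exact h

/-- Supertrace zero means that the diagonal blocks X₀ and X₁ have equal trace. Bracketing 1 with X₁
gives diag(X₁, X₁). The traceless remainder X₀ - X₁ is a combination of commutators PQ - QP, and
diag(PQ - QP, 0) is the bracket diag(PQ, QP) minus the bracket diag(QP, QP). -/
theorem part_zero_slSuper_le_span_bracket (hn : 1 ≤ n) :
    (part 0 : Submodule k (slSuper k n).carrier) ≤
      Submodule.span k {z | ∃ x y : (slSuper k n).carrier, z = bracket (k := k) x y} := by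
  intro X hX
  let z : Fin n := ⟨0, hn⟩
  let E : Fin n → Fin n → Matrix (Fin n) (Fin n) k := fun i j => Matrix.single i j 1
  let X₀ : Matrix (Fin n) (Fin n) k := fun a b => (X : Gl k n) (Sum.inl a) (Sum.inl b)
  let X₁ : Matrix (Fin n) (Fin n) k := fun a b => (X : Gl k n) (Sum.inr a) (Sum.inr b)
  have hXb : (X : Gl k n) = glDiag (X₀, X₁) := by
    funext a b
    rcases a with a | a <;> rcases b with b | b
    · rfl
    · exact hX _ _ (by simp)
    · exact hX _ _ (by simp)
    · rfl
  have htr : (X₀ - X₁).trace = 0 := by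
    rw [Matrix.trace_sub]
    exact LinearMap.mem_ker.mp X.2
  -- E i z * E z j is the matrix unit at (i, j), while E z j * E i z is E z z for i = j and 0
  -- otherwise, so the second terms add up to the trace, which is 0. A fixed index z, available as n
  -- ≥ 1, treats diagonal and off-diagonal entries alike.
  have hZ : ∑ i, ∑ j, (X₀ - X₁) i j • (E i z * E z j - E z j * E i z) = X₀ - X₁ := by
    have h1 : ∑ i, ∑ j, (X₀ - X₁) i j • (E i z * E z j) = X₀ - X₁ := by
      conv_rhs => rw [Matrix.matrix_eq_sum_single (X₀ - X₁)]
      simp [E]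
    have h2 : ∑ i, ∑ j, (X₀ - X₁) i j • (E z j * E i z) = (X₀ - X₁).trace • E z z := by
      rw [Matrix.trace, Finset.sum_smul]
      refine Finset.sum_congr rfl fun i _ => ?_
      rw [Finset.sum_eq_single i]
      · simp [E]
      · intro j _ hj
        simp [E, hj]
      · simp
    simp only [smul_sub, Finset.sum_sub_distrib]
    rw [h1, h2, htr, zero_smul, sub_zero]
  have hXeq : X = bracket (k := k) (slUpper 1) (slLower X₁) + ∑ i, ∑ j, (X₀ - X₁) i j •
      (bracket (k := k) (slUpper (E i z)) (slLower (E z j)) -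
        bracket (k := k) (slUpper 1) (slLower (E z j * E i z))) := by
    apply Subtype.ext
    let ℓ : Matrix (Fin n) (Fin n) k →ₗ[k] Gl k n := glDiag ∘ₗ LinearMap.inl k _ _
    have h1 : ∀ P Q : Matrix (Fin n) (Fin n) k, (slSuper k n).carrier.subtype
        (bracket (k := k) (slUpper P) (slLower Q) - bracket (k := k) (slUpper 1) (slLower (Q * P))) =
          ℓ (P * Q - Q * P) := by
      intro P Q
      rw [map_sub, Submodule.subtype_apply, Submodule.subtype_apply, coe_bracket_slUpper_slLower,
        coe_bracket_slUpper_slLower, one_mul, mul_one, ← map_sub, Prod.mk_sub_mk, sub_self]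
      rfl
    have h2 := map_add (slSuper k n).carrier.subtype (bracket (k := k) (slUpper 1) (slLower X₁))
      (∑ i, ∑ j, (X₀ - X₁) i j • (bracket (k := k) (slUpper (E i z)) (slLower (E z j)) -
        bracket (k := k) (slUpper 1) (slLower (E z j * E i z))))
    refine Eq.trans ?_ h2.symm
    simp only [map_sum, map_smul, h1]
    simp only [← map_smul, ← map_sum]
    rw [hZ, Submodule.subtype_apply, coe_bracket_slUpper_slLower, one_mul, mul_one, hXb, LinearMap.comp_apply,
      ← map_add, LinearMap.inl_apply, Prod.mk_add_mk, add_sub_cancel, add_zero]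
  rw [hXeq]
  refine Submodule.add_mem _ (Submodule.subset_span ⟨_, _, rfl⟩) (Submodule.sum_mem _ fun i _ =>
    Submodule.sum_mem _ fun j _ => Submodule.smul_mem _ _ (Submodule.sub_mem _
      (Submodule.subset_span ⟨_, _, rfl⟩) (Submodule.subset_span ⟨_, _, rfl⟩)))

theorem finiteDimensional_slSuper : FiniteDimensional k (slSuper k n).carrier := by
  have : FiniteDimensional k (Gl k n) :=
    inferInstanceAs (FiniteDimensional k (Matrix (Fin n ⊕ Fin n) (Fin n ⊕ Fin n) k))
  infer_instance

end Sl

end LieSuperalgebra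

end

/-! ### The theorem. -/

theorem mainTheorem8 {k : Type u} [Field k] [IsAlgClosed k] [CharZero k]
    {L : Type v} [AddCommGroup L] [Module k L] [LieSuperalgebra k L]
    (hL : (LieSuperalgebra.IsBasicClassical k L ∧ LieSuperalgebra.IsTypeI k L) ∨
      ∃ n : ℕ, 1 ≤ n ∧
        Nonempty (LieSuperalgebra.Iso k L (LieSuperalgebra.slSuper k n).carrier))
    (A : Type w) [CommRing A] [Algebra k A] [Algebra.FiniteType k A] :
    Nonempty (LieSuperalgebra.DistinguishedGrading k L) ∧
    ∀ (D : LieSuperalgebra.DistinguishedGrading k L)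
      (M : Type z) [AddCommGroup M] [Module k M]
      [LieRingModule (A ⊗[k] (LieSuperalgebra.part 0 : Submodule k L)) M]
      [LieModule k (A ⊗[k] (LieSuperalgebra.part 0 : Submodule k L)) M]
      [LieModule.IsIrreducible k (A ⊗[k] (LieSuperalgebra.part 0 : Submodule k L)) M]
      [FiniteDimensional k M],
      IsCoatom (D.maxSubmodule A M) ∧
      annMapModule k A (LieSuperalgebra.part 0 : Submodule k L) M = D.annKacQuotient A M ∧
      (FiniteDimensional k (D.KacQuotient A M) ↔
        IsGeneralizedEvaluation k A (LieSuperalgebra.part 0 : Submodule k L) M) := by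
  -- Three facts through which the two families are treated alike: the splitting yields a grading,
  -- and the other two serve the finiteness criterion for every grading.
  have hmain : (∃ S T : Submodule k L, LieSuperalgebra.OddSplitting S T) ∧
      FiniteDimensional k L ∧ (LieSuperalgebra.part 0 : Submodule k L) ≤
        Submodule.span k {z | ∃ x y : L, z = LieSuperalgebra.bracket (k := k) x y} := by
    rcases hL with ⟨⟨⟨hfin, hsimple, -⟩, -⟩, htype⟩ | ⟨n, hn, ⟨φ⟩⟩
    · exact ⟨hsimple.exists_oddSplitting htype, hfin,
        le_top.trans hsimple.span_bracket_eq_top.ge⟩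
    · have := LieSuperalgebra.finiteDimensional_slSuper (k := k) (n := n)
      exact ⟨⟨_, _, LieSuperalgebra.oddSplitting_slBlock.comap φ⟩,
        φ.toLinearEquiv.symm.finiteDimensional,
        φ.part_zero_le_span_bracket (LieSuperalgebra.part_zero_slSuper_le_span_bracket hn)⟩
  obtain ⟨⟨S, T, h⟩, hfin, hspan⟩ := hmain
  refine ⟨⟨h.grading⟩, fun D M _ _ _ _ _ _ => ⟨D.isCoatom_maxSubmodule A M,
    D.annMapModule_eq_annKacQuotient A M, ?_⟩⟩
  rw [D.finiteDimensional_kacQuotient_iff A M hspan, isGeneralizedEvaluation_iff]
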